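/- Work over $\mathbb C$ on the projective plane $\mathbb P^2$. Let $Q=T_{\mathbb P^2}(-1)$ be the universal quotient bundle, i.e. the cokernel of the Euler map $(x_0,x_1,x_2):\mathcal O_{\mathbb P^2}(-1)\to\mathcal O_{\mathbb P^2}^{3}$. Let $a,b\ge 0$ and $d_1,\dots,d_a\ge 1$ be integers, and set $$F=\bigoplus_{j=1}^{a}\mathcal O_{\mathbb P^2}(d_j)\ \oplus\ Q^{\oplus b}.$$ Let $E$ be a vector bundle of rank $2$ on $\mathbb P^2$ which is a quotient of $F$ by trivial sections, i.e. for some $s\ge 0$ there is a short exact sequence $$0\to\mathcal O_{\mathbb P^2}^{\,s}\to F\to E\to 0 .$$ Then $E$ is m-effective: there are an integer $c\ge 1$ and a skew-symmetric matrix $A$ of size $2c+2$, whose entries are linear forms in $3$ variables, which has constant rank $2c$ (every specialization of $A$ at a nonzero point of $\mathbb C^3$ has rank $2c$), and such that $E$ is isomorphic to the cokernel of $A:\mathcal O_{\mathbb P^2}(-1)^{2c+2}\to\mathcal O_{\mathbb P^2}^{2c+2}$. More precisely, this holds with $c=b+\sum_{j}d_j$, which is $c_1(E)$. -/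

import Mathlib

open CategoryTheory CategoryTheory.Limits AlgebraicGeometry TopologicalSpace Opposite

noncomputable section

namespace PlaneBundle

/-- The homogeneous coordinate ring `ℂ[x₀, x₁, x₂]`. -/
abbrev S : Type := MvPolynomial (Fin 3) ℂ

/-- Its standard grading: `grading k` consists of the homogeneous polynomials of degree `k`. -/
abbrev grading : ℕ → Submodule ℂ S := MvPolynomial.homogeneousSubmodule (Fin 3) ℂ

instance : GradedAlgebra grading := MvPolynomial.gradedAlgebra

/-- The projective plane over `ℂ`, as a scheme. -/
abbrev P2 : Scheme := Proj grading

/-- The local ring `S_𝔭` at the homogeneous prime `𝔭` of a point (all fractions, of any degree). -/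
abbrev Loc (x : ProjectiveSpectrum grading) : Type :=
  Localization x.asHomogeneousIdeal.toIdeal.primeCompl

/-- The fraction `a / b` in `S_𝔭`, for `b ∉ 𝔭`. -/
abbrev frac (x : ProjectiveSpectrum grading) (a b : S) (hb : b ∉ x.asHomogeneousIdeal) : Loc x :=
  Localization.mk a ⟨b, hb⟩

lemma frac_add (x : ProjectiveSpectrum grading) (a b a' b' : S) (hb : b ∉ x.asHomogeneousIdeal)
    (hb' : b' ∉ x.asHomogeneousIdeal) (hbb : b * b' ∉ x.asHomogeneousIdeal) :
    frac x a b hb + frac x a' b' hb' = frac x (b' * a + b * a') (b * b') hbb := by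
  rw [frac, frac, Localization.add_mk, frac]
  congr 1
  simp only
  ring

lemma frac_mul (x : ProjectiveSpectrum grading) (a b a' b' : S) (hb : b ∉ x.asHomogeneousIdeal)
    (hb' : b' ∉ x.asHomogeneousIdeal) (hbb : b * b' ∉ x.asHomogeneousIdeal) :
    frac x a b hb * frac x a' b' hb' = frac x (a * a') (b * b') hbb :=
  Localization.mk_mul _ _ _ _

lemma mul_notMem (x : ProjectiveSpectrum grading) {b b' : S} (hb : b ∉ x.asHomogeneousIdeal)
    (hb' : b' ∉ x.asHomogeneousIdeal) : b * b' ∉ x.asHomogeneousIdeal :=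
  x.asHomogeneousIdeal.toIdeal.primeCompl.mul_mem hb hb'

lemma one_notMem (x : ProjectiveSpectrum grading) : (1 : S) ∉ x.asHomogeneousIdeal :=
  x.asHomogeneousIdeal.toIdeal.primeCompl.one_mem

lemma pow_notMem (x : ProjectiveSpectrum grading) {b : S} (hb : b ∉ x.asHomogeneousIdeal)
    (n : ℕ) : b ^ n ∉ x.asHomogeneousIdeal :=
  pow_mem (show b ∈ x.asHomogeneousIdeal.toIdeal.primeCompl from hb) n

/-- A polynomial, seen as an element of `S_𝔭`. -/
abbrev polyAt (x : ProjectiveSpectrum grading) (p : S) : Loc x := frac x p 1 (one_notMem x)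

/-- The local ring of `Proj`: its elements are the fractions of degree `0` in `S_𝔭`. -/
abbrev HLoc (x : ProjectiveSpectrum grading) : Type :=
  HomogeneousLocalization.AtPrime grading x.asHomogeneousIdeal.toIdeal

/-- The fraction `a / b` with `deg a = deg b`, as an element of the local ring of `Proj`. -/
def homFrac (x : ProjectiveSpectrum grading) {k : ℕ} (a b : S) (ha : a ∈ grading k)
    (hb : b ∈ grading k) (hx : b ∉ x.asHomogeneousIdeal) :
    HLoc x :=
  .mk ⟨k, ⟨a, ha⟩, ⟨b, hb⟩, hx⟩

lemma val_homFrac (x : ProjectiveSpectrum grading) {k : ℕ} (a b : S) (ha : a ∈ grading k)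
    (hb : b ∈ grading k) (hx : b ∉ x.asHomogeneousIdeal) :
    (homFrac x a b ha hb hx).val = frac x a b hx :=
  HomogeneousLocalization.val_mk _

lemma val_inj (x : ProjectiveSpectrum grading) {y z : HLoc x}
    (h : (y.val : Loc x) = z.val) : y = z :=
  HomogeneousLocalization.val_injective _ h

/-! ### The twisting sheaves `𝒪(d)`

A section of `𝒪(d)` over `U` is a function `x ↦ f x ∈ S_{𝔭ₓ}` on `U` which is locally a fraction
`a / b` of homogeneous polynomials with `deg a = deg b + d`. -/

/-- `f` is a single fraction `a / b` of degree `d`. -/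
def IsTwistedFraction (d : ℤ) {U : Opens (ProjectiveSpectrum.top grading)}
    (f : ∀ x : U, Loc x.1) : Prop :=
  ∃ (i j : ℕ) (a b : S), (i : ℤ) = j + d ∧ a ∈ grading i ∧ b ∈ grading j ∧
    ∃ hb : ∀ x : U, b ∉ x.1.asHomogeneousIdeal, ∀ x : U, f x = frac x.1 a b (hb x)

lemma IsTwistedFraction.res {d : ℤ} {U V : Opens (ProjectiveSpectrum.top grading)}
    {f : ∀ x : U, Loc x.1} (h : IsTwistedFraction d f) (i : V ⟶ U) :
    IsTwistedFraction d (fun x : V => f (i x)) := by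
  obtain ⟨k, l, a, b, hd, ha, hb, hx, w⟩ := h
  exact ⟨k, l, a, b, hd, ha, hb, fun x => hx (i x), fun x => w (i x)⟩

/-- `IsTwistedFraction` as a prelocal predicate (it is stable under restriction). -/
def isTwistedFractionPrelocal (d : ℤ) :
    TopCat.PrelocalPredicate fun x : ProjectiveSpectrum.top grading => Loc x where
  pred f := IsTwistedFraction d f
  res i _ h := h.res i

/-- `f` is locally a fraction of degree `d`. -/
def isLocallyTwistedFraction (d : ℤ) :
    TopCat.LocalPredicate fun x : ProjectiveSpectrum.top grading => Loc x :=
  (isTwistedFractionPrelocal d).sheafify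

lemma IsTwistedFraction.add {d : ℤ} {U : Opens (ProjectiveSpectrum.top grading)}
    {f g : ∀ x : U, Loc x.1} (hf : IsTwistedFraction d f) (hg : IsTwistedFraction d g) :
    IsTwistedFraction d (f + g) := by
  obtain ⟨i, j, a, b, hd, ha, hb, hx, w⟩ := hf
  obtain ⟨i', j', a', b', hd', ha', hb', hx', w'⟩ := hg
  refine ⟨i + j', j + j', b' * a + b * a', b * b', by push_cast; omega, ?_, ?_, ?_, ?_⟩
  · refine add_mem ?_ ?_
    · rw [add_comm i j']; exact SetLike.mul_mem_graded hb' ha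
    · have : i + j' = j + i' := by omega
      rw [this]; exact SetLike.mul_mem_graded hb ha'
  · exact SetLike.mul_mem_graded hb hb'
  · exact fun x => mul_notMem x.1 (hx x) (hx' x)
  · intro x
    exact (congrArg₂ (· + ·) (w x) (w' x)).trans (frac_add x.1 a b a' b' _ _ _)

lemma IsTwistedFraction.mul {d e : ℤ} {U : Opens (ProjectiveSpectrum.top grading)}
    {f g : ∀ x : U, Loc x.1} (hf : IsTwistedFraction d f) (hg : IsTwistedFraction e g) :
    IsTwistedFraction (d + e) (f * g) := by
  obtain ⟨i, j, a, b, hd, ha, hb, hx, w⟩ := hf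
  obtain ⟨i', j', a', b', hd', ha', hb', hx', w'⟩ := hg
  refine ⟨i + i', j + j', a * a', b * b', by push_cast; omega, SetLike.mul_mem_graded ha ha',
    SetLike.mul_mem_graded hb hb', fun x => mul_notMem x.1 (hx x) (hx' x), ?_⟩
  intro x
  exact (congrArg₂ (· * ·) (w x) (w' x)).trans (frac_mul x.1 a b a' b' _ _ _)

lemma isTwistedFraction_poly {k : ℕ} {p : S} (hp : p ∈ grading k)
    (U : Opens (ProjectiveSpectrum.top grading)) :
    IsTwistedFraction (U := U) k (fun x => polyAt x.1 p) :=
  ⟨k, 0, p, 1, by simp, hp, SetLike.one_mem_graded _, fun x => one_notMem x.1, fun _ => rfl⟩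

lemma isTwistedFraction_zero (d : ℤ) {x : ProjectiveSpectrum.top grading} :
    ∃ U : Opens (ProjectiveSpectrum.top grading), x ∈ U ∧
      ∀ V ≤ U, IsTwistedFraction (U := V) d 0 := by
  obtain ⟨f, m, hf, hm, hx⟩ : ∃ (f : S) (m : ℕ) (_ : f ∈ grading m) (_ : 0 < m),
      f ∉ x.asHomogeneousIdeal := by
    classical
    by_contra! h
    refine x.not_irrelevant_le fun z hz => ?_
    rw [← DirectSum.sum_support_decompose grading z]
    exact x.asHomogeneousIdeal.toIdeal.sum_mem fun k hk =>
      h _ k (SetLike.coe_mem _) (by_contra fun hk' => by aesop)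
  refine ⟨ProjectiveSpectrum.basicOpen grading f, hx, fun V hV => ?_⟩
  have hmn : d.natAbs ≤ d.natAbs * m := Nat.le_mul_of_pos_right _ hm
  refine ⟨((d.natAbs * m : ℕ) + d).toNat, d.natAbs * m, 0, f ^ d.natAbs, by omega, zero_mem _,
    ?_, fun y => ?_, fun y => (Localization.mk_zero _).symm⟩
  · simpa using SetLike.pow_mem_graded d.natAbs hf
  · exact pow_notMem y.1 (hV y.2) _

lemma isLocallyTwistedFraction_poly {k : ℕ} {p : S} (hp : p ∈ grading k)
    (U : Opens (ProjectiveSpectrum.top grading)) :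
    (isLocallyTwistedFraction k).pred (fun x : U => polyAt x.1 p) := fun x =>
  ⟨U, x.2, 𝟙 _, (isTwistedFraction_poly hp U).res (𝟙 U)⟩

/-- The sections of the structure sheaf, seen as functions with values in the `S_𝔭`. -/
def structureValue {U : (Opens (ProjectiveSpectrum.top grading))ᵒᵖ}
    (r : (ProjectiveSpectrum.Proj.structureSheaf grading).1.obj U) : ∀ x : U.unop, Loc x.1 :=
  fun x => (r.1 x).val

lemma isLocallyTwistedFraction_structureValue {U : (Opens (ProjectiveSpectrum.top grading))ᵒᵖ}
    (r : (ProjectiveSpectrum.Proj.structureSheaf grading).1.obj U) :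
    (isLocallyTwistedFraction 0).pred (structureValue r) := fun x => by
  obtain ⟨V, hV, i, n, a, b, hb, w⟩ := r.2 x
  refine ⟨V, hV, i, n, n, a.1, b.1, by simp, a.2, b.2, hb, fun y => ?_⟩
  have := congrArg HomogeneousLocalization.val (w y)
  simpa [structureValue] using this

lemma isLocallyTwistedFraction_mul {d e : ℤ} {U : Opens (ProjectiveSpectrum.top grading)}
    {f g : ∀ x : U, Loc x.1} (hf : (isLocallyTwistedFraction d).pred f)
    (hg : (isLocallyTwistedFraction e).pred g) :
    (isLocallyTwistedFraction (d + e)).pred (f * g) := fun x => by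
  obtain ⟨V, hV, i, h⟩ := hf x
  obtain ⟨V', hV', i', h'⟩ := hg x
  exact ⟨V ⊓ V', ⟨hV, hV'⟩, Opens.infLELeft _ _ ≫ i,
    (h.res (Opens.infLELeft V V')).mul (h'.res (Opens.infLERight V V'))⟩

/-- The sections of `𝒪(d)` over `U`. -/
def twistSections (d : ℤ) (U : (Opens (ProjectiveSpectrum.top grading))ᵒᵖ) :
    AddSubgroup (∀ x : U.unop, Loc x.1) where
  carrier := {f | (isLocallyTwistedFraction d).pred f}
  zero_mem' := fun x => by
    obtain ⟨V, hV, h⟩ := isTwistedFraction_zero d (x := x.1)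
    exact ⟨V ⊓ U.unop, ⟨hV, x.2⟩, Opens.infLERight _ _, h _ inf_le_left⟩
  add_mem' := fun {f g} hf hg x => by
    obtain ⟨V, hV, i, h⟩ := hf x
    obtain ⟨V', hV', i', h'⟩ := hg x
    exact ⟨V ⊓ V', ⟨hV, hV'⟩, Opens.infLELeft _ _ ≫ i,
      (h.res (Opens.infLELeft V V')).add (h'.res (Opens.infLERight V V'))⟩
  neg_mem' := fun {f} hf x => by
    obtain ⟨V, hV, i, k, l, a, b, hd, ha, hb, hx, w⟩ := hf x
    refine ⟨V, hV, i, k, l, -a, b, hd, neg_mem ha, hb, hx, fun y => ?_⟩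
    have := w y
    exact (congrArg (fun z => -z) this).trans (Localization.neg_mk _ _)

/-- `𝒪(d)` as a sheaf of sets. -/
def twistInType (d : ℤ) : TopCat.Sheaf Type (ProjectiveSpectrum.top grading) :=
  TopCat.subsheafToTypes (isLocallyTwistedFraction d)

instance (d : ℤ) (U : (Opens (ProjectiveSpectrum.top grading))ᵒᵖ) :
    AddCommGroup ((twistInType d).1.obj U) :=
  inferInstanceAs (AddCommGroup (twistSections d U))

instance twistModule (d : ℤ) (U : (Opens (ProjectiveSpectrum.top grading))ᵒᵖ) :
    Module ((ProjectiveSpectrum.Proj.structureSheaf grading).1.obj U)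
      ((twistInType d).1.obj U) where
  smul r f := ⟨structureValue r * f.1, by
    simpa using isLocallyTwistedFraction_mul (isLocallyTwistedFraction_structureValue r) f.2⟩
  one_smul f := Subtype.ext (funext fun x =>
    (congrArg (· * f.1 x) (HomogeneousLocalization.val_one (𝒜 := grading))).trans (one_mul _))
  mul_smul r s f := Subtype.ext (funext fun x =>
    (congrArg (· * f.1 x) (HomogeneousLocalization.val_mul (r.1 x) (s.1 x))).trans (mul_assoc _ _ _))
  smul_zero r := Subtype.ext (funext fun x => mul_zero _)
  smul_add r f g := Subtype.ext (funext fun x => mul_add _ _ _)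
  add_smul r s f := Subtype.ext (funext fun x =>
    (congrArg (· * f.1 x) (HomogeneousLocalization.val_add (r.1 x) (s.1 x))).trans (add_mul _ _ _))
  zero_smul f := Subtype.ext (funext fun x =>
    (congrArg (· * f.1 x) (HomogeneousLocalization.val_zero (𝒜 := grading))).trans (zero_mul _))

/-- The underlying presheaf of abelian groups of `𝒪(d)`. -/
def twistPresheafAb (d : ℤ) : TopCat.Presheaf Ab.{0} (ProjectiveSpectrum.top grading) where
  obj U := AddCommGrpCat.of ((twistInType d).1.obj U)
  map i := AddCommGrpCat.ofHom
    { toFun := (twistInType d).1.map i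
      map_zero' := rfl
      map_add' := fun _ _ => rfl }

instance (d : ℤ) (U : (Opens P2)ᵒᵖ) :
    Module (P2.ringCatSheaf.obj.obj U) ((twistPresheafAb d).obj U) :=
  twistModule d U

/-- The twisting sheaf `𝒪(d)` on the projective plane, as a sheaf of `𝒪`-modules. -/
def twist (d : ℤ) : P2.Modules where
  val := PresheafOfModules.ofPresheaf (twistPresheafAb d) fun _ _ _ _ _ => rfl
  isSheaf := (TopCat.Presheaf.isSheaf_iff_isSheaf_comp (forget AddCommGrpCat) _).2
    (twistInType d).2

/-- Multiplication by a homogeneous polynomial `p` of degree `k` on sections over `U`. -/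
def twistMulSections {k : ℕ} (p : S) (hp : p.IsHomogeneous k) (d e : ℤ) (h : k + d = e)
    (U : (Opens (ProjectiveSpectrum.top grading))ᵒᵖ) :
    (twistInType d).1.obj U →ₗ[(ProjectiveSpectrum.Proj.structureSheaf grading).1.obj U]
      (twistInType e).1.obj U where
  toFun f := ⟨(fun x : U.unop => polyAt x.1 p) * f.1, by
    subst h
    exact isLocallyTwistedFraction_mul (isLocallyTwistedFraction_poly hp U.unop) f.2⟩
  map_add' f g := Subtype.ext (funext fun x => mul_add (polyAt x.1 p) (f.1 x) (g.1 x))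
  map_smul' r f := Subtype.ext (funext fun x =>
    mul_left_comm (polyAt x.1 p) (structureValue r x) (f.1 x))

/-- Multiplication by a homogeneous polynomial `p` of degree `k`, as a map `𝒪(d) ⟶ 𝒪(d + k)`. -/
def twistMul {k : ℕ} (p : S) (hp : p.IsHomogeneous k) (d e : ℤ) (h : k + d = e) :
    twist d ⟶ twist e where
  val :=
    { app := fun U => ModuleCat.ofHom (R := P2.ringCatSheaf.obj.obj U)
        (X := (twistPresheafAb d).obj U) (Y := (twistPresheafAb e).obj U)
        (twistMulSections p hp d e h U)
      naturality := fun _ => by ext; rfl }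

/-! ### The structure sheaf, and its isomorphism with `𝒪(0)` -/

/-- The structure sheaf of a scheme, as a sheaf of modules over itself. -/
def structureModule (X : Scheme.{0}) : X.Modules := SheafOfModules.unit X.ringCatSheaf

/-- A section of the structure sheaf, as a section of `𝒪(0)`. -/
def toTwistZero (U : (Opens (ProjectiveSpectrum.top grading))ᵒᵖ) :
    (ProjectiveSpectrum.Proj.structureSheaf grading).1.obj U →ₗ[
      (ProjectiveSpectrum.Proj.structureSheaf grading).1.obj U] (twistInType 0).1.obj U where
  toFun r := ⟨structureValue r, isLocallyTwistedFraction_structureValue r⟩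
  map_add' _ _ := Subtype.ext (funext fun _ => HomogeneousLocalization.val_add _ _)
  map_smul' _ _ := Subtype.ext (funext fun _ => HomogeneousLocalization.val_mul _ _)

lemma toTwistZero_bijective (U : (Opens (ProjectiveSpectrum.top grading))ᵒᵖ) :
    Function.Bijective (toTwistZero U) := by
  refine ⟨fun r s h => Subtype.ext (funext fun x => ?_), fun f => ?_⟩
  · exact val_inj x.1 (congrFun (congrArg Subtype.val h) x)
  · have key : ∀ x : U.unop, ∃ z : HLoc x.1, z.val = f.1 x := by
      intro x
      obtain ⟨V, hV, i, k, l, a, b, hd, ha, hb, hx, w⟩ := f.2 x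
      obtain rfl : k = l := by omega
      exact ⟨homFrac x.1 a b ha hb (hx ⟨x.1, hV⟩),
        (val_homFrac x.1 a b ha hb _).trans (w ⟨x.1, hV⟩).symm⟩
    choose z hz using key
    refine ⟨⟨z, fun x => ?_⟩, Subtype.ext (funext hz)⟩
    obtain ⟨V, hV, i, k, l, a, b, hd, ha, hb, hx, w⟩ := f.2 x
    obtain rfl : k = l := by omega
    refine ⟨V, hV, i, k, ⟨a, ha⟩, ⟨b, hb⟩, hx, fun y => val_inj y.1 ?_⟩
    exact (hz (i y)).trans ((w y).trans (val_homFrac y.1 a b ha hb (hx y)).symm)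

/-- `𝒪 ⟶ 𝒪(0)`. -/
def structureToTwistZero : structureModule P2 ⟶ twist 0 where
  val :=
    { app := fun U => ModuleCat.ofHom (R := P2.ringCatSheaf.obj.obj U)
        (X := P2.ringCatSheaf.obj.obj U) (Y := (twistPresheafAb 0).obj U) (toTwistZero U)
      naturality := fun _ => rfl }

instance : IsIso structureToTwistZero := by
  rw [Scheme.Modules.Hom.isIso_iff_isIso_app]
  intro U
  rw [ConcreteCategory.isIso_iff_bijective]
  exact toTwistZero_bijective (op U)

/-! ### Bundles on the plane -/

instance (X : Scheme.{0}) : HasFiniteBiproducts X.Modules := Abelian.hasFiniteBiproducts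

/-- `E` is a vector bundle of rank `r`: locally isomorphic to `𝒪 ^ r`. -/
def IsVectorBundle (E : P2.Modules) (r : ℕ) : Prop :=
  ∀ x : P2, ∃ U : P2.Opens, x ∈ U ∧
    Nonempty (E.restrict U.ι ≅ ⨁ fun _ : Fin r => structureModule U)

/-- The Euler map `𝒪(-1) ⟶ 𝒪 ^ 3` given by the three coordinates. -/
def eulerMap : twist (-1) ⟶ ⨁ fun _ : Fin 3 => twist 0 :=
  biproduct.lift fun i => twistMul (MvPolynomial.X i) (MvPolynomial.isHomogeneous_X ℂ i) (-1) 0 rfl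

/-- The universal quotient bundle `Q = T(-1)`, the cokernel in the Euler sequence
`0 ⟶ 𝒪(-1) ⟶ 𝒪 ^ 3 ⟶ Q ⟶ 0`. -/
def Q : P2.Modules := cokernel eulerMap

/-- `E` is a quotient of `F` by trivial sections: for some `s ≥ 0` there is a short exact sequence
`0 ⟶ 𝒪 ^ s ⟶ F ⟶ E ⟶ 0`. -/
def IsQuotientBySections (F E : P2.Modules) : Prop :=
  ∃ (s : ℕ) (i : (⨁ fun _ : Fin s => structureModule P2) ⟶ F) (p : F ⟶ E) (w : i ≫ p = 0),
    (ShortComplex.mk i p w).ShortExact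

/-- A skew-symmetric `n × n` matrix of linear forms in three variables. -/
structure SkewLinearMatrix (n : ℕ) where
  /-- The matrix. -/
  mat : Matrix (Fin n) (Fin n) S
  linear : ∀ i j, (mat i j).IsHomogeneous 1
  skew : mat.transpose = -mat

namespace SkewLinearMatrix

variable {n : ℕ} (A : SkewLinearMatrix n)

/-- `A` has constant rank `r`: every specialization at a nonzero point of `ℂ³` has rank `r`. -/
def HasConstantRank (r : ℕ) : Prop :=
  ∀ v : Fin 3 → ℂ, v ≠ 0 → (A.mat.map (MvPolynomial.eval v)).rank = r

/-- The map `𝒪(-1) ^ n ⟶ 𝒪 ^ n` given by `A` (acting on column vectors). -/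
def toHom : (⨁ fun _ : Fin n => twist (-1)) ⟶ ⨁ fun _ : Fin n => twist 0 :=
  biproduct.matrix fun j i => twistMul (A.mat i j) (A.linear i j) (-1) 0 rfl

end SkewLinearMatrix

/-- `E` is the cokernel of a skew-symmetric matrix of linear forms in three variables, of size
`2c + 2` and constant rank `2c`. -/
def IsSkewCokernel (c : ℕ) (E : P2.Modules) : Prop :=
  ∃ A : SkewLinearMatrix (2 * c + 2), A.HasConstantRank (2 * c) ∧ Nonempty (E ≅ cokernel A.toHom)

/-- `E` is m-effective. -/
def IsMEffective (E : P2.Modules) : Prop := ∃ c : ℕ, 0 < c ∧ IsSkewCokernel c E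

end PlaneBundle

end

open PlaneBundle

open CategoryTheory CategoryTheory.Limits AlgebraicGeometry TopologicalSpace Opposite

noncomputable section

namespace PlaneBundle

open MvPolynomial (eval)
open Matrix

/-! The problem is reduced to linear algebra over `S`. Replacing each copy of `Q` by its Euler
sequence presents `E` as the cokernel of a matrix `τ = (σ | ε)`, a map `𝒪^s ⊕ 𝒪(-1)^b ⟶ ⨁ 𝒪(dd j)`,
where `dd` lists the `d j` followed by `3b` zeros (`exists_presentation`); trivial sections lift to
the cover because every global section of `Q` comes from `ℂ³`. As `E` is locally free of rank `2`,
the matrix `τ(p)` is injective for all `p ≠ 0` and has `s + b + 2` rows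
(`card_eq_and_mulVec_injective`).

Write `V i` for `degreePart dd i`, the vectors with entries of degree `dd j - i`. If `w ∈ V 1` has
`w(p)` in the image of `τ(p)` for all `p ≠ 0`, then `w = τ q` by a Hartogs argument, and `q = 0` for
degree reasons. So the functionals `w ↦ m · w(p)` with `m τ(p) = 0` span the dual of `V 1`. For a
basis `φ_a` of the dual made of such functionals, `B = ∑ φ_a ⊗ φ_a` is symmetric, perfect on `V 1`,
kills the columns of `τ`, and satisfies `B(f u, v) = B(u, f v)` because it only sees values at
points (`nonempty_relationPairing`). Let `W ⊆ V 0` be the orthogonal of `V 2`. Its dimension is `dim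
V 0 - dim V 2 = ∑ (2 dd j + 1)`, it contains the columns of `σ`, and each column of `ε` is `∑ x_k
e_k` with `e_k ∈ W` (`RelationPairing.exists_orthogonal_of_form_eq_zero`).

For a functional `φ` and linear forms `f, g`, let `⟨φ f⟩ ∈ V 1` represent `v ↦ φ (f v)` under `B`.
Then `f ⟨φ g⟩ - g ⟨φ f⟩` lies in `W`, and pairing it with a second functional `ψ` is skew in `φ, ψ`.
Taking for `φ, ψ` the coordinates of `W` modulo the columns of `σ`, a space of dimension `2 ∑ d j +
b + 2`, gives a skew matrix of linear forms; bordering it by the coordinates of the `e_k` gives `A`,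
of size `2c + 2`. With `Φ` the matrix of the basis of `W` modulo `σ`, the identity `x · (x × w) = 0`
becomes `Φ A = τ Ψ`.

If `p` is the common zero of two linear forms, the kernel of `A(p)` is exactly the set of `y Φ(p)`
with `y τ(p) = 0` (`OrthogonalFrame.exists_of_skewMatrix_mulVec_eq_zero`). This gives the rank, and
by skew-symmetry the exactness of the presentation by `A` on fibres (`exists_skewLinearMatrix`). A
Nakayama argument at closed points carries this to sheaves (`nonempty_iso_cokernel`). -/

lemma SheafOfModules.isLocallySurjective_of_epi {C : Type} [SmallCategory C]
    {J : GrothendieckTopology C} (R : Sheaf J RingCat.{0}) [HasSheafify J AddCommGrpCat.{0}]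
    [J.WEqualsLocallyBijective AddCommGrpCat.{0}] {M N : SheafOfModules.{0} R} (f : M ⟶ N)
    [Epi f] : PresheafOfModules.IsLocallySurjective J f.val := by
  let F : SheafOfModules.{0} R ⥤ PresheafOfModules.{0} R.obj :=
    SheafOfModules.forget R ⋙ PresheafOfModules.restrictScalars (𝟙 R.obj)
  let adj := PresheafOfModules.sheafificationAdjunction (𝟙 R.obj)
  let fP : F.obj M ⟶ F.obj N := F.map f
  -- The map from the target of `f` to the sheafification of the presheaf cokernel vanishes, since
  -- `f` is epi among sheaves. So a section of the presheaf cokernel dies locally, that is, it lifts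
  -- locally.
  let P := cokernel fP
  obtain ⟨ψ, hψ⟩ := F.map_surjective (cokernel.π fP ≫ adj.unit.app P)
  have hF0 (A B : SheafOfModules.{0} R) : F.map (0 : A ⟶ B) = 0 := by
    ext U x
    rfl
  have h0 : f ≫ ψ = 0 := by
    apply F.map_injective
    rw [F.map_comp, hψ, cokernel.condition_assoc, zero_comp, hF0]
  have hψ0 : ψ = 0 := (cancel_epi f).1 (h0.trans comp_zero.symm)
  have hz : cokernel.π fP ≫ adj.unit.app P = 0 := by rw [← hψ, hψ0, hF0]
  refine ⟨fun {U} y₀ => ?_⟩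
  let y : (F.obj N).obj (op U) := y₀
  have hy : (adj.unit.app P).app (op U) ((cokernel.π fP).app (op U) y) = 0 :=
    ConcreteCategory.congr_hom (congrArg (fun φ => φ.app (op U)) hz) y
  have h := Presheaf.equalizerSieve_mem J (CategoryTheory.toSheafify J P.presheaf) (X := op U)
    ((cokernel.π fP).app (op U) y) 0 ((hy : _).trans (map_zero _).symm)
  refine J.superset_covering ?_ h
  intro V i hi
  have hi' : P.presheaf.map i.op ((cokernel.π fP).app (op U) y) = P.presheaf.map i.op 0 := hi
  rw [map_zero] at hi'
  have hi2 : (cokernel.π fP).app (op V) ((F.obj N).presheaf.map i.op y) = 0 :=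
    (PresheafOfModules.naturality_apply (cokernel.π fP) i.op y).trans hi'
  have hex : (ShortComplex.mk fP (cokernel.π fP) (cokernel.condition fP)).Exact :=
    ShortComplex.exact_cokernel fP
  have hex2 := hex.map (PresheafOfModules.evaluation R.obj (op V))
  rw [ShortComplex.moduleCat_exact_iff] at hex2
  obtain ⟨z, hz⟩ := hex2 _ hi2
  exact ⟨z, hz⟩

/-! ### Epimorphisms and exactness of sheaves of modules, tested on local sections. -/

section Sections

variable {X : Scheme.{0}}

/-- Sections over `U`, as a functor to abelian groups. -/
def sectionsFunctor (U : X.Opens) : X.Modules ⥤ Ab.{0} :=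
  Scheme.Modules.toPresheaf X ⋙ (evaluation (Opens X)ᵒᵖ Ab.{0}).obj (op U)

instance (U : X.Opens) : PreservesFiniteLimits (sectionsFunctor U) :=
  have : PreservesFiniteLimits ((evaluation (Opens X)ᵒᵖ Ab.{0}).obj (op U)) := inferInstance
  comp_preservesFiniteLimits (Scheme.Modules.toPresheaf X)
    ((evaluation (Opens X)ᵒᵖ Ab.{0}).obj (op U))

instance (U : X.Opens) : (sectionsFunctor U).Additive where

lemma app_injective_of_mono {M N : X.Modules} (f : M ⟶ N) [Mono f] (U : X.Opens) :
    Function.Injective (f.app U) := by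
  have : Mono ((sectionsFunctor U).map f) := inferInstance
  exact (AddCommGrpCat.mono_iff_injective _).1 this

/-- `f` is surjective on sections, locally. -/
def LocSurj {M N : X.Modules} (f : M ⟶ N) : Prop :=
  ∀ (U : X.Opens) (y : Γ(N, U)) (x : X), x ∈ U → ∃ (V : X.Opens) (i : V ⟶ U), x ∈ V ∧
    ∃ z : Γ(M, V), f.app V z = N.presheaf.map i.op y

/-- Sections killed by `g` come locally from `f`. -/
def LocExact {M N K : X.Modules} (f : M ⟶ N) (g : N ⟶ K) : Prop :=
  ∀ (U : X.Opens) (y : Γ(N, U)), g.app U y = 0 → ∀ x ∈ U, ∃ (V : X.Opens) (i : V ⟶ U), x ∈ V ∧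
    ∃ z : Γ(M, V), f.app V z = N.presheaf.map i.op y

lemma exists_kernel_section {M N : X.Modules} (g : M ⟶ N) (U : X.Opens) (y : Γ(M, U))
    (hy : g.app U y = 0) : ∃ z : Γ(kernel g, U), (kernel.ι g).app U z = y := by
  let S : ShortComplex X.Modules := ShortComplex.mk (kernel.ι g) g (kernel.condition g)
  have hS : S.Exact := ShortComplex.exact_kernel g
  have : Mono S.f := inferInstanceAs (Mono (kernel.ι g))
  have h2 := hS.map_of_mono_of_preservesKernel (sectionsFunctor U) inferInstance inferInstance
  rw [ShortComplex.ab_exact_iff] at h2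
  exact h2 y hy

lemma app_map {M N : X.Modules} (f : M ⟶ N) {U V : X.Opens} (i : V ⟶ U) (y : Γ(M, U)) :
    f.app V (M.presheaf.map i.op y) = N.presheaf.map i.op (f.app U y) :=
  ConcreteCategory.congr_hom (f.mapPresheaf.naturality i.op) y

lemma epi_of_locSurj {M N : X.Modules} (f : M ⟶ N) (h : LocSurj f) : Epi f := by
  have hs : TopCat.Presheaf.IsLocallySurjective f.mapPresheaf := by
    rw [TopCat.Presheaf.isLocallySurjective_iff]
    intro U t x hx
    obtain ⟨V, i, hV, z, hz⟩ := h U t x hx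
    exact ⟨V, leOfHom i, ⟨z, hz⟩, hV⟩
  have : Epi ((SheafOfModules.toSheaf X.ringCatSheaf).map f) := by
    rw [← CategoryTheory.Sheaf.isLocallySurjective_iff_epi']
    exact hs
  exact (SheafOfModules.toSheaf X.ringCatSheaf).epi_of_epi_map this

lemma locSurj_of_epi {M N : X.Modules} (f : M ⟶ N) [hf : Epi f] : LocSurj f := by
  have : Epi (C := SheafOfModules X.ringCatSheaf) f := hf
  have hs : TopCat.Presheaf.IsLocallySurjective f.mapPresheaf :=
    SheafOfModules.isLocallySurjective_of_epi X.ringCatSheaf (M := M) (N := N) f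
  intro U y x hx
  obtain ⟨V, i, ⟨z, hz⟩, hV⟩ := (TopCat.Presheaf.isLocallySurjective_iff _).1 hs U y x hx
  exact ⟨V, homOfLE i, hV, z, hz⟩

lemma exact_of_locExact {M N K : X.Modules} (f : M ⟶ N) (g : N ⟶ K) (w : f ≫ g = 0)
    (h : LocExact f g) : (ShortComplex.mk f g w).Exact := by
  rw [ShortComplex.exact_iff_epi_kernel_lift]
  refine epi_of_locSurj _ fun U y x hx => ?_
  have hy : g.app U ((kernel.ι g).app U y) = 0 := by
    have := congrArg (fun φ => φ.app U) (kernel.condition g)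
    exact ConcreteCategory.congr_hom this y
  obtain ⟨V, i, hV, z, hz⟩ := h U _ hy x hx
  refine ⟨V, i, hV, z, app_injective_of_mono (kernel.ι g) V ?_⟩
  have h1 : (kernel.ι g).app V ((kernel.lift g f w).app V z) = f.app V z := by
    have := congrArg (fun φ => φ.app V) (kernel.lift_ι g f w)
    exact ConcreteCategory.congr_hom this z
  exact h1.trans (hz.trans (app_map _ _ _).symm)

lemma locExact_of_exact {M N K : X.Modules} (f : M ⟶ N) (g : N ⟶ K) (w : f ≫ g = 0)
    (h : (ShortComplex.mk f g w).Exact) : LocExact f g := by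
  intro U y hy x hx
  have : Epi (kernel.lift g f w) := (ShortComplex.exact_iff_epi_kernel_lift _).1 h
  obtain ⟨t, ht⟩ := exists_kernel_section g U y hy
  obtain ⟨V, i, hV, z, hz⟩ := locSurj_of_epi (kernel.lift g f w) U t x hx
  refine ⟨V, i, hV, z, ?_⟩
  have h1 : (kernel.ι g).app V ((kernel.lift g f w).app V z) = f.app V z := by
    have := congrArg (fun φ => φ.app V) (kernel.lift_ι g f w)
    exact ConcreteCategory.congr_hom this z
  rw [← h1, hz, app_map, ht]

end Sections

/-! ### Closed points, the generic point and specialization on the plane. -/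

section Points

/-- Restriction of polynomials to the line spanned by `p`. -/
def lineRestriction (p : Fin 3 → ℂ) : S →ₐ[ℂ] Polynomial ℂ :=
  MvPolynomial.aeval fun i => Polynomial.C (p i) * Polynomial.X

lemma lineRestriction_of_isHomogeneous (p : Fin 3 → ℂ) {f : S} {k : ℕ} (hf : f.IsHomogeneous k) :
    lineRestriction p f = Polynomial.C (eval p f) * Polynomial.X ^ k := by
  rw [lineRestriction, MvPolynomial.aeval_def, MvPolynomial.eval₂_eq, MvPolynomial.eval_eq,
    map_sum, Finset.sum_mul]
  refine Finset.sum_congr rfl fun m hm => ?_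
  rw [hf.degree_eq_sum_deg_support hm]
  have h : ∏ i ∈ m.support, (Polynomial.C (p i) * Polynomial.X) ^ m i =
      Polynomial.C (∏ i ∈ m.support, p i ^ m i) * Polynomial.X ^ (∑ i ∈ m.support, m i) := by
    simp only [mul_pow, Finset.prod_mul_distrib, Finset.prod_pow_eq_pow_sum, map_prod, map_pow]
  rw [h, map_mul, mul_assoc]
  rfl

lemma lineRestriction_apply (p : Fin 3 → ℂ) (f : S) :
    lineRestriction p f = ∑ k ∈ Finset.range (f.totalDegree + 1),
      Polynomial.C (eval p (MvPolynomial.homogeneousComponent k f)) * Polynomial.X ^ k := by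
  conv_lhs => rw [← MvPolynomial.sum_homogeneousComponent f, map_sum]
  exact Finset.sum_congr rfl fun k _ => lineRestriction_of_isHomogeneous p
    (MvPolynomial.homogeneousComponent_isHomogeneous k f)

lemma lineRestriction_eq_zero_iff (p : Fin 3 → ℂ) (f : S) :
    lineRestriction p f = 0 ↔ ∀ k, eval p (MvPolynomial.homogeneousComponent k f) = 0 := by
  constructor
  · intro h k
    have h2 := congrArg (fun q => Polynomial.coeff q k) ((lineRestriction_apply p f).symm.trans h)
    simp only [Polynomial.finsetSum_coeff, Polynomial.coeff_C_mul, Polynomial.coeff_X_pow,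
      Polynomial.coeff_zero, mul_ite, mul_one, mul_zero, Finset.sum_ite_eq, Finset.mem_range] at h2
    by_cases hk : k < f.totalDegree + 1
    · simpa [hk] using h2
    · rw [MvPolynomial.homogeneousComponent_eq_zero k f (by omega), map_zero]
  · intro h
    rw [lineRestriction_apply]
    exact Finset.sum_eq_zero fun k _ => by rw [h k, map_zero, zero_mul]

lemma decompose_apply (f : S) (i : ℕ) :
    ((DirectSum.decompose grading f i : grading i) : S) =
      MvPolynomial.homogeneousComponent i f :=
  MvPolynomial.decomposition.decompose'_apply f i

lemma X_mem_irrelevant (i : Fin 3) :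
    (MvPolynomial.X i : S) ∈ HomogeneousIdeal.irrelevant grading := by
  rw [HomogeneousIdeal.mem_irrelevant_iff, GradedRing.proj_apply, decompose_apply,
    MvPolynomial.homogeneousComponent_zero]
  simp

/-- The homogeneous ideal of the line spanned by `p`. -/
def lineIdeal (p : Fin 3 → ℂ) : HomogeneousIdeal grading where
  toSubmodule := RingHom.ker (lineRestriction p)
  is_homogeneous' := by
    intro i f hf
    change lineRestriction p _ = 0
    have hf' : lineRestriction p f = 0 := hf
    rw [decompose_apply, lineRestriction_of_isHomogeneous p
      (MvPolynomial.homogeneousComponent_isHomogeneous i f),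
      (lineRestriction_eq_zero_iff p f).1 hf' i, map_zero, zero_mul]

lemma mem_lineIdeal_iff (p : Fin 3 → ℂ) (f : S) :
    f ∈ lineIdeal p ↔ lineRestriction p f = 0 := Iff.rfl

lemma mem_lineIdeal_of_isHomogeneous (p : Fin 3 → ℂ) {f : S} {k : ℕ} (hf : f.IsHomogeneous k) :
    f ∈ lineIdeal p ↔ eval p f = 0 := by
  rw [mem_lineIdeal_iff, lineRestriction_of_isHomogeneous p hf]
  simp

/-- The closed point of the projective plane with homogeneous coordinates `p`. -/
def closedPoint (p : Fin 3 → ℂ) (hp : p ≠ 0) : ProjectiveSpectrum grading where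
  asHomogeneousIdeal := lineIdeal p
  isPrime := RingHom.ker_isPrime (lineRestriction p).toRingHom
  not_irrelevant_le := by
    intro h
    obtain ⟨i, hi⟩ := Function.ne_iff.1 hp
    have hX : (MvPolynomial.X i : S) ∈ lineIdeal p := h (X_mem_irrelevant i)
    rw [mem_lineIdeal_of_isHomogeneous p (MvPolynomial.isHomogeneous_X ℂ i)] at hX
    exact hi (by simpa using hX)

/-- The generic point of the projective plane. -/
def genericPoint : ProjectiveSpectrum grading where
  asHomogeneousIdeal := ⊥
  isPrime := by
    rw [HomogeneousIdeal.toIdeal_bot]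
    exact Ideal.isPrime_bot
  not_irrelevant_le := by
    intro h
    have hX : (MvPolynomial.X 0 : S) ∈ (⊥ : HomogeneousIdeal grading) :=
      h (X_mem_irrelevant 0)
    exact MvPolynomial.X_ne_zero (R := ℂ) (0 : Fin 3) hX

lemma mem_of_specializes {x y : ProjectiveSpectrum grading}
    (h : x.asHomogeneousIdeal ≤ y.asHomogeneousIdeal)
    (U : Opens (ProjectiveSpectrum.top grading)) (hy : y ∈ U) : x ∈ U := by
  have h2 : y ∈ closure {x} := (ProjectiveSpectrum.le_iff_mem_closure grading x y).1 h
  obtain ⟨z, hz, rfl⟩ := mem_closure_iff.1 h2 U.1 U.2 hy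
  exact hz

lemma genericPoint_mem (U : Opens (ProjectiveSpectrum.top grading)) {x} (hx : x ∈ U) :
    genericPoint ∈ U :=
  mem_of_specializes (bot_le) U hx

lemma exists_X_notMem (x : ProjectiveSpectrum grading) :
    ∃ i, (MvPolynomial.X i : S) ∉ x.asHomogeneousIdeal := by
  by_contra! h
  refine x.not_irrelevant_le fun f hf => ?_
  rw [HomogeneousIdeal.mem_irrelevant_iff, GradedRing.proj_apply, decompose_apply] at hf
  have h0 : MvPolynomial.homogeneousComponent 0 f = 0 := hf
  rw [MvPolynomial.homogeneousComponent_zero] at h0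
  have h1 : MvPolynomial.coeff 0 f = 0 := by simpa using h0
  have h2 : f ∈ Ideal.span (MvPolynomial.X '' (Set.univ : Set (Fin 3))) := by
    rw [MvPolynomial.mem_ideal_span_X_image]
    intro m hm
    by_contra! h3
    have : m = 0 := Finsupp.ext fun i => h3 i trivial
    rw [this, MvPolynomial.mem_support_iff] at hm
    exact hm h1
  refine (Ideal.span_le.2 ?_ : _ ≤ x.asHomogeneousIdeal.toIdeal) h2
  rintro _ ⟨i, -, rfl⟩
  exact h i

/-- Every open neighbourhood of a point contains a closed specialization of this point. -/
lemma exists_closedPoint_mem (U : Opens (ProjectiveSpectrum.top grading))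
    (x : ProjectiveSpectrum grading) (hx : x ∈ U) :
    ∃ (p : Fin 3 → ℂ) (hp : p ≠ 0), closedPoint p hp ∈ U ∧
      x.asHomogeneousIdeal ≤ (closedPoint p hp).asHomogeneousIdeal := by
  obtain ⟨_, ⟨r, rfl⟩, hxr, hrU⟩ :=
    @IsTopologicalBasis.exists_subset_of_mem_open _ _ _
      (ProjectiveSpectrum.isTopologicalBasis_basic_opens grading) x U.1 hx U.2
  obtain ⟨i, hi⟩ := exists_X_notMem x
  have hrx : r ∉ x.asHomogeneousIdeal := hxr
  obtain ⟨k, hk⟩ : ∃ k, MvPolynomial.homogeneousComponent k r ∉ x.asHomogeneousIdeal := by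
    by_contra! h
    apply hrx
    rw [← MvPolynomial.sum_homogeneousComponent r]
    exact x.asHomogeneousIdeal.toIdeal.sum_mem fun k _ => h k
  -- The Nullstellensatz gives a zero `p` of the ideal of `x` with `f p ≠ 0`. The factor `X i`
  -- forces `p ≠ 0`; the other factor puts the closed point in the basic open set of `r`.
  set f : S := MvPolynomial.homogeneousComponent k r * MvPolynomial.X i with hf
  have hfx : f ∉ x.asHomogeneousIdeal := mul_notMem x hk hi
  have hrad : f ∉ MvPolynomial.vanishingIdeal ℂ
      (MvPolynomial.zeroLocus ℂ x.asHomogeneousIdeal.toIdeal) := by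
    rw [MvPolynomial.IsPrime.vanishingIdeal_zeroLocus]
    exact hfx
  rw [MvPolynomial.mem_vanishingIdeal_iff] at hrad
  push Not at hrad
  obtain ⟨p, hpz, hpf⟩ := hrad
  rw [MvPolynomial.mem_zeroLocus_iff] at hpz
  have hpf' : eval p (MvPolynomial.homogeneousComponent k r) * p i ≠ 0 := by
    simpa [hf, MvPolynomial.aeval_eq_eval] using hpf
  have hp : p ≠ 0 := by
    rintro rfl
    simp at hpf'
  refine ⟨p, hp, hrU ?_, fun g hg => ?_⟩
  · change r ∉ lineIdeal p
    rw [mem_lineIdeal_iff, lineRestriction_eq_zero_iff]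
    exact fun h => hpf' (by rw [h k, zero_mul])
  · change g ∈ lineIdeal p
    rw [mem_lineIdeal_iff, lineRestriction_eq_zero_iff]
    intro j
    have hgj : MvPolynomial.homogeneousComponent j g ∈ x.asHomogeneousIdeal :=
      decompose_apply g j ▸ x.asHomogeneousIdeal.isHomogeneous j hg
    simpa [MvPolynomial.aeval_eq_eval] using hpz _ hgj

end Points

/-! ### Sections of the twisting sheaves and their values in `S_𝔭`. -/

section TwistSections

/-- The value at `x`, in `S_𝔭`, of a section of `𝒪(d)`. -/
def twistValue {d : ℤ} {U : P2.Opens} (f : Γ(twist d, U)) (x : ProjectiveSpectrum grading)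
    (hx : x ∈ U) : Loc x :=
  (show (twistInType d).1.obj (op U) from f).1 ⟨x, hx⟩

variable {d e : ℤ} {U V : P2.Opens} {x : ProjectiveSpectrum grading} (hx : x ∈ U)

lemma twistValue_add (f g : Γ(twist d, U)) :
    twistValue (f + g) x hx = twistValue f x hx + twistValue g x hx := rfl

lemma twistValue_sum {ι : Type*} (s : Finset ι) (f : ι → Γ(twist d, U)) :
    twistValue (∑ i ∈ s, f i) x hx = ∑ i ∈ s, twistValue (f i) x hx := by
  classical
  induction s using Finset.induction_on with
  | empty => rfl
  | insert a s ha ih => rw [Finset.sum_insert ha, Finset.sum_insert ha, twistValue_add, ih]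

lemma twistValue_twistMul {k : ℕ} (p : S) (hp : p.IsHomogeneous k) (h : k + d = e)
    (f : Γ(twist d, U)) :
    twistValue ((twistMul p hp d e h).app U f) x hx = polyAt x p * twistValue f x hx := rfl

lemma twist_ext {f g : Γ(twist d, U)}
    (h : ∀ x hx, twistValue f x hx = twistValue g x hx) : f = g :=
  Subtype.ext (funext fun y => h y.1 y.2)

lemma frac_eq_iff {x : ProjectiveSpectrum grading} {a b a' b' : S}
    {hb : b ∉ x.asHomogeneousIdeal} {hb' : b' ∉ x.asHomogeneousIdeal} :
    frac x a b hb = frac x a' b' hb' ↔ b' * a = b * a' := by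
  rw [frac, frac, Localization.mk_eq_mk_iff, Localization.r_iff_exists]
  constructor
  · rintro ⟨c, hc⟩
    have hc0 : (c : S) ≠ 0 := fun h => c.2 (by rw [h]; exact zero_mem _)
    exact mul_left_cancel₀ hc0 hc
  · intro h
    exact ⟨1, by rw [h]⟩

/-- `t` is a fraction of degree `d`. -/
def IsTwist (d : ℤ) {x : ProjectiveSpectrum grading} (t : Loc x) : Prop :=
  ∃ (i j : ℕ) (a b : S) (hb : b ∉ x.asHomogeneousIdeal), (i : ℤ) = j + d ∧ a ∈ grading i ∧
    b ∈ grading j ∧ t = frac x a b hb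

/-- Locally a section of `𝒪(d)` is a fraction. -/
lemma exists_frac (f : Γ(twist d, U)) (x : ProjectiveSpectrum grading) (hx : x ∈ U) :
    ∃ (V : P2.Opens) (_ : V ≤ U) (_ : x ∈ V) (i j : ℕ) (a b : S), (i : ℤ) = j + d ∧
      a ∈ grading i ∧ b ∈ grading j ∧ ∃ hb : ∀ y ∈ V, b ∉ y.asHomogeneousIdeal,
      ∀ y (hy : y ∈ V) (hyU : y ∈ U), twistValue f y hyU = frac y a b (hb y hy) := by
  obtain ⟨V, hV, i, k, l, a, b, hd, ha, hb, hxb, w⟩ := f.2 ⟨x, hx⟩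
  exact ⟨V, leOfHom i, hV, k, l, a, b, hd, ha, hb, fun y hy => hxb ⟨y, hy⟩,
    fun y hy _ => w ⟨y, hy⟩⟩

lemma isTwist_twistValue (f : Γ(twist d, U)) : IsTwist d (twistValue f x hx) := by
  obtain ⟨V, hVU, hxV, i, j, a, b, hd, ha, hb, hbV, h⟩ := exists_frac f x hx
  exact ⟨i, j, a, b, hbV x hxV, hd, ha, hb, h x hxV hx⟩

/-- Every fraction of degree `d` is the value of a section. -/
lemma exists_section {t : Loc x} (ht : IsTwist d t) (hx : x ∈ U) :
    ∃ (V : P2.Opens) (_ : V ≤ U) (hxV : x ∈ V) (f : Γ(twist d, V)), twistValue f x hxV = t := by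
  obtain ⟨i, j, a, b, hb, hd, ha, hbj, rfl⟩ := ht
  refine ⟨U ⊓ ProjectiveSpectrum.basicOpen grading b, inf_le_left, ⟨hx, hb⟩,
    ⟨fun y => frac y.1 a b y.2.2, fun y => ?_⟩, rfl⟩
  exact ⟨_, y.2, 𝟙 _, i, j, a, b, hd, ha, hbj, fun z => z.2.2, fun z => rfl⟩

/-- A section of `𝒪(d)` is determined by its value at a point. -/
lemma twist_ext_of_mem {f g : Γ(twist d, U)} (hx : x ∈ U)
    (h : twistValue f x hx = twistValue g x hx) : f = g := by
  -- Since `S` is a domain, equality of two fractions is the same cross-multiplied identity at every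
  -- point. Comparison with the generic point therefore links all points of `U`.
  have key : ∀ y (hy : y ∈ U), (twistValue f y hy = twistValue g y hy ↔
      twistValue f genericPoint (genericPoint_mem U hx) =
        twistValue g genericPoint (genericPoint_mem U hx)) := by
    intro y hy
    obtain ⟨V, hVU, hxV, i, j, a, b, hd, ha, hb, hbV, h⟩ := exists_frac f y hy
    obtain ⟨V', hVU', hxV', i', j', a', b', hd', ha', hb', hbV', h'⟩ := exists_frac g y hy
    have hg := genericPoint_mem V hxV
    have hg' := genericPoint_mem V' hxV'
    rw [h y hxV hy, h' y hxV' hy, h _ hg, h' _ hg']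
    exact frac_eq_iff.trans frac_eq_iff.symm
  exact twist_ext fun y hy => (key y hy).2 ((key x hx).1 h)

/-- The value of a function at `x`, in `S_𝔭`. -/
def functionValue (r : Γ(P2, U)) (x : ProjectiveSpectrum grading) (hx : x ∈ U) : HLoc x :=
  (show (ProjectiveSpectrum.Proj.structureSheaf grading).1.obj (op U) from r).1 ⟨x, hx⟩

lemma twistValue_smul (r : Γ(P2, U)) (f : Γ(twist d, U)) :
    twistValue (r • f) x hx = (functionValue r x hx).val * twistValue f x hx := rfl

lemma isTwist_zero_iff {t : Loc x} : IsTwist 0 t ↔ ∃ r : HLoc x, t = r.val := by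
  constructor
  · rintro ⟨i, j, a, b, hb, hd, ha, hbj, rfl⟩
    obtain rfl : i = j := by omega
    exact ⟨homFrac x a b ha hbj hb, (val_homFrac x a b ha hbj hb).symm⟩
  · rintro ⟨r, rfl⟩
    obtain ⟨⟨k, a, b, hb⟩, rfl⟩ := HomogeneousLocalization.mk_surjective r
    exact ⟨k, k, a, b, hb, by simp, a.2, b.2, HomogeneousLocalization.val_mk _⟩

lemma IsTwist.mul {d e : ℤ} {t u : Loc x} (ht : IsTwist d t) (hu : IsTwist e u) :
    IsTwist (d + e) (t * u) := by
  obtain ⟨i, j, a, b, hb, hd, ha, hbj, rfl⟩ := ht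
  obtain ⟨i', j', a', b', hb', hd', ha', hbj', rfl⟩ := hu
  exact ⟨i + i', j + j', a * a', b * b', mul_notMem x hb hb', by push_cast; omega,
    SetLike.mul_mem_graded ha ha', SetLike.mul_mem_graded hbj hbj', frac_mul x _ _ _ _ _ _ _⟩

lemma isTwist_polyAt {k : ℕ} {p : S} (hp : p.IsHomogeneous k) : IsTwist k (polyAt x p) :=
  ⟨k, 0, p, 1, one_notMem x, by simp, hp, SetLike.one_mem_graded _, rfl⟩

lemma isTwist_inv {k : ℕ} {p : S} (hp : p.IsHomogeneous k) (hpx : p ∉ x.asHomogeneousIdeal) :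
    IsTwist (-k : ℤ) (frac x 1 p hpx) :=
  ⟨0, k, 1, p, hpx, by simp, SetLike.one_mem_graded _, hp, rfl⟩

end TwistSections

/-- The polynomials as elements of `S_𝔭`. -/
def polyAtHom (x : ProjectiveSpectrum grading) : S →+* Loc x := algebraMap S (Loc x)

lemma polyAtHom_apply (x : ProjectiveSpectrum grading) (p : S) : polyAtHom x p = polyAt x p :=
  (Localization.mk_one_eq_algebraMap p).symm

/-! ### Sections of finite sums, and common neighbourhoods for finitely many conditions. -/

section SectionsMore

variable {X : Scheme.{0}}

lemma comp_app_apply {M N K : X.Modules} (f : M ⟶ N) (g : N ⟶ K) (U : X.Opens) (y : Γ(M, U)) :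
    (f ≫ g).app U y = g.app U (f.app U y) := rfl

lemma add_app_apply {M N : X.Modules} (f g : M ⟶ N) (U : X.Opens) (y : Γ(M, U)) :
    (f + g).app U y = f.app U y + g.app U y := rfl

lemma sum_app_apply {ι : Type*} (s : Finset ι) {M N : X.Modules} (f : ι → (M ⟶ N)) (U : X.Opens)
    (y : Γ(M, U)) : (∑ i ∈ s, f i).app U y = ∑ i ∈ s, (f i).app U y := by
  classical
  induction s using Finset.induction_on with
  | empty => rfl
  | insert a s ha ih => rw [Finset.sum_insert ha, Finset.sum_insert ha, add_app_apply, ih]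

lemma mono_of_app_injective {M N : X.Modules} (f : M ⟶ N)
    (h : ∀ U, Function.Injective (f.app U)) : Mono f := by
  have : ∀ U, Mono (f.mapPresheaf.app U) := fun U =>
    (AddCommGrpCat.mono_iff_injective _).2 (h U.unop)
  have : Mono ((Scheme.Modules.toPresheaf X).map f) := NatTrans.mono_of_mono_app f.mapPresheaf
  exact (Scheme.Modules.toPresheaf X).mono_of_mono_map this

/-- Two sections which agree locally are equal. -/
lemma section_ext_of_locally {M : X.Modules} {U : X.Opens} {y z : Γ(M, U)}
    (h : ∀ x ∈ U, ∃ (V : X.Opens) (i : V ⟶ U), x ∈ V ∧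
      M.presheaf.map i.op y = M.presheaf.map i.op z) : y = z := by
  choose V i hV he using h
  refine TopCat.Sheaf.eq_of_locally_eq' ⟨M.presheaf, M.isSheaf⟩ (fun x : U => V x.1 x.2) U
    (fun x => i x.1 x.2) (fun x hx => ?_) y z fun x => he x.1 x.2
  exact Opens.mem_iSup.2 ⟨⟨x, hx⟩, hV x hx⟩

variable {ι : Type} [Finite ι]

lemma biproduct_section_ext {M : ι → X.Modules} {U : X.Opens} {y z : Γ(⨁ M, U)}
    (h : ∀ i, (biproduct.π M i).app U y = (biproduct.π M i).app U z) : y = z := by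
  cases nonempty_fintype ι
  have key : ∀ y : Γ(⨁ M, U), y = ∑ i, (biproduct.ι M i).app U ((biproduct.π M i).app U y) := by
    intro y
    have : y = (𝟙 (⨁ M) : ⨁ M ⟶ ⨁ M).app U y := rfl
    rw [← biproduct.total, sum_app_apply] at this
    exact this
  rw [key y, key z]
  exact Finset.sum_congr rfl fun i _ => by rw [h i]

lemma exists_biproduct_section {M : ι → X.Modules} {U : X.Opens} (s : ∀ i, Γ(M i, U)) :
    ∃ y : Γ(⨁ M, U), ∀ i, (biproduct.π M i).app U y = s i := by
  classical
  cases nonempty_fintype ι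
  refine ⟨∑ i, (biproduct.ι M i).app U (s i), fun j => ?_⟩
  rw [map_sum, Finset.sum_eq_single j]
  · rw [← comp_app_apply, biproduct.ι_π_self]; rfl
  · intro i _ hij
    rw [← comp_app_apply, biproduct.ι_π_ne _ hij]; rfl
  · simp

lemma biproduct_desc_app {M : ι → X.Modules} [Fintype ι] {N : X.Modules} (f : ∀ i, M i ⟶ N)
    (U : X.Opens) (y : Γ(⨁ M, U)) :
    (biproduct.desc f).app U y = ∑ i, (f i).app U ((biproduct.π M i).app U y) := by
  rw [biproduct.desc_eq, sum_app_apply]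
  rfl

lemma exists_open_forall {ι : Type} [Finite ι] {x : X} {U : X.Opens} (hx : x ∈ U)
    (P : ι → X.Opens → Prop) (hP : ∀ i V W, W ≤ V → P i V → P i W)
    (h : ∀ i, ∃ V : X.Opens, V ≤ U ∧ x ∈ V ∧ P i V) :
    ∃ V : X.Opens, V ≤ U ∧ x ∈ V ∧ ∀ i, P i V := by
  classical
  cases nonempty_fintype ι
  choose V hVU hxV hV using h
  refine ⟨U ⊓ Finset.univ.inf V, inf_le_left, ⟨hx, ?_⟩, fun i =>
    hP i (V i) _ (inf_le_right.trans (Finset.inf_le (Finset.mem_univ i))) (hV i)⟩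
  have : ∀ s : Finset ι, x ∈ s.inf V := by
    intro s
    induction s using Finset.induction_on with
    | empty => exact trivial
    | insert a s ha ih => rw [Finset.inf_insert]; exact ⟨hxV a, ih⟩
  exact this _

end SectionsMore

/-! ### Maps between sums of twisting sheaves given by polynomial matrices. -/

section PolyMatrix

variable {I J K : Type} [Fintype I] [Fintype J] [Fintype K] {d : I → ℤ} {e : J → ℤ} {c : K → ℤ}

/-- The values at `x` of the components of a section of a sum of twisting sheaves. -/
def compValue {U : P2.Opens} (y : Γ(⨁ fun i => twist (d i), U)) (x : ProjectiveSpectrum grading)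
    (hx : x ∈ U) (i : I) : Loc x :=
  twistValue ((biproduct.π (fun i => twist (d i)) i).app U y) x hx

variable {U V : P2.Opens} {x : ProjectiveSpectrum grading}

lemma compValue_add (hx : x ∈ U) (y z : Γ(⨁ fun i => twist (d i), U)) :
    compValue (y + z) x hx = compValue y x hx + compValue z x hx := by
  ext i
  rw [compValue, map_add]
  rfl

lemma compValue_neg (hx : x ∈ U) (y : Γ(⨁ fun i => twist (d i), U)) :
    compValue (-y) x hx = -compValue y x hx := by
  ext i
  rw [compValue, map_neg]
  rfl

lemma compValue_zero (hx : x ∈ U) : compValue (0 : Γ(⨁ fun i => twist (d i), U)) x hx = 0 := by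
  ext i
  rw [compValue, map_zero]
  rfl

lemma compValue_sub (hx : x ∈ U) (y z : Γ(⨁ fun i => twist (d i), U)) :
    compValue (y - z) x hx = compValue y x hx - compValue z x hx := by
  rw [sub_eq_add_neg, compValue_add, compValue_neg, sub_eq_add_neg]

lemma compValue_map (i : V ⟶ U) (hx : x ∈ V) (y : Γ(⨁ fun i => twist (d i), U)) :
    compValue ((⨁ fun i => twist (d i)).presheaf.map i.op y) x hx =
      compValue y x (leOfHom i hx) := by
  ext j
  rw [compValue, app_map]
  rfl

lemma isTwist_compValue (hx : x ∈ U) (y : Γ(⨁ fun i => twist (d i), U)) (i : I) :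
    IsTwist (d i) (compValue y x hx i) := isTwist_twistValue hx _

lemma compValue_smul (hx : x ∈ U) (r : Γ(P2, U)) (y : Γ(⨁ fun i => twist (d i), U)) :
    compValue (r • y) x hx = (functionValue r x hx).val • compValue y x hx := by
  ext i
  rw [compValue, Scheme.Modules.Hom.app_smul]
  rfl

lemma compValue_ext {y z : Γ(⨁ fun i => twist (d i), U)}
    (h : ∀ x hx, compValue y x hx = compValue z x hx) : y = z :=
  biproduct_section_ext fun i => twist_ext fun x hx => congrFun (h x hx) i

lemma compValue_ext_of_mem (hx : x ∈ U) {y z : Γ(⨁ fun i => twist (d i), U)}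
    (h : compValue y x hx = compValue z x hx) : y = z :=
  biproduct_section_ext fun i => twist_ext_of_mem hx (congrFun h i)

lemma exists_section_compValue (hx : x ∈ U) {t : I → Loc x} (ht : ∀ i, IsTwist (d i) (t i)) :
    ∃ (V : P2.Opens) (_ : V ≤ U) (hxV : x ∈ V) (y : Γ(⨁ fun i => twist (d i), V)),
      compValue y x hxV = t := by
  obtain ⟨V, hVU, hxV, hV⟩ := exists_open_forall (X := P2) (x := x) hx
    (fun i V => ∀ hxV : x ∈ V, ∃ f : Γ(twist (d i), V), twistValue f x hxV = t i)
    (fun i V W hWV h hxW => by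
      obtain ⟨f, hf⟩ := h (hWV hxW)
      exact ⟨(twist (d i)).presheaf.map (homOfLE hWV).op f, hf⟩)
    (fun i => by
      obtain ⟨V, hVU, hxV, f, hf⟩ := exists_section (ht i) hx
      exact ⟨V, hVU, hxV, fun _ => ⟨f, hf⟩⟩)
  choose f hf using hV
  obtain ⟨y, hy⟩ := exists_biproduct_section fun i => f i hxV
  exact ⟨V, hVU, hxV, y, funext fun i => by rw [compValue, hy, hf]⟩

/-- The map between sums of twisting sheaves given by a matrix of homogeneous polynomials. -/
def polyMatrixHom (m : Matrix J I S) (k : J → I → ℕ) (hm : ∀ j i, (m j i).IsHomogeneous (k j i))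
    (hk : ∀ j i, (k j i : ℤ) + d i = e j) :
    (⨁ fun i => twist (d i)) ⟶ ⨁ fun j => twist (e j) :=
  biproduct.matrix fun i j => twistMul (m j i) (hm j i) (d i) (e j) (hk j i)

lemma compValue_polyMatrixHom (m : Matrix J I S) (k : J → I → ℕ)
    (hm : ∀ j i, (m j i).IsHomogeneous (k j i)) (hk : ∀ j i, (k j i : ℤ) + d i = e j)
    (hx : x ∈ U) (y : Γ(⨁ fun i => twist (d i), U)) :
    compValue ((polyMatrixHom m k hm hk).app U y) x hx =
      (m.map (polyAtHom x)).mulVec (compValue y x hx) := by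
  ext j
  rw [compValue, ← comp_app_apply, polyMatrixHom, biproduct.matrix_π, biproduct_desc_app,
    twistValue_sum]
  refine Finset.sum_congr rfl fun i _ => ?_
  rw [twistValue_twistMul, ← polyAtHom_apply]
  rfl

end PolyMatrix

/-! ### Lifting injectivity and surjectivity from a residue field to a local ring. -/

section Lifting

lemma exists_left_inverse_of_mulVec_injective {k J K : Type*} [Field k] [Fintype J] [Fintype K]
    [DecidableEq K] {M : Matrix J K k} (h : Function.Injective M.mulVec) :
    ∃ T : Matrix K J k, T * M = 1 := by
  classical
  obtain ⟨g, hg⟩ := M.mulVecLin.exists_leftInverse_of_injective (LinearMap.ker_eq_bot.2 h)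
  refine ⟨LinearMap.toMatrix' g, ?_⟩
  apply Matrix.toLin'.injective
  rw [Matrix.toLin'_mul, Matrix.toLin'_toMatrix', Matrix.toLin'_apply', hg, Matrix.toLin'_one]

lemma exists_right_inverse_of_mulVec_surjective {k J K : Type*} [Field k] [Fintype J] [Fintype K]
    [DecidableEq J] {M : Matrix J K k} (h : Function.Surjective M.mulVec) :
    ∃ T : Matrix K J k, M * T = 1 := by
  classical
  obtain ⟨g, hg⟩ := M.mulVecLin.exists_rightInverse_of_surjective (LinearMap.range_eq_top.2 h)
  refine ⟨LinearMap.toMatrix' g, ?_⟩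
  apply Matrix.toLin'.injective
  rw [Matrix.toLin'_mul, Matrix.toLin'_toMatrix', Matrix.toLin'_apply', hg, Matrix.toLin'_one]

variable {R κ : Type*} [CommRing R] [Field κ] (ev : R →+* κ) (ι : ℂ →+* R) (φ : ℂ →+* κ)
  {J K : Type*} [Fintype J] [Fintype K]

lemma isUnit_det_of_map_eq_one [DecidableEq J] (hev : ∀ r, ev r ≠ 0 → IsUnit r) (M : Matrix J J R)
    (h : M.map ev = 1) : IsUnit M.det := by
  apply hev
  rw [RingHom.map_det, RingHom.mapMatrix_apply, h, Matrix.det_one]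
  exact one_ne_zero

/-- Injectivity of a matrix over a local ring can be checked in the residue field. -/
lemma mulVec_injective_of_map (hev : ∀ r, ev r ≠ 0 → IsUnit r)
    (hφ : ∀ c, ev (ι c) = φ c) {M : Matrix J K R} {M₀ : Matrix J K ℂ}
    (hM : M.map ev = M₀.map φ) (h : Function.Injective M₀.mulVec) :
    Function.Injective M.mulVec := by
  classical
  obtain ⟨T, hT⟩ := exists_left_inverse_of_mulVec_injective h
  -- A left inverse `T` of the complex matrix, viewed as a constant matrix over `R`, has a product
  -- with `M` that reduces to the identity, so the product is invertible.
  have hu : IsUnit (T.map ι * M).det := by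
    refine isUnit_det_of_map_eq_one ev hev _ ?_
    rw [Matrix.map_mul, Matrix.map_map, hM]
    have : ev ∘ ι = φ := funext hφ
    rw [this, ← Matrix.map_mul, hT, Matrix.map_one _ (map_zero _) (map_one _)]
  intro v w hvw
  have h2 : (T.map ι * M).mulVec v = (T.map ι * M).mulVec w := by
    rw [← Matrix.mulVec_mulVec, ← Matrix.mulVec_mulVec, hvw]
  have h3 := congrArg ((T.map ι * M)⁻¹).mulVec h2
  rwa [Matrix.mulVec_mulVec, Matrix.mulVec_mulVec, Matrix.nonsing_inv_mul _ hu, Matrix.one_mulVec,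
    Matrix.one_mulVec] at h3

/-- Surjectivity of a matrix over a local ring can be checked in the residue field. -/
lemma mulVec_surjective_of_map (hev : ∀ r, ev r ≠ 0 → IsUnit r)
    (hφ : ∀ c, ev (ι c) = φ c) {M : Matrix J K R} {M₀ : Matrix J K ℂ}
    (hM : M.map ev = M₀.map φ) (h : Function.Surjective M₀.mulVec) :
    Function.Surjective M.mulVec := by
  classical
  obtain ⟨T, hT⟩ := exists_right_inverse_of_mulVec_surjective h
  have hu : IsUnit (M * T.map ι).det := by
    refine isUnit_det_of_map_eq_one ev hev _ ?_
    rw [Matrix.map_mul, Matrix.map_map, hM]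
    have : ev ∘ ι = φ := funext hφ
    rw [this, ← Matrix.map_mul, hT, Matrix.map_one _ (map_zero _) (map_one _)]
  intro v
  refine ⟨(T.map ι).mulVec ((M * T.map ι)⁻¹.mulVec v), ?_⟩
  rw [Matrix.mulVec_mulVec, Matrix.mulVec_mulVec, Matrix.mul_nonsing_inv _ hu, Matrix.one_mulVec]

end Lifting

/-! ### The local ring of a closed point, its residue map, and trivialization of the twists by a
linear form. -/

section ClosedPoint

variable {p : Fin 3 → ℂ} {hp : p ≠ 0}

/-- The residue field at the vertex of the local ring `S_𝔭` for a closed point. -/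
abbrev ResField : Type := FractionRing (Polynomial ℂ)

/-- Restriction of fractions to the line of a closed point. -/
def locEval (p : Fin 3 → ℂ) (hp : p ≠ 0) : Loc (closedPoint p hp) →+* ResField :=
  IsLocalization.lift (M := (closedPoint p hp).asHomogeneousIdeal.toIdeal.primeCompl)
    (g := (algebraMap (Polynomial ℂ) ResField).comp (lineRestriction p).toRingHom)
    fun y => by
      have hy : lineRestriction p y ≠ 0 := y.2
      refine IsUnit.mk0 _ fun h => hy ?_
      exact (IsFractionRing.injective (Polynomial ℂ) ResField) (h.trans (map_zero _).symm)

lemma locEval_poly (f : S) :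
    locEval p hp (polyAtHom _ f) = algebraMap (Polynomial ℂ) ResField (lineRestriction p f) :=
  IsLocalization.lift_eq _ _

/-- The prime of a closed point is the kernel of restriction to the line through `p`, so `locEval`
is reduction modulo the maximal ideal of `S_𝔭`. Fractions of all degrees are allowed, so the target
is the function field of the line and not `ℂ`. -/
lemma isUnit_of_locEval_ne_zero (t : Loc (closedPoint p hp)) (h : locEval p hp t ≠ 0) :
    IsUnit t := by
  obtain ⟨a, b, rfl⟩ := IsLocalization.exists_mk'_eq
    (closedPoint p hp).asHomogeneousIdeal.toIdeal.primeCompl t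
  have ha : a ∈ (closedPoint p hp).asHomogeneousIdeal.toIdeal.primeCompl := by
    intro ha
    apply h
    have ha' : lineRestriction p a = 0 := ha
    have h1 : locEval p hp (polyAtHom _ a) = 0 := by rw [locEval_poly, ha', map_zero]
    rw [IsLocalization.mk'_eq_mul_mk'_one, map_mul]
    exact mul_eq_zero_of_left h1 _
  exact (IsLocalization.AtPrime.isUnit_mk'_iff _ _ _ _).2 ha

/-- The local ring of a point in its homogeneous localization. -/
def valHom (x : ProjectiveSpectrum grading) : HLoc x →+* Loc x :=
  algebraMap (HLoc x) (Loc x)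

lemma valHom_apply (x : ProjectiveSpectrum grading) (r : HLoc x) : valHom x r = r.val := rfl

lemma isUnit_of_locEval_val_ne_zero (r : HLoc (closedPoint p hp))
    (h : (locEval p hp).comp (valHom _) r ≠ 0) : IsUnit r :=
  (HomogeneousLocalization.isUnit_iff_isUnit_val _ _ _).1 (isUnit_of_locEval_ne_zero _ h)

/-- The constants in the residue field. -/
def constHom : ℂ →+* ResField := (algebraMap (Polynomial ℂ) ResField).comp Polynomial.C

/-- The constants in the local ring of a point. -/
def constHLoc (x : ProjectiveSpectrum grading) : ℂ →+* HLoc x :=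
  (algebraMap (grading 0) (HLoc x)).comp (algebraMap ℂ (grading 0))

lemma val_constHLoc (x : ProjectiveSpectrum grading) (c : ℂ) :
    (constHLoc x c).val = polyAtHom x (MvPolynomial.C c) := by
  rw [polyAtHom_apply]
  exact HomogeneousLocalization.val_mk _

lemma locEval_const (c : ℂ) : locEval p hp (polyAtHom _ (MvPolynomial.C c)) = constHom c := by
  rw [locEval_poly, lineRestriction, MvPolynomial.aeval_C]
  rfl

/-- Such a form is a unit near the closed point. Dividing by its powers turns fractions of any
degree into functions, which makes matrices with entries of mixed degrees comparable with their
values at `p`. -/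
lemma exists_linear_form (hp : p ≠ 0) : ∃ l : S, l.IsHomogeneous 1 ∧ eval p l = 1 := by
  obtain ⟨i, hi⟩ := Function.ne_iff.1 hp
  refine ⟨MvPolynomial.C (p i)⁻¹ * MvPolynomial.X i, MvPolynomial.isHomogeneous_C_mul_X _ _, ?_⟩
  simpa using inv_mul_cancel₀ hi

lemma pow_notMem_of_eval {l : S} (hl : l.IsHomogeneous 1) (hl1 : eval p l = 1) (k : ℕ) :
    l ^ k ∉ (closedPoint p hp).asHomogeneousIdeal := by
  refine pow_notMem _ ?_ k
  change l ∉ lineIdeal p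
  rw [mem_lineIdeal_of_isHomogeneous p hl, hl1]
  exact one_ne_zero

section Normalize

/-- The quotient of a homogeneous polynomial by a power of a linear form. -/
def normalize {l : S} (hl : l.IsHomogeneous 1) (hl1 : eval p l = 1)
    (hp : p ≠ 0) {f : S} {k : ℕ} (hf : f.IsHomogeneous k) : HLoc (closedPoint p hp) :=
  homFrac _ f (l ^ k) hf (by simpa using hl.pow k) (pow_notMem_of_eval hl hl1 k)

lemma val_normalize_mul {l : S} (hl : l.IsHomogeneous 1) (hl1 : eval p l = 1)
    {f : S} {k : ℕ} (hf : f.IsHomogeneous k) :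
    (normalize hl hl1 hp hf).val * polyAtHom _ l ^ k = polyAtHom _ f := by
  have h : (normalize hl hl1 hp hf).val = frac _ f (l ^ k) (pow_notMem_of_eval hl hl1 k) :=
    val_homFrac _ _ _ _ _ _
  rw [h, ← map_pow, polyAtHom_apply, polyAtHom_apply,
    frac_mul _ _ _ _ _ _ _ (by simpa using pow_notMem_of_eval hl hl1 k), frac_eq_iff]
  ring

lemma locEval_linear {l : S} (hl : l.IsHomogeneous 1) (hl1 : eval p l = 1) :
    locEval p hp (polyAtHom _ l) = algebraMap (Polynomial ℂ) _ Polynomial.X := by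
  rw [locEval_poly, lineRestriction_of_isHomogeneous p hl, hl1]
  simp

/-- On the line through `p`, `f` becomes `f(p) t^k` and `l` becomes `t`; the quotient is the
constant `f(p)`. Hence a normalized matrix reduces to the complex matrix of the fibre. -/
lemma locEval_normalize {l : S} (hl : l.IsHomogeneous 1) (hl1 : eval p l = 1)
    {f : S} {k : ℕ} (hf : f.IsHomogeneous k) :
    locEval p hp (normalize hl hl1 hp hf).val = constHom (eval p f) := by
  have h := congrArg (locEval p hp) (val_normalize_mul (hp := hp) hl hl1 hf)
  rw [map_mul, map_pow, locEval_linear hl hl1, locEval_poly, lineRestriction_of_isHomogeneous p hf,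
    map_mul, map_pow] at h
  refine mul_right_cancel₀ (pow_ne_zero k ?_) h
  exact fun h0 => Polynomial.X_ne_zero
    (IsFractionRing.injective (Polynomial ℂ) ResField (h0.trans (map_zero _).symm))

lemma isUnit_linear {l : S} (hl : l.IsHomogeneous 1) (hl1 : eval p l = 1) :
    IsUnit (polyAtHom (closedPoint p hp) l) := by
  apply isUnit_of_locEval_ne_zero
  rw [locEval_linear hl hl1]
  exact fun h0 => Polynomial.X_ne_zero
    (IsFractionRing.injective (Polynomial ℂ) ResField (h0.trans (map_zero _).symm))

/-- Sections of `𝒪(d)` near a closed point are the functions times a power of a linear form. -/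
lemma isTwist_natCast_iff {l : S} (hl : l.IsHomogeneous 1) (hl1 : eval p l = 1)
    {d : ℕ} {t : Loc (closedPoint p hp)} :
    IsTwist d t ↔ ∃ r : HLoc (closedPoint p hp), t = r.val * polyAtHom _ l ^ d := by
  have hld : (l ^ d).IsHomogeneous d := by simpa using hl.pow d
  have hlx := pow_notMem_of_eval (hp := hp) hl hl1 d
  constructor
  · intro ht
    have h0 : IsTwist ((d : ℤ) + (-d : ℤ)) (t * frac _ 1 (l ^ d) hlx) :=
      ht.mul (isTwist_inv hld hlx)
    rw [add_neg_cancel, isTwist_zero_iff] at h0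
    obtain ⟨r, hr⟩ := h0
    refine ⟨r, ?_⟩
    rw [← hr, mul_assoc, ← map_pow, polyAtHom_apply,
      frac_mul _ _ _ _ _ _ _ (by simpa using hlx)]
    have : frac (closedPoint p hp) (1 * l ^ d) (l ^ d * 1) (by simpa using hlx) =
      frac _ 1 1 (one_notMem _) := by rw [frac_eq_iff]; ring
    rw [this, ← polyAt, ← polyAtHom_apply, map_one, mul_one]
  · rintro ⟨r, rfl⟩
    have h0 := (isTwist_zero_iff.2 ⟨r, rfl⟩).mul (isTwist_polyAt (x := closedPoint p hp) hld)
    rwa [zero_add, ← polyAtHom_apply, map_pow] at h0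

lemma isTwist_neg_iff {l : S} (hl : l.IsHomogeneous 1) (hl1 : eval p l = 1)
    {d : ℕ} {t : Loc (closedPoint p hp)} :
    IsTwist (-d : ℤ) t ↔ ∃ r : HLoc (closedPoint p hp), t * polyAtHom _ l ^ d = r.val := by
  have hld : (l ^ d).IsHomogeneous d := by simpa using hl.pow d
  have hlx := pow_notMem_of_eval (hp := hp) hl hl1 d
  constructor
  · intro ht
    have h0 := ht.mul (isTwist_polyAt (x := closedPoint p hp) hld)
    rw [neg_add_cancel, isTwist_zero_iff, ← polyAtHom_apply, map_pow] at h0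
    exact h0
  · rintro ⟨r, hr⟩
    have h0 := (isTwist_zero_iff.2 ⟨r, hr⟩).mul (isTwist_inv hld hlx)
    rw [zero_add] at h0
    convert h0 using 1
    rw [mul_assoc, ← map_pow, polyAtHom_apply,
      frac_mul _ _ _ _ _ _ _ (by simpa using hlx)]
    have : frac (closedPoint p hp) (l ^ d * 1) (1 * l ^ d) (by simpa using hlx) =
      frac _ 1 1 (one_notMem _) := by rw [frac_eq_iff]; ring
    rw [this, ← polyAt, ← polyAtHom_apply, map_one, mul_one]

end Normalize

end ClosedPoint

/-! ### From exactness on a fibre to exactness at the local ring. -/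

section LocalExactness

/-- The columns of `B` are a basis of a complement of the column space of `A`. They supply the
coordinates that measure the failure to lie in the image of `A`. -/
lemma exists_complement_matrix {I K : Type*} [Fintype I] [Fintype K] (A : Matrix I K ℂ) :
    ∃ (k : ℕ) (B : Matrix I (Fin k) ℂ), Function.Surjective (fromCols A B).mulVec ∧
      ∀ z u, B *ᵥ z = A *ᵥ u → z = 0 := by
  classical
  obtain ⟨Q, hQ⟩ := (LinearMap.range A.mulVecLin).exists_isCompl
  let b := Module.finBasis ℂ Q
  let f : (Fin (Module.finrank ℂ Q) → ℂ) →ₗ[ℂ] (I → ℂ) := Q.subtype ∘ₗ b.equivFun.symm.toLinearMap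
  have hf : ∀ z, (LinearMap.toMatrix' f) *ᵥ z = b.equivFun.symm z := fun z => by
    rw [LinearMap.toMatrix'_mulVec]; rfl
  refine ⟨_, LinearMap.toMatrix' f, fun y => ?_, fun z u h => ?_⟩
  · have hy : y ∈ LinearMap.range A.mulVecLin ⊔ Q := by rw [hQ.sup_eq_top]; trivial
    obtain ⟨_, ⟨u, rfl⟩, q, hq, rfl⟩ := Submodule.mem_sup.1 hy
    refine ⟨Sum.elim u (b.equivFun ⟨q, hq⟩), ?_⟩
    rw [fromCols_mulVec_sumElim, hf, LinearEquiv.symm_apply_apply]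
    rfl
  · rw [hf] at h
    have h0 : ((b.equivFun.symm z : Q) : I → ℂ) ∈ LinearMap.range A.mulVecLin ⊓ Q :=
      ⟨⟨u, h.symm⟩, (b.equivFun.symm z).2⟩
    rw [hQ.inf_eq_bot, Submodule.mem_bot] at h0
    exact (LinearEquiv.map_eq_zero_iff _).1 (Subtype.ext h0)

variable {I J R : Type} [Fintype I] [Fintype J] [Fintype R] {p : Fin 3 → ℂ} {hp : p ≠ 0}
  {dd : J → ℕ} {ρ : R → ℕ} {A : Matrix I I S} {Φ : Matrix J I S} {τ : Matrix J R S}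
  {Ψ : Matrix R I S}

/-- A complex of sums of twisting sheaves which is exact on the fibre at a closed point is exact
near this point. -/
lemma exists_lift_of_fibre_exact (hA : ∀ i i', (A i i').IsHomogeneous 1)
    (hΦ : ∀ j i, (Φ j i).IsHomogeneous (dd j)) (hτ : ∀ j r, (τ j r).IsHomogeneous (dd j + ρ r))
    (hrel : Φ * A = τ * Ψ)
    (hexact : ∀ v w, Φ.map (eval p) *ᵥ v = τ.map (eval p) *ᵥ w → ∃ u, v = A.map (eval p) *ᵥ u)
    (hinj : Function.Injective (τ.map (eval p)).mulVec)
    (y : I → Loc (closedPoint p hp)) (hy : ∀ i, IsTwist 0 (y i)) (w : R → Loc (closedPoint p hp))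
    (hyw : Φ.map (polyAtHom _) *ᵥ y = τ.map (polyAtHom _) *ᵥ w) :
    ∃ v : I → Loc (closedPoint p hp), (∀ i, IsTwist (-1) (v i)) ∧
      A.map (polyAtHom _) *ᵥ v = y := by
  classical
  obtain ⟨l, hl, hl1⟩ := exists_linear_form hp
  obtain ⟨k, B, hB, hB0⟩ := exists_complement_matrix (A.map (eval p))
  set lu := polyAtHom (closedPoint p hp) l with hlu
  have hu : IsUnit lu := isUnit_linear hl hl1
  let A' : Matrix I I (HLoc (closedPoint p hp)) := .of fun i i' => normalize hl hl1 hp (hA i i')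
  have hA' : ∀ i i', (A' i i').val * lu = polyAtHom _ (A i i') := fun i i' => by
    have h := val_normalize_mul (hp := hp) hl hl1 (hA i i')
    rw [pow_one] at h
    exact h
  choose y' hy' using fun i => isTwist_zero_iff.1 (hy i)
  -- This is done over the local ring of degree-zero fractions, so that the decomposition `y = A v +
  -- B z` has coefficients of the right degree.
  have hsurj : Function.Surjective (fromCols A' (B.map (constHLoc _))).mulVec := by
    refine mulVec_surjective_of_map ((locEval p hp).comp (valHom _)) (constHLoc _) constHom
      isUnit_of_locEval_val_ne_zero (fun c => ?_) ?_ hB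
    · rw [RingHom.comp_apply, valHom_apply, val_constHLoc, locEval_const]
    · ext i (i' | m)
      · exact locEval_normalize hl hl1 (hA i i')
      · exact (congrArg (locEval p hp) (val_constHLoc _ (B i m))).trans (locEval_const _)
  obtain ⟨uz, huz⟩ := hsurj y'
  set u : I → HLoc (closedPoint p hp) := uz ∘ Sum.inl with hudef
  set z : Fin k → HLoc (closedPoint p hp) := uz ∘ Sum.inr with hzdef
  have huz' : A' *ᵥ u + B.map (constHLoc _) *ᵥ z = y' := by
    rw [← huz, fromCols_mulVec]
  obtain ⟨li, hli⟩ := hu.exists_right_inv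
  let v : I → Loc (closedPoint p hp) := fun i => (u i).val * li
  let B' : Matrix I (Fin k) (Loc (closedPoint p hp)) :=
    B.map fun c => polyAtHom _ (MvPolynomial.C c)
  let z' : Fin k → Loc (closedPoint p hp) := fun m => (z m).val
  have hAv : A.map (polyAtHom _) *ᵥ v + B' *ᵥ z' = y := by
    ext i
    have h1 := congrArg (valHom _) (congrFun huz' i)
    rw [Pi.add_apply, map_add, Matrix.mulVec, Matrix.mulVec, dotProduct, dotProduct, map_sum,
      map_sum] at h1
    rw [hy' i, ← valHom_apply, ← h1, Pi.add_apply]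
    congr 1
    · refine Finset.sum_congr rfl fun i' _ => ?_
      rw [map_mul, valHom_apply, valHom_apply]
      change polyAtHom _ (A i i') * ((u i').val * li) = _
      rw [← hA']
      linear_combination ((A' i i').val * (u i').val) * hli
    · rw [Matrix.mulVec, dotProduct]
      refine Finset.sum_congr rfl fun m _ => ?_
      rw [map_mul]
      exact congrArg (· * z' m) (val_constHLoc _ _).symm
  -- The component of `y` along the complement has to vanish. Applying `Φ` to the decomposition
  -- gives `Φ B z = τ (w - Ψ v)`, by `Φ A = τ Ψ`.
  suffices hz : z' = 0 by
    refine ⟨v, fun i => ?_, by rw [← hAv, hz, mulVec_zero, add_zero]⟩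
    have : IsTwist (-(1 : ℕ) : ℤ) (v i) := (isTwist_neg_iff hl hl1).2
      ⟨u i, by rw [pow_one]; change (u i).val * li * lu = _; rw [mul_assoc, mul_comm li, hli,
        mul_one]⟩
    exact this
  let Φ' : Matrix J I (Loc (closedPoint p hp)) := .of fun j i => (normalize hl hl1 hp (hΦ j i)).val
  let τ' : Matrix J R (Loc (closedPoint p hp)) := .of fun j r => (normalize hl hl1 hp (hτ j r)).val
  -- On the fibre, `Φ B z = τ w` puts `B z` in the image of `A`, so `z = 0`; then `w = 0` by
  -- injectivity of `τ`. Injectivity lifts to `S_𝔭`.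
  have hM : Function.Injective (fromCols (Φ' * B') τ').mulVec := by
    refine mulVec_injective_of_map (M₀ := fromCols (Φ.map (eval p) * B) (τ.map (eval p)))
      (locEval p hp) ((polyAtHom _).comp MvPolynomial.C) constHom
      isUnit_of_locEval_ne_zero (fun c => locEval_const c) ?_ ?_
    · ext j (m | r)
      · change locEval p hp (∑ i, Φ' j i * B' i m) = constHom (∑ i, eval p (Φ j i) * B i m)
        rw [map_sum, map_sum]
        refine Finset.sum_congr rfl fun i _ => ?_
        rw [map_mul, map_mul]
        exact congrArg₂ (· * ·) (locEval_normalize hl hl1 (hΦ j i)) (locEval_const _)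
      · exact locEval_normalize hl hl1 (hτ j r)
    · refine (injective_iff_map_eq_zero (fromCols (Φ.map (eval p) * B)
        (τ.map (eval p))).mulVecLin).2 fun q hq => ?_
      rw [mulVecLin_apply, fromCols_mulVec, ← mulVec_mulVec] at hq
      obtain ⟨u, hu⟩ := hexact (B *ᵥ (q ∘ Sum.inl)) (-(q ∘ Sum.inr))
        (by rw [mulVec_neg]; exact eq_neg_of_add_eq_zero_left hq)
      have hq1 := hB0 _ _ hu
      rw [hq1, mulVec_zero, mulVec_zero, zero_add] at hq
      have hq2 := hinj (hq.trans (mulVec_zero _).symm)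
      ext (m | r)
      · exact congrFun hq1 m
      · exact congrFun hq2 r
  have h0 : fromCols (Φ' * B') τ' *ᵥ Sum.elim z'
      (fun r => lu ^ ρ r * (((Ψ.map (polyAtHom _)) *ᵥ v) r - w r)) = 0 := by
    rw [fromCols_mulVec_sumElim]
    ext j
    refine (hu.pow (dd j)).mul_left_cancel ?_
    rw [Pi.add_apply, mul_add, ← mulVec_mulVec, Pi.zero_apply, mul_zero]
    have e1 : lu ^ dd j * (Φ' *ᵥ (B' *ᵥ z')) j = (Φ.map (polyAtHom _) *ᵥ (B' *ᵥ z')) j := by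
      rw [mulVec, mulVec, dotProduct, dotProduct, Finset.mul_sum]
      refine Finset.sum_congr rfl fun i _ => ?_
      have h := val_normalize_mul (hp := hp) hl hl1 (hΦ j i)
      change _ * ((normalize hl hl1 hp (hΦ j i)).val * _) = polyAtHom _ (Φ j i) * _
      rw [← h]
      ring
    have e2 : lu ^ dd j * (τ' *ᵥ fun r => lu ^ ρ r * (((Ψ.map (polyAtHom _)) *ᵥ v) r - w r)) j =
        (τ.map (polyAtHom _) *ᵥ ((Ψ.map (polyAtHom _)) *ᵥ v - w)) j := by
      rw [mulVec, mulVec, dotProduct, dotProduct, Finset.mul_sum]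
      refine Finset.sum_congr rfl fun r _ => ?_
      have h := val_normalize_mul (hp := hp) hl hl1 (hτ j r)
      change _ * ((normalize hl hl1 hp (hτ j r)).val * _) = polyAtHom _ (τ j r) * _
      rw [← h, Pi.sub_apply, pow_add]
      ring
    rw [e1, e2, eq_sub_of_add_eq' hAv, mulVec_sub, mulVec_sub, hyw, mulVec_mulVec, mulVec_mulVec,
      ← Matrix.map_mul, ← Matrix.map_mul, hrel, Pi.sub_apply, Pi.sub_apply]
    ring
  have h1 := hM (h0.trans (mulVec_zero _).symm)
  ext m
  exact congrFun h1 (Sum.inl m)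

/-- A map of sums of twisting sheaves which is surjective on the fibre at a closed point is
surjective near this point. -/
lemma exists_lift_of_fibre_surjective
    (hΦ : ∀ j i, (Φ j i).IsHomogeneous (dd j)) (hτ : ∀ j r, (τ j r).IsHomogeneous (dd j + ρ r))
    (hsurj : Function.Surjective (fromCols (Φ.map (eval p)) (τ.map (eval p))).mulVec)
    (f : J → Loc (closedPoint p hp)) (hf : ∀ j, IsTwist (dd j) (f j)) :
    ∃ (y : I → Loc (closedPoint p hp)) (w : R → Loc (closedPoint p hp)),
      (∀ i, IsTwist 0 (y i)) ∧ (∀ r, IsTwist (-ρ r : ℤ) (w r)) ∧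
      Φ.map (polyAtHom _) *ᵥ y + τ.map (polyAtHom _) *ᵥ w = f := by
  obtain ⟨l, hl, hl1⟩ := exists_linear_form hp
  set lu := polyAtHom (closedPoint p hp) l with hlu
  have hu : IsUnit lu := isUnit_linear hl hl1
  obtain ⟨li, hli⟩ := hu.exists_right_inv
  choose f' hf' using fun j => (isTwist_natCast_iff hl hl1).1 (hf j)
  let Φ' : Matrix J I (HLoc (closedPoint p hp)) := .of fun j i => normalize hl hl1 hp (hΦ j i)
  let τ' : Matrix J R (HLoc (closedPoint p hp)) := .of fun j r => normalize hl hl1 hp (hτ j r)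
  have hM : Function.Surjective (fromCols Φ' τ').mulVec := by
    classical
    refine mulVec_surjective_of_map ((locEval p hp).comp (valHom _)) (constHLoc _) constHom
      isUnit_of_locEval_val_ne_zero (fun c => ?_) ?_ hsurj
    · rw [RingHom.comp_apply, valHom_apply, val_constHLoc, locEval_const]
    · ext j (i | r)
      · exact locEval_normalize hl hl1 (hΦ j i)
      · exact locEval_normalize hl hl1 (hτ j r)
  obtain ⟨q, hq⟩ := hM f'
  refine ⟨fun i => (q (Sum.inl i)).val, fun r => (q (Sum.inr r)).val * li ^ ρ r,
    fun i => isTwist_zero_iff.2 ⟨_, rfl⟩, fun r => (isTwist_neg_iff hl hl1).2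
      ⟨q (Sum.inr r), by rw [mul_assoc, ← mul_pow, mul_comm li, hli, one_pow, mul_one]⟩, ?_⟩
  ext j
  have h1 := congrArg (valHom _) (congrFun hq j)
  rw [fromCols_mulVec, Pi.add_apply, map_add, mulVec, mulVec, dotProduct, dotProduct, map_sum,
    map_sum, valHom_apply] at h1
  rw [hf' j, ← h1, Pi.add_apply, add_mul, Finset.sum_mul, Finset.sum_mul]
  congr 1
  · rw [mulVec, dotProduct]
    refine Finset.sum_congr rfl fun i _ => ?_
    rw [map_mul, valHom_apply, valHom_apply]
    have h := val_normalize_mul (hp := hp) hl hl1 (hΦ j i)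
    change polyAtHom _ (Φ j i) * _ = (normalize hl hl1 hp (hΦ j i)).val * _ * _
    rw [← h]
    simp only [Function.comp_apply]
    ring
  · rw [mulVec, dotProduct]
    refine Finset.sum_congr rfl fun r _ => ?_
    rw [map_mul, valHom_apply, valHom_apply]
    have h := val_normalize_mul (hp := hp) hl hl1 (hτ j r)
    have h2 : lu ^ ρ r * li ^ ρ r = 1 := by rw [← mul_pow, hli, one_pow]
    change polyAtHom _ (τ j r) * _ = (normalize hl hl1 hp (hτ j r)).val * _ * _
    rw [← h, pow_add]
    simp only [Function.comp_apply]
    linear_combination ((normalize hl hl1 hp (hτ j r)).val * lu ^ dd j * (q (Sum.inr r)).val) * h2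

end LocalExactness

/-! ### Comparison of a presentation with a skew-symmetric matrix. -/

section Presentation

variable {J R : Type} [Fintype J] [Fintype R] {dd : J → ℕ} {ρ : R → ℕ} {τ : Matrix J R S}

/-- The map between sums of twisting sheaves given by a matrix with entries in row `j` and column
`r` of degree `dd j + ρ r`. -/
def relationHom (dd : J → ℕ) (ρ : R → ℕ) (τ : Matrix J R S)
    (hτ : ∀ j r, (τ j r).IsHomogeneous (dd j + ρ r)) :
    (⨁ fun r => twist (-ρ r : ℤ)) ⟶ ⨁ fun j => twist (dd j) :=
  polyMatrixHom τ (fun j r => dd j + ρ r) hτ (fun j r => by push_cast; ring)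

lemma compValue_relationHom (hτ : ∀ j r, (τ j r).IsHomogeneous (dd j + ρ r)) {U : P2.Opens}
    {x : ProjectiveSpectrum grading} (hx : x ∈ U) (y : Γ(⨁ fun r => twist (-ρ r : ℤ), U)) :
    compValue ((relationHom dd ρ τ hτ).app U y) x hx =
      (τ.map (polyAtHom x)).mulVec (compValue y x hx) :=
  compValue_polyMatrixHom _ _ _ _ _ _

lemma compValue_toHom {n : ℕ} (A : SkewLinearMatrix n) {U : P2.Opens}
    {x : ProjectiveSpectrum grading} (hx : x ∈ U) (y : Γ(⨁ fun _ : Fin n => twist (-1), U)) :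
    compValue (d := fun _ => 0) (A.toHom.app U y) x hx =
      (A.mat.map (polyAtHom x)).mulVec (compValue (d := fun _ => -1) y x hx) :=
  compValue_polyMatrixHom (d := fun _ => -1) (e := fun _ => 0) A.mat (fun _ _ => 1) A.linear
    (fun _ _ => rfl) hx y

/-- A sheaf with a presentation by sums of twisting sheaves is the cokernel of a skew-symmetric
matrix which resolves this presentation on every fibre. -/
theorem nonempty_iso_cokernel {E : P2.Modules}
    (hτ : ∀ j r, (τ j r).IsHomogeneous (dd j + ρ r))
    (π : (⨁ fun j => twist (dd j)) ⟶ E) (w : relationHom dd ρ τ hτ ≫ π = 0)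
    (hex : (ShortComplex.mk _ π w).Exact) [Epi π] {n : ℕ} (A : SkewLinearMatrix n)
    (Φ : Matrix J (Fin n) S) (hΦ : ∀ j i, (Φ j i).IsHomogeneous (dd j))
    (Ψ : Matrix R (Fin n) S) (e : R → ℕ) (he : ∀ r, e r + ρ r = 1)
    (hΨ : ∀ r i, (Ψ r i).IsHomogeneous (e r)) (hrel : Φ * A.mat = τ * Ψ)
    (hinj : ∀ p : Fin 3 → ℂ, p ≠ 0 → Function.Injective (τ.map (eval p)).mulVec)
    (hexact : ∀ p : Fin 3 → ℂ, p ≠ 0 → ∀ v w, Φ.map (eval p) *ᵥ v = τ.map (eval p) *ᵥ w →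
      ∃ u, v = A.mat.map (eval p) *ᵥ u)
    (hsurj : ∀ p : Fin 3 → ℂ, p ≠ 0 →
      Function.Surjective (fromCols (Φ.map (eval p)) (τ.map (eval p))).mulVec) :
    Nonempty (E ≅ cokernel A.toHom) := by
  let Φh : (⨁ fun _ : Fin n => twist 0) ⟶ ⨁ fun j => twist (dd j) :=
    polyMatrixHom (d := fun _ => 0) Φ (fun j _ => dd j) hΦ (fun j r => add_zero _)
  let Ψh : (⨁ fun _ : Fin n => twist (-1)) ⟶ ⨁ fun r => twist (-ρ r : ℤ) :=
    polyMatrixHom (d := fun _ => -1) Ψ (fun r _ => e r) hΨ (fun r _ => by have := he r; omega)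
  have hΦv : ∀ {U : P2.Opens} {x : ProjectiveSpectrum grading} (hx : x ∈ U)
      (y : Γ(⨁ fun _ : Fin n => twist 0, U)), compValue (Φh.app U y) x hx =
        (Φ.map (polyAtHom x)).mulVec (compValue (d := fun _ => 0) y x hx) :=
    fun hx y => compValue_polyMatrixHom (d := fun _ => 0) _ _ _ _ hx y
  have hΨv : ∀ {U : P2.Opens} {x : ProjectiveSpectrum grading} (hx : x ∈ U)
      (y : Γ(⨁ fun _ : Fin n => twist (-1), U)), compValue (Ψh.app U y) x hx =
        (Ψ.map (polyAtHom x)).mulVec (compValue (d := fun _ => -1) y x hx) :=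
    fun hx y => compValue_polyMatrixHom (d := fun _ => -1) _ _ _ _ hx y
  have hcomm : A.toHom ≫ Φh = Ψh ≫ relationHom dd ρ τ hτ := by
    refine Scheme.Modules.hom_ext _ _ fun U => ConcreteCategory.hom_ext _ _ fun y => ?_
    refine compValue_ext fun x hx => ?_
    rw [comp_app_apply, comp_app_apply, hΦv, compValue_toHom, compValue_relationHom, hΨv,
      mulVec_mulVec, mulVec_mulVec, ← Matrix.map_mul, ← Matrix.map_mul, hrel]
  have hw : A.toHom ≫ Φh ≫ π = 0 := by
    rw [← Category.assoc, hcomm, Category.assoc, w, comp_zero]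
  have hepi : LocSurj (Φh ≫ π) := by
    intro U t x hx
    obtain ⟨V, i, hxV, f, hf⟩ := locSurj_of_epi π U t x hx
    -- Fibre conditions are known only at closed points. It suffices to work at a closed
    -- specialization of `x`, because every open set containing it also contains `x`.
    obtain ⟨p, hp, hpV, hspec⟩ := exists_closedPoint_mem V x hxV
    obtain ⟨y, z, hy, hz, hyz⟩ := exists_lift_of_fibre_surjective (hp := hp) hΦ hτ (hsurj p hp)
      (compValue f _ hpV) (fun j => isTwist_compValue hpV f j)
    obtain ⟨V₁, hV₁, hpV₁, y', hy'⟩ := exists_section_compValue (d := fun _ => 0) hpV hy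
    obtain ⟨V₂, hV₂, hpV₂, z', hz'⟩ := exists_section_compValue hpV₁ hz
    have key : (⨁ fun j => twist (dd j)).presheaf.map (homOfLE (hV₂.trans hV₁)).op f =
        Φh.app V₂ ((⨁ fun _ : Fin n => twist 0).presheaf.map (homOfLE hV₂).op y') +
          (relationHom dd ρ τ hτ).app V₂ z' := by
      -- An identity between sections of a sum of twists holds on the whole open set as soon as it
      -- holds at one of its points.
      refine compValue_ext_of_mem hpV₂ ?_
      rw [compValue_map, compValue_add, hΦv, compValue_relationHom, hz']
      refine hyz.symm.trans ?_
      rw [← hy']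
      exact congrArg (fun v => Φ.map (polyAtHom (closedPoint p hp)) *ᵥ v + _)
        (compValue_map (d := fun _ => 0) (homOfLE hV₂) hpV₂ y').symm
    refine ⟨V₂, homOfLE (hV₂.trans hV₁) ≫ i, mem_of_specializes hspec V₂ hpV₂,
      (⨁ fun _ : Fin n => twist 0).presheaf.map (homOfLE hV₂).op y', ?_⟩
    rw [comp_app_apply, eq_sub_of_add_eq key.symm, map_sub, ← comp_app_apply _ π, w, app_map, hf]
    simp
  have hexact' : LocExact A.toHom (Φh ≫ π) := by
    intro U y hy x hx
    obtain ⟨V, i, hxV, z, hz⟩ := locExact_of_exact _ π w hex U (Φh.app U y) hy x hx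
    obtain ⟨p, hp, hpV, hspec⟩ := exists_closedPoint_mem V x hxV
    have hpU := leOfHom i hpV
    have h1 : Φ.map (polyAtHom (closedPoint p hp)) *ᵥ compValue (d := fun _ => 0) y _ hpU =
        τ.map (polyAtHom _) *ᵥ compValue z _ hpV := by
      rw [← hΦv, ← compValue_relationHom hτ, hz, compValue_map]
    obtain ⟨v, hv, hAv⟩ := exists_lift_of_fibre_exact (hp := hp) A.linear hΦ hτ hrel (hexact p hp)
      (hinj p hp) _ (fun i => isTwist_compValue (d := fun _ => 0) hpU y i) _ h1
    obtain ⟨V₁, hV₁, hpV₁, v', hv'⟩ := exists_section_compValue (d := fun _ => -1) hpV hv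
    refine ⟨V₁, homOfLE hV₁ ≫ i, mem_of_specializes hspec V₁ hpV₁, v', ?_⟩
    refine compValue_ext_of_mem (d := fun _ => 0) hpV₁ ?_
    rw [compValue_toHom, hv', hAv]
    exact (compValue_map (d := fun _ => 0) (homOfLE hV₁ ≫ i) hpV₁ y).symm
  have hE := exact_of_locExact A.toHom (Φh ≫ π) hw hexact'
  have : Epi (Φh ≫ π) := epi_of_locSurj _ hepi
  exact ⟨(hE.gIsCokernel.coconePointUniqueUpToIso (colimit.isColimit _))⟩

end Presentation

/-! ### Local bases of a vector bundle. -/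

section LocalBasis

/-- Restriction of sections. -/
def resSection {X : Scheme.{0}} (M : X.Modules) {U V : X.Opens} (h : V ≤ U) (y : Γ(M, U)) :
    Γ(M, V) := M.presheaf.map (homOfLE h).op y

lemma exists_basis_of_iso {X : Scheme.{0}} {M : X.Modules} {r : ℕ}
    (φ : M ≅ ⨁ fun _ : Fin r => structureModule X) :
    ∃ e : Fin r → Γ(M, ⊤), ∀ V : X.Opens,
      (∀ y : Γ(M, V), ∃ c : Fin r → Γ(X, V),
        y = (∑ i, c i • resSection M le_top (e i) : Γ(M, V))) ∧
      ∀ c : Fin r → Γ(X, V), (∑ i, c i • resSection M le_top (e i) : Γ(M, V)) = 0 → c = 0 := by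
  let N : X.Modules := ⨁ fun _ : Fin r => structureModule X
  let one : ∀ V : X.Opens, Γ(structureModule X, V) := fun V => (1 : Γ(X, V))
  let b : ∀ V : X.Opens, Fin r → Γ(N, V) := fun V i => (biproduct.ι (fun _ : Fin r => structureModule X) i).app V (one V)
  have hmap : ∀ (V : X.Opens) (i : V ⟶ ⊤) j, N.presheaf.map i.op (b ⊤ j) = b V j := by
    intro V i j
    rw [← app_map]
    congr 1
    exact map_one (X.presheaf.map i.op).hom
  have hsmul : ∀ (V : X.Opens) (c : Γ(structureModule X, V)),
      (show Γ(X, V) from c) • one V = c := fun V c => mul_one (show Γ(X, V) from c)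
  have hπ : ∀ (V : X.Opens) (c : Fin r → Γ(X, V)) j,
      (biproduct.π (fun _ : Fin r => structureModule X) j).app V (∑ i, c i • b V i) = c j := by
    intro V c j
    rw [map_sum, Finset.sum_eq_single j]
    · refine (Scheme.Modules.Hom.app_smul _ _ _).trans ((congrArg _ ?_).trans (hsmul V (c j)))
      refine (comp_app_apply _ _ V (one V)).symm.trans ?_
      rw [biproduct.ι_π_self]
      rfl
    · intro i _ hij
      refine (Scheme.Modules.Hom.app_smul _ _ _).trans ((congrArg _ ?_).trans (smul_zero _))
      refine (comp_app_apply _ _ V (one V)).symm.trans ?_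
      rw [biproduct.ι_π_ne _ hij]
      rfl
    · simp
  have hinv : ∀ (V : X.Opens) j, φ.inv.app V (b V j) =
      resSection M le_top (φ.inv.app ⊤ (b ⊤ j)) := by
    intro V j
    rw [resSection, ← app_map, hmap V (homOfLE le_top) j]
  have hφ : ∀ (V : X.Opens) (c : Fin r → Γ(X, V)), φ.inv.app V (∑ i, c i • b V i) =
      (∑ i, c i • resSection M le_top (φ.inv.app ⊤ (b ⊤ i)) : Γ(M, V)) := by
    intro V c
    rw [map_sum]
    refine Finset.sum_congr rfl fun i _ => ?_
    rw [Scheme.Modules.Hom.app_smul, hinv V i]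
  have hid : ∀ (V : X.Opens) (y : Γ(M, V)), φ.inv.app V (φ.hom.app V y) = y := by
    intro V y
    rw [← comp_app_apply, φ.hom_inv_id]
    rfl
  have hid' : ∀ (V : X.Opens) (y : Γ(N, V)), φ.hom.app V (φ.inv.app V y) = y := by
    intro V y
    rw [← comp_app_apply, φ.inv_hom_id]
    rfl
  refine ⟨fun i => φ.inv.app ⊤ (b ⊤ i), fun V => ⟨fun y => ?_, fun c hc => ?_⟩⟩
  · refine ⟨fun i => (biproduct.π (fun _ : Fin r => structureModule X) i).app V (φ.hom.app V y), ?_⟩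
    refine Eq.trans (hid V y).symm (Eq.trans ?_ (hφ V _))
    exact congrArg _ (biproduct_section_ext fun j => (hπ V
      (fun i => (biproduct.π (fun _ : Fin r => structureModule X) i).app V (φ.hom.app V y)) j).symm)
  · rw [← hφ] at hc
    have h0 : (∑ i, c i • b V i : Γ(N, V)) = 0 := by
      rw [← hid' V (∑ i, c i • b V i), hc, map_zero]
    ext j
    rw [← hπ V c j, h0, map_zero]
    rfl

/-- A vector bundle has local bases. -/
lemma exists_local_basis {E : P2.Modules} {r : ℕ} (hE : IsVectorBundle E r) (x : P2) :
    ∃ U : P2.Opens, x ∈ U ∧ ∃ e : Fin r → Γ(E, U), ∀ (V : P2.Opens) (h : V ≤ U),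
      (∀ y : Γ(E, V), ∃ c : Fin r → Γ(P2, V),
        y = (∑ i, c i • resSection E h (e i) : Γ(E, V))) ∧
      ∀ c : Fin r → Γ(P2, V), (∑ i, c i • resSection E h (e i) : Γ(E, V)) = 0 → c = 0 := by
  obtain ⟨U, hxU, ⟨φ⟩⟩ := hE x
  obtain ⟨e, he⟩ := exists_basis_of_iso φ
  refine ⟨U.ι ''ᵁ ⊤, by simpa using hxU, e, fun V h => ?_⟩
  obtain ⟨V', rfl⟩ : ∃ V' : U.toScheme.Opens, U.ι ''ᵁ V' = V := by
    refine ⟨U.ι ⁻¹ᵁ V, ?_⟩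
    rw [Scheme.Hom.image_preimage_eq_opensRange_inf]
    simpa using h
  have hi : ∀ (c : Γ(U.toScheme, V')) (y : Γ(E.restrict U.ι, V')),
      c • y = (show Γ(P2, U.ι ''ᵁ V') from (U.ι.appIso V').inv c) •
        (show Γ(E, U.ι ''ᵁ V') from y) := fun _ _ => rfl
  obtain ⟨h1, h2⟩ := he V'
  constructor
  · intro y
    obtain ⟨c, hc⟩ := h1 y
    exact ⟨fun i => (U.ι.appIso V').inv (c i), hc⟩
  · intro c hc
    have h3 := h2 (fun i => (U.ι.appIso V').hom (c i)) (by
      refine Eq.trans (Finset.sum_congr rfl fun i _ => ?_) hc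
      refine (hi _ _).trans ?_
      congr 1
      exact ConcreteCategory.congr_hom (U.ι.appIso V').hom_inv_id (c i))
    ext i
    have h4 := congrArg (fun c => (U.ι.appIso V').inv (c i)) h3
    refine Eq.trans ?_ (h4.trans (map_zero _))
    exact (ConcreteCategory.congr_hom (U.ι.appIso V').hom_inv_id (c i)).symm

end LocalBasis

/-! ### Independence of the relations on fibres, and their number. -/

section Rank

/-- Every element of the local ring is the value of a function. -/
lemma exists_function {U : P2.Opens} {x : ProjectiveSpectrum grading} (hx : x ∈ U) (r : HLoc x) :
    ∃ (V : P2.Opens) (_ : V ≤ U) (hxV : x ∈ V) (f : Γ(P2, V)), functionValue f x hxV = r := by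
  obtain ⟨V, hVU, hxV, t, ht⟩ := exists_section (isTwist_zero_iff.2 ⟨r, rfl⟩) hx
  obtain ⟨f, hf⟩ := (toTwistZero_bijective (op V)).2 t
  refine ⟨V, hVU, hxV, f, val_inj x ?_⟩
  rw [← ht, ← hf]
  rfl

lemma resSection_trans {X : Scheme.{0}} {M : X.Modules} {U V W : X.Opens} (h : V ≤ U) (h' : W ≤ V)
    (y : Γ(M, U)) : resSection M h' (resSection M h y) = resSection M (h'.trans h) y := by
  rw [resSection, resSection, resSection, ← ConcreteCategory.comp_apply, ← Functor.map_comp,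
    ← op_comp, homOfLE_comp]

lemma app_resSection {X : Scheme.{0}} {M N : X.Modules} (f : M ⟶ N) {U V : X.Opens} (h : V ≤ U)
    (y : Γ(M, U)) : f.app V (resSection M h y) = resSection N h (f.app U y) :=
  app_map _ _ _

variable {J R : Type} [Fintype J] [Fintype R] {dd : J → ℕ} {ρ : R → ℕ} {τ : Matrix J R S}

lemma compValue_resSection {d : J → ℤ} {U V : P2.Opens} {x : ProjectiveSpectrum grading}
    (h : V ≤ U) (hx : x ∈ V) (y : Γ(⨁ fun i => twist (d i), U)) :
    compValue (resSection _ h y) x hx = compValue y x (h hx) :=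
  compValue_map _ _ _

lemma compValue_sum_smul {d : J → ℤ} {ι : Type} (s : Finset ι) {U : P2.Opens}
    {x : ProjectiveSpectrum grading} (hx : x ∈ U) (c : ι → Γ(P2, U))
    (y : ι → Γ(⨁ fun i => twist (d i), U)) (j : J) :
    compValue (∑ i ∈ s, c i • y i : Γ(⨁ fun i => twist (d i), U)) x hx j =
      ∑ i ∈ s, (functionValue (c i) x hx).val * compValue (y i) x hx j := by
  classical
  induction s using Finset.induction_on with
  | empty => simp [compValue_zero]
  | insert a s ha ih =>
    rw [Finset.sum_insert ha, Finset.sum_insert ha, compValue_add, Pi.add_apply, ih,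
      compValue_smul]
    rfl

/-- Near a closed point, lifts of a basis of the quotient together with the relations form a
basis. -/
lemma exists_matrix_bijective {E : P2.Modules} {r : ℕ} (hE : IsVectorBundle E r)
    (hτ : ∀ j r, (τ j r).IsHomogeneous (dd j + ρ r))
    (π : (⨁ fun j => twist (dd j)) ⟶ E) (w : relationHom dd ρ τ hτ ≫ π = 0)
    (hex : (ShortComplex.mk _ π w).Exact) [Epi π] [Mono (relationHom dd ρ τ hτ)]
    {p : Fin 3 → ℂ} (hp : p ≠ 0) {l : S} (hl : l.IsHomogeneous 1) (hl1 : eval p l = 1) :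
    ∃ N : Matrix J (Fin r) (HLoc (closedPoint p hp)), Function.Bijective
      (fromCols N (.of fun j s => normalize hl hl1 hp (hτ j s))).mulVec := by
  set x := closedPoint p hp with hx
  set lu := polyAtHom x l with hlu
  have hu : IsUnit lu := isUnit_linear hl hl1
  obtain ⟨U, hxU, e, he⟩ := exists_local_basis hE x
  obtain ⟨V, hVU, hxV, hV⟩ := exists_open_forall (X := P2) (x := x) hxU
    (fun i V => ∃ (h : V ≤ U) (f : Γ(⨁ fun j => twist (dd j), V)),
      π.app V f = resSection E h (e i))
    (fun i V W hWV h => by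
      obtain ⟨hVU, f, hf⟩ := h
      exact ⟨hWV.trans hVU, resSection _ hWV f, by rw [app_resSection, hf, resSection_trans]⟩)
    (fun i => by
      obtain ⟨V, i', hxV, f, hf⟩ := locSurj_of_epi π U (e i) x hxU
      exact ⟨V, leOfHom i', hxV, leOfHom i', f, hf⟩)
  choose _ f hf using hV
  choose fh hfh using fun i j => (isTwist_natCast_iff hl hl1).1 (isTwist_compValue hxV (f i) j)
  let T : Matrix J R (HLoc x) := .of fun j s => normalize hl hl1 hp (hτ j s)
  have hT : ∀ j s, (T j s).val * lu ^ (dd j + ρ s) = polyAtHom x (τ j s) :=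
    fun j s => val_normalize_mul hl hl1 (hτ j s)
  have hvalue : ∀ (c : Fin r → HLoc x) (z : R → HLoc x) (z' : R → Loc x)
      (_ : ∀ s, z' s * lu ^ ρ s = (z s).val) (j : J),
      ((fromCols (.of fun j i => fh i j) T *ᵥ Sum.elim c z) j).val * lu ^ dd j =
        (∑ i, (c i).val * compValue (f i) x hxV j) + (τ.map (polyAtHom x) *ᵥ z') j := by
    intro c z z' hz j
    rw [fromCols_mulVec_sumElim, Pi.add_apply, ← valHom_apply, map_add, add_mul, mulVec, mulVec,
      mulVec, dotProduct, dotProduct, dotProduct, map_sum, map_sum, Finset.sum_mul, Finset.sum_mul]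
    congr 1
    · refine Finset.sum_congr rfl fun i _ => ?_
      rw [map_mul, valHom_apply, valHom_apply, hfh i j, of_apply]
      ring
    · refine Finset.sum_congr rfl fun s _ => ?_
      rw [map_mul, valHom_apply, valHom_apply, ← hz s, map_apply, ← hT]
      ring
  refine ⟨.of fun j i => fh i j, ?_, ?_⟩
  · rw [← coe_mulVecLin, ← LinearMap.ker_eq_bot, LinearMap.ker_eq_bot']
    intro cz hcz
    obtain ⟨c, z, rfl⟩ : ∃ c z, cz = Sum.elim c z := ⟨_, _, (Sum.elim_comp_inl_inr cz).symm⟩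
    obtain ⟨li, hli⟩ := hu.exists_right_inv
    have hz' : ∀ s, ((z s).val * li ^ ρ s) * lu ^ ρ s = (z s).val := fun s => by
      rw [mul_assoc, ← mul_pow, mul_comm li, hli, one_pow, mul_one]
    obtain ⟨V₁, hV₁, hxV₁, z', hzV⟩ := exists_section_compValue (d := fun s => (-ρ s : ℤ)) hxV
      (t := fun s => (z s).val * li ^ ρ s) (fun s => (isTwist_neg_iff hl hl1).2 ⟨z s, hz' s⟩)
    obtain ⟨V₂, hV₂, hxV₂, hc⟩ := exists_open_forall (X := P2) (x := x) hxV₁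
      (fun i V => ∀ hx : x ∈ V, ∃ f : Γ(P2, V), functionValue f x hx = c i)
      (fun i V W hWV h hxW => by
        obtain ⟨f, hf⟩ := h (hWV hxW)
        exact ⟨P2.presheaf.map (homOfLE hWV).op f, hf⟩)
      (fun i => by
        obtain ⟨V, hV, hxV, f, hf⟩ := exists_function hxV₁ (c i)
        exact ⟨V, hV, hxV, fun _ => ⟨f, hf⟩⟩)
    choose c' hc' using fun i => hc i hxV₂
    have h0 : (∑ i, c' i • resSection _ (hV₂.trans hV₁) (f i) :
        Γ(⨁ fun j => twist (dd j), V₂)) +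
        (relationHom dd ρ τ hτ).app V₂ (resSection _ hV₂ z') = 0 := by
      refine compValue_ext_of_mem hxV₂ (funext fun j => ?_)
      rw [compValue_add, compValue_zero, Pi.add_apply, compValue_sum_smul, compValue_relationHom,
        compValue_resSection, hzV]
      simp only [hc', compValue_resSection]
      refine (hvalue c z _ hz' j).symm.trans ?_
      have h1 := congrFun hcz j
      rw [mulVecLin_apply] at h1
      rw [h1, Pi.zero_apply, HomogeneousLocalization.val_zero, zero_mul]
      rfl
    -- The map `π` kills the relations, so only the combination of the basis of `E` survives. This
    -- gives `c = 0`, and then the relation map, being mono, gives `z = 0`.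
    have h1 : (∑ i, c' i • resSection E ((hV₂.trans hV₁).trans hVU) (e i) : Γ(E, V₂)) = 0 := by
      have h2 := congrArg (π.app V₂) h0
      rw [map_add, map_zero, ← comp_app_apply _ π, w, map_sum] at h2
      refine Eq.trans ?_ (Eq.trans (add_zero _).symm h2)
      refine Finset.sum_congr rfl fun i _ => ?_
      rw [Scheme.Modules.Hom.app_smul, app_resSection, hf, resSection_trans]
    have h2 : c' = 0 := (he V₂ _).2 _ h1
    have hc0 : c = 0 := by
      ext1 i
      rw [← hc', h2]
      rfl
    have h3 : (relationHom dd ρ τ hτ).app V₂ (resSection _ hV₂ z') = 0 := by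
      rw [h2] at h0
      simpa using h0
    have h4 := app_injective_of_mono (relationHom dd ρ τ hτ) V₂ (h3.trans (map_zero _).symm)
    have hz0 : z = 0 := by
      ext1 s
      have h5 := congrFun (congrArg (fun y => compValue y x hxV₂) h4) s
      rw [compValue_resSection, hzV, compValue_zero] at h5
      refine val_inj x ?_
      rw [← hz' s, (show (z s).val * li ^ ρ s = 0 from h5), zero_mul]
      exact (HomogeneousLocalization.val_zero (𝒜 := grading)).symm
    rw [hc0, hz0]
    ext (i | i) <;> rfl
  · intro g
    obtain ⟨V₁, hV₁, hxV₁, y, hy⟩ := exists_section_compValue (d := fun j => (dd j : ℤ)) hxV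
      (t := fun j => (g j).val * lu ^ dd j) (fun j => (isTwist_natCast_iff hl hl1).2 ⟨g j, rfl⟩)
    -- Subtracting the lift of the expansion of `π y` in the basis of `E` leaves a section of the
    -- kernel of `π`, which is locally a combination of the relations.
    obtain ⟨c, hc⟩ := (he V₁ (hV₁.trans hVU)).1 (π.app V₁ y)
    have h0 : π.app V₁ (y - ∑ i, c i • resSection _ hV₁ (f i)) = 0 := by
      rw [map_sub, hc, map_sum, sub_eq_zero]
      refine Finset.sum_congr rfl fun i _ => ?_
      rw [Scheme.Modules.Hom.app_smul, app_resSection, hf, resSection_trans]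
    obtain ⟨V₂, i₂, hxV₂, z', hz'⟩ := locExact_of_exact _ π w hex V₁ _ h0 x hxV₁
    choose z hz using fun s => (isTwist_neg_iff hl hl1).1 (isTwist_compValue hxV₂ z' s)
    refine ⟨Sum.elim (fun i => functionValue (c i) x hxV₁) z, funext fun j => val_inj x ?_⟩
    have h1 := hvalue (fun i => functionValue (c i) x hxV₁) z _ hz j
    rw [← compValue_relationHom hτ, hz', compValue_map, compValue_sub, hy, Pi.sub_apply,
      compValue_sum_smul] at h1
    simp only [compValue_resSection] at h1
    rw [add_sub_cancel] at h1
    exact (hu.pow _).mul_right_cancel h1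

/-- The relations of a vector bundle are independent on every fibre, and their number is given by
the rank. -/
theorem card_eq_and_mulVec_injective {E : P2.Modules} {r : ℕ} (hE : IsVectorBundle E r)
    (hτ : ∀ j r, (τ j r).IsHomogeneous (dd j + ρ r))
    (π : (⨁ fun j => twist (dd j)) ⟶ E) (w : relationHom dd ρ τ hτ ≫ π = 0)
    (hex : (ShortComplex.mk _ π w).Exact) [Epi π] [Mono (relationHom dd ρ τ hτ)]
    {p : Fin 3 → ℂ} (hp : p ≠ 0) :
    Fintype.card J = r + Fintype.card R ∧ Function.Injective (τ.map (eval p)).mulVec := by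
  classical
  obtain ⟨l, hl, hl1⟩ := exists_linear_form hp
  obtain ⟨N, hN⟩ := exists_matrix_bijective hE hτ π w hex hp hl hl1
  set T : Matrix J R (HLoc (closedPoint p hp)) := .of fun j s => normalize hl hl1 hp (hτ j s)
  have hc1 := card_le_of_injective _ (fromCols N T).mulVecLin hN.1
  have hc2 := card_le_of_surjective _ (fromCols N T).mulVecLin hN.2
  have hcard : Fintype.card (Fin r ⊕ R) = Fintype.card J := le_antisymm hc1 hc2
  refine ⟨by rw [← hcard, Fintype.card_sum, Fintype.card_fin], ?_⟩
  -- A right inverse of a square matrix is also a left inverse. Reduction to the residue field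
  -- preserves it, so the columns of the reduced matrix, those of `τ(p)` among them, stay
  -- independent.
  obtain ⟨B, hB⟩ : ∃ B : Matrix (Fin r ⊕ R) J (HLoc (closedPoint p hp)), fromCols N T * B = 1 := by
    choose b hb using fun j : J => hN.2 (Pi.single j 1)
    refine ⟨(Matrix.of b)ᵀ, ?_⟩
    refine Matrix.ext fun i j => ?_
    have := congrFun (hb j) i
    rw [Matrix.one_apply, Matrix.mul_apply]
    rw [Pi.single_apply] at this
    exact this
  rw [mul_eq_one_comm_of_card_eq _ _ _ hcard.symm] at hB
  let ev := (locEval p hp).comp (valHom _)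
  have hB' : B.map ev * (fromCols N T).map ev = 1 := by
    rw [← Matrix.map_mul, hB]
    simp
  rw [← coe_mulVecLin, ← LinearMap.ker_eq_bot, LinearMap.ker_eq_bot']
  intro v hv
  have h1 : (fromCols N T).map ev *ᵥ Sum.elim 0 (constHom ∘ v) = 0 := by
    ext j
    have h2 := congrArg constHom (congrFun hv j)
    rw [mulVecLin_apply, mulVec, dotProduct, map_sum] at h2
    rw [mulVec, dotProduct, Fintype.sum_sum_type, Finset.sum_eq_zero (by simp), zero_add]
    refine Eq.trans ?_ (h2.trans (map_zero _))
    refine Finset.sum_congr rfl fun s _ => ?_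
    rw [map_mul]
    exact congrArg (· * _) (locEval_normalize hl hl1 (hτ j s))
  have h2 := congrArg (B.map ev).mulVec h1
  rw [mulVec_mulVec, hB', one_mulVec, mulVec_zero] at h2
  ext s
  have h3 := congrFun h2 (Sum.inr s)
  exact (map_eq_zero constHom).1 h3

end Rank

/-! ### Homogeneous polynomials of integer degree. -/

section Graded

/-- The homogeneous polynomials of degree `d`; there are none but `0` if `d` is negative. -/
def homogeneousPart (d : ℤ) : Submodule ℂ S where
  carrier := {f | ∀ m, MvPolynomial.coeff m f ≠ 0 → (m.degree : ℤ) = d}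
  zero_mem' := fun m hm => absurd (MvPolynomial.coeff_zero m) hm
  add_mem' := fun {f g} hf hg m hm => by
    by_cases h : MvPolynomial.coeff m f = 0
    · exact hg m fun h' => hm (by rw [MvPolynomial.coeff_add, h, h', add_zero])
    · exact hf m h
  smul_mem' := fun c f hf m hm => hf m fun h => hm (by rw [MvPolynomial.coeff_smul, h, smul_zero])

lemma mem_homogeneousPart_natCast {d : ℕ} {f : S} :
    f ∈ homogeneousPart d ↔ f.IsHomogeneous d := by
  refine forall_congr' fun m => ?_
  rw [Nat.cast_inj, Finsupp.degree_eq_weight_one]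
  rfl

lemma eq_zero_of_mem_homogeneousPart {d : ℤ} (hd : d < 0) {f : S} (hf : f ∈ homogeneousPart d) :
    f = 0 := by
  ext m
  by_contra h
  have := hf m h
  omega

lemma mem_homogeneousPart_iff {d : ℤ} {f : S} :
    f ∈ homogeneousPart d ↔ f = 0 ∨ ∃ k : ℕ, d = k ∧ f.IsHomogeneous k := by
  constructor
  · intro hf
    rcases lt_or_ge d 0 with hd | hd
    · exact .inl (eq_zero_of_mem_homogeneousPart hd hf)
    · lift d to ℕ using hd
      exact .inr ⟨d, rfl, mem_homogeneousPart_natCast.1 hf⟩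
  · rintro (rfl | ⟨k, rfl, hk⟩)
    · exact zero_mem _
    · exact mem_homogeneousPart_natCast.2 hk

lemma mul_mem_homogeneousPart {d e t : ℤ} {f g : S} (hf : f ∈ homogeneousPart d)
    (hg : g ∈ homogeneousPart e) (h : d + e = t) : f * g ∈ homogeneousPart t := by
  rw [mem_homogeneousPart_iff] at hf hg ⊢
  rcases hf with rfl | ⟨k, rfl, hk⟩
  · exact .inl (zero_mul _)
  rcases hg with rfl | ⟨k', rfl, hk'⟩
  · exact .inl (mul_zero _)
  · exact .inr ⟨k + k', by rw [← h]; push_cast; rfl, hk.mul hk'⟩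

lemma X_mem_homogeneousPart (i : Fin 3) : (MvPolynomial.X i : S) ∈ homogeneousPart 1 :=
  mem_homogeneousPart_natCast.2 (MvPolynomial.isHomogeneous_X ℂ i)

lemma mem_homogeneousPart_of_mul_mem {e t : ℤ} {f g : S} (hf : f ∈ homogeneousPart e)
    (hf0 : f ≠ 0) (h : f * g ∈ homogeneousPart t) : g ∈ homogeneousPart (t - e) := by
  obtain ⟨e, rfl, he⟩ := (mem_homogeneousPart_iff.1 hf).resolve_left hf0
  rw [← DirectSum.sum_support_decompose grading g]
  refine sum_mem fun k _ => ?_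
  have h1 := DirectSum.coe_decompose_mul_add_of_left_mem (b := g) grading (j := k) he
  rcases mem_homogeneousPart_iff.1 h with h0 | ⟨t, rfl, ht⟩
  · rw [(mul_eq_zero.1 h0).resolve_left hf0, DirectSum.decompose_zero]
    exact zero_mem _
  · by_cases hk : e + k = t
    · rw [← hk, Nat.cast_add, add_sub_cancel_left, mem_homogeneousPart_natCast]
      exact (DirectSum.decompose grading g k).2
    · rw [DirectSum.decompose_of_mem_ne grading ht (Ne.symm hk)] at h1
      rw [(mul_eq_zero.1 h1.symm).resolve_left hf0]
      exact zero_mem _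

end Graded

/-! ### Extension across the origin of affine three-space. -/

section Hartogs

/-- The zero locus of `I` contains at most the origin, so by the Nullstellensatz each variable lies
in the radical. Two coprime powers are all that is used. -/
lemma exists_pow_mem {I : Ideal S} (hI : ∀ p : Fin 3 → ℂ, p ≠ 0 → ∃ D ∈ I, eval p D ≠ 0) :
    ∃ n, (MvPolynomial.X 0 : S) ^ n ∈ I ∧ (MvPolynomial.X 1 : S) ^ n ∈ I := by
  have key : ∀ i, ∃ n, (MvPolynomial.X i : S) ^ n ∈ I := fun i => by
    change MvPolynomial.X i ∈ I.radical
    rw [← MvPolynomial.vanishingIdeal_zeroLocus_eq_radical (K := ℂ),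
      MvPolynomial.mem_vanishingIdeal_iff]
    intro p hp
    rw [MvPolynomial.mem_zeroLocus_iff] at hp
    by_cases h : p = 0
    · simp [h]
    · obtain ⟨D, hD, hDp⟩ := hI p h
      exact absurd (by simpa [MvPolynomial.aeval_eq_eval] using hp D hD) hDp
  obtain ⟨n, hn⟩ := key 0
  obtain ⟨m, hm⟩ := key 1
  exact ⟨n + m, by rw [pow_add]; exact I.mul_mem_right _ hn, by
    rw [pow_add]; exact I.mul_mem_left _ hm⟩

/-- A fraction with denominator `X 0 ^ n` and also with denominator `X 1 ^ n` is a polynomial,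
because the two denominators are coprime. -/
lemma exists_eq_pow_mul {n : ℕ} {f g : S}
    (h : MvPolynomial.X 0 ^ n * g = MvPolynomial.X 1 ^ n * f) :
    ∃ q, f = MvPolynomial.X 0 ^ n * q := by
  have hX : Prime (MvPolynomial.X 0 : S) := MvPolynomial.X_prime
  have h1 : ¬ (MvPolynomial.X 0 : S) ∣ MvPolynomial.X 1 ^ n := by
    intro h1
    have h2 := hX.dvd_of_dvd_pow h1
    rw [MvPolynomial.X_dvd_X] at h2
    simp at h2
  exact hX.pow_dvd_of_dvd_mul_left n h1 ⟨g, h.symm⟩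

lemma eq_zero_of_eval_eq_zero {f : S} (h : ∀ p : Fin 3 → ℂ, p ≠ 0 → eval p f = 0) : f = 0 := by
  have h1 : MvPolynomial.X 0 * f = 0 := by
    refine MvPolynomial.funext fun p => ?_
    by_cases hp : p = 0
    · simp [hp]
    · simp [h p hp]
  exact (mul_eq_zero.1 h1).resolve_left (MvPolynomial.X_ne_zero 0)

end Hartogs

/-! ### Linear syzygies of the coordinates. -/

section Linear

lemma exists_linear_coeff {l : S} (hl : l.IsHomogeneous 1) :
    ∃ c : Fin 3 → ℂ, l = ∑ i, MvPolynomial.C (c i) * MvPolynomial.X i := by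
  have h : l ∈ MvPolynomial.homogeneousSubmodule (Fin 3) ℂ 1 := hl
  rw [MvPolynomial.homogeneousSubmodule_one_eq_span_X, Submodule.mem_span_range_iff_exists_fun] at h
  obtain ⟨c, rfl⟩ := h
  exact ⟨c, Finset.sum_congr rfl fun i _ => MvPolynomial.smul_eq_C_mul _ _⟩

/-- The Koszul complex is exact on linear forms. -/
lemma exists_of_sum_X_mul_eq_zero {l : Fin 3 → S} (hl : ∀ i, (l i).IsHomogeneous 1)
    (h : ∑ i, MvPolynomial.X i * l i = 0) :
    ∃ v : Fin 3 → ℂ, ∀ i, l i = MvPolynomial.X (i + 1) * MvPolynomial.C (v (i + 2)) -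
      MvPolynomial.X (i + 2) * MvPolynomial.C (v (i + 1)) := by
  choose c hc using fun i => exists_linear_coeff (hl i)
  have key : ∀ p : Fin 3 → ℂ, ∑ i, p i * ∑ j, c i j * p j = 0 := fun p => by
    have := congrArg (eval p) h
    simpa [hc] using this
  -- The quadratic form with matrix `c` vanishes identically. Its values at these six vectors show
  -- that `c` is skew-symmetric, hence a cross product with a constant vector.
  have h00 := key ![1, 0, 0]
  have h11 := key ![0, 1, 0]
  have h22 := key ![0, 0, 1]
  have h01 := key ![1, 1, 0]
  have h02 := key ![1, 0, 1]
  have h12 := key ![0, 1, 1]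
  simp only [Fin.sum_univ_three, Matrix.cons_val_zero, Matrix.cons_val_one, Matrix.cons_val] at *
  ring_nf at h00 h11 h22 h01 h02 h12
  have e10 : c 1 0 = - c 0 1 := by linear_combination h01 - h00 - h11
  have e20 : c 2 0 = - c 0 2 := by linear_combination h02 - h00 - h22
  have e21 : c 2 1 = - c 1 2 := by linear_combination h12 - h11 - h22
  refine ⟨![c 1 2, c 2 0, c 0 1], fun i => ?_⟩
  rw [hc i]
  fin_cases i
  · simp [h00, e20]; ring
  · simp [h11, e10]; ring
  · simp [h22, e20, e21]; ring

end Linear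

/-! ### Global sections of the twisting sheaves. -/

section GlobalSections

/-- A homogeneous polynomial of degree `d` as a section of `𝒪(d)`. -/
def polySection {d : ℕ} {q : S} (hq : q.IsHomogeneous d) (U : P2.Opens) : Γ(twist d, U) :=
  (⟨fun x => polyAt x.1 q, isLocallyTwistedFraction_poly hq U⟩ : twistSections d (op U))

lemma twistValue_polySection {d : ℕ} {q : S} (hq : q.IsHomogeneous d) (U : P2.Opens)
    (x : ProjectiveSpectrum grading) (hx : x ∈ U) :
    twistValue (polySection hq U) x hx = polyAtHom x q := (polyAtHom_apply x q).symm

lemma polyAtHom_injective (x : ProjectiveSpectrum grading) : Function.Injective (polyAtHom x) := by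
  intro f g h
  rw [polyAtHom_apply, polyAtHom_apply] at h
  have := frac_eq_iff.1 h
  rwa [one_mul, one_mul] at this

lemma isUnit_polyAtHom {x : ProjectiveSpectrum grading} {f : S} (hf : f ∉ x.asHomogeneousIdeal) :
    IsUnit (polyAtHom x f) :=
  IsLocalization.map_units (Loc x) (⟨f, hf⟩ : x.asHomogeneousIdeal.toIdeal.primeCompl)

lemma polyAtHom_mul_frac {x : ProjectiveSpectrum grading} {a b : S}
    (hb : b ∉ x.asHomogeneousIdeal) : polyAtHom x b * frac x a b hb = polyAtHom x a := by
  rw [polyAtHom_apply, polyAtHom_apply, frac_mul _ _ _ _ _ _ _ (by rwa [one_mul]), frac_eq_iff]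
  ring

/-- The global sections of `𝒪(d)` are the homogeneous polynomials of degree `d`. -/
lemma exists_polySection_eq {d : ℕ} (f : Γ(twist d, (⊤ : P2.Opens))) :
    ∃ (q : S) (hq : q.IsHomogeneous d), f = polySection hq ⊤ := by
  have htop : ∀ x : ProjectiveSpectrum grading, x ∈ (⊤ : P2.Opens) := fun x => trivial
  set t := twistValue f genericPoint (htop _) with ht
  -- The ideal of denominators of the generic value `t`. Local fractions for the section supply, at
  -- every closed point, a denominator that is nonzero there.
  let I : Ideal S := (LinearMap.range (Algebra.linearMap S (Loc genericPoint))).comap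
    (LinearMap.toSpanSingleton S _ t)
  have hI : ∀ D, D ∈ I ↔ ∃ F, polyAtHom genericPoint F = polyAtHom genericPoint D * t :=
    fun D => by
      refine exists_congr fun F => ?_
      rw [LinearMap.toSpanSingleton_apply, Algebra.smul_def]
      rfl
  have hfrac : ∀ x : ProjectiveSpectrum grading, ∃ (i j : ℕ) (a b : S), (i : ℤ) = j + d ∧ a ∈ grading i ∧ b ∈ grading j ∧
      b ∉ x.asHomogeneousIdeal ∧ polyAtHom genericPoint a = polyAtHom genericPoint b * t := by
    intro x
    obtain ⟨V, hV, hxV, i, j, a, b, hij, ha, hb, hbV, h⟩ := exists_frac f x (htop x)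
    refine ⟨i, j, a, b, hij, ha, hb, hbV x hxV, ?_⟩
    rw [ht, h _ (genericPoint_mem V hxV), polyAtHom_mul_frac]
  obtain ⟨n, ⟨F, hF⟩, ⟨G, hG⟩⟩ : ∃ n, (∃ F, polyAtHom genericPoint F =
      polyAtHom genericPoint (MvPolynomial.X 0 ^ n) * t) ∧ ∃ F, polyAtHom genericPoint F =
      polyAtHom genericPoint (MvPolynomial.X 1 ^ n) * t := by
    obtain ⟨n, h0, h1⟩ := exists_pow_mem (I := I) fun p hp => by
      obtain ⟨i, j, a, b, hij, ha, hb, hbp, h⟩ := hfrac (closedPoint p hp)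
      exact ⟨b, (hI b).2 ⟨a, h⟩, fun h0 => hbp ((mem_lineIdeal_of_isHomogeneous p hb).2 h0)⟩
    exact ⟨n, (hI _).1 h0, (hI _).1 h1⟩
  obtain ⟨q, hq⟩ := exists_eq_pow_mul (n := n) (f := F) (g := G) (by
    apply polyAtHom_injective genericPoint
    rw [map_mul, map_mul, hF, hG]
    ring)
  have hX : (MvPolynomial.X 0 : S) ^ n ∉ genericPoint.asHomogeneousIdeal :=
    pow_ne_zero n (MvPolynomial.X_ne_zero 0)
  have htq : t = polyAtHom genericPoint q := by
    refine (isUnit_polyAtHom hX).mul_left_cancel ?_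
    rw [← hF, hq, map_mul]
  obtain ⟨i, j, a, b, hij, ha, hb, hbp, h⟩ := hfrac genericPoint
  rw [htq, ← map_mul] at h
  have hab := polyAtHom_injective genericPoint h
  have hqd : q.IsHomogeneous d := by
    rw [← mem_homogeneousPart_natCast]
    have h1 := mem_homogeneousPart_of_mul_mem (mem_homogeneousPart_natCast.2 hb)
      (fun h0 => hbp (by rw [h0]; exact zero_mem _)) (g := q) (t := i)
      (by rw [← hab]; exact mem_homogeneousPart_natCast.2 ha)
    rwa [show (i : ℤ) - j = d by omega] at h1
  refine ⟨q, hqd, twist_ext_of_mem (htop genericPoint) ?_⟩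
  rw [twistValue_polySection, ← htq]

/-- A map from `𝒪` is determined by the image of the section `1`. -/
lemma twistZero_hom_ext {N : P2.Modules} {f g : twist 0 ⟶ N}
    (h : f.app ⊤ (polySection (d := 0) (MvPolynomial.isHomogeneous_one _ _) ⊤) =
      g.app ⊤ (polySection (d := 0) (MvPolynomial.isHomogeneous_one _ _) ⊤)) : f = g := by
  refine Scheme.Modules.hom_ext _ _ fun U => ConcreteCategory.hom_ext _ _ fun y => ?_
  obtain ⟨r, hr⟩ := (toTwistZero_bijective (op U)).2 y
  let one : ∀ U : P2.Opens, Γ(twist 0, U) :=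
    polySection (d := 0) (MvPolynomial.isHomogeneous_one _ _)
  have h1 : y = (show Γ(P2, U) from r) • one U := by
    rw [← hr]
    refine twist_ext (d := 0) fun x hx => ?_
    rw [twistValue_smul]
    have h2 : twistValue (one U) x hx = 1 := Localization.mk_one
    rw [h2, mul_one]
    rfl
  have h2 : one U = (twist 0).presheaf.map (homOfLE le_top).op (one ⊤) := rfl
  rw [h1, Scheme.Modules.Hom.app_smul, Scheme.Modules.Hom.app_smul, h2, app_map, app_map, h]

end GlobalSections

/-! ### The Euler sequence and the global sections of the quotient bundle. -/

section Euler

lemma compValue_eulerMap {U : P2.Opens} {x : ProjectiveSpectrum grading} (hx : x ∈ U)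
    (g : Γ(twist (-1), U)) (k : Fin 3) :
    compValue (d := fun _ : Fin 3 => 0) (eulerMap.app U g) x hx k =
      polyAtHom x (MvPolynomial.X k) * twistValue g x hx := by
  rw [compValue, ← comp_app_apply, eulerMap, biproduct.lift_π, polyAtHom_apply]
  rfl

/-- The matrix of the cross product with the vector of coordinates. -/
def koszulMatrix : Matrix (Fin 3) (Fin 3) S :=
  .of fun i j => if j = i + 2 then MvPolynomial.X (i + 1) else
    if j = i + 1 then -MvPolynomial.X (i + 2) else 0

lemma koszulMatrix_mulVec {A : Type} [CommRing A] (φ : S →+* A) (v : Fin 3 → A) (i : Fin 3) :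
    (koszulMatrix.map φ *ᵥ v) i = φ (MvPolynomial.X (i + 1)) * v (i + 2) -
      φ (MvPolynomial.X (i + 2)) * v (i + 1) := by
  fin_cases i <;> simp [koszulMatrix, Matrix.mulVec, dotProduct, Fin.sum_univ_three] <;> ring

/-- The map `𝒪 ^ 3 ⟶ 𝒪(1) ^ 3` given by the cross product with the vector of coordinates. -/
def koszulMap : (⨁ fun _ : Fin 3 => twist 0) ⟶ ⨁ fun _ : Fin 3 => twist (1 : ℕ) :=
  polyMatrixHom (d := fun _ => 0) (e := fun _ => (1 : ℕ)) koszulMatrix (fun _ _ => 1)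
    (fun i j => by
      rw [koszulMatrix, of_apply]
      split_ifs
      · exact MvPolynomial.isHomogeneous_X _ _
      · exact (MvPolynomial.isHomogeneous_X _ _).neg
      · exact MvPolynomial.isHomogeneous_zero _ _ _) fun _ _ => rfl

lemma compValue_koszulMap {U : P2.Opens} {x : ProjectiveSpectrum grading} (hx : x ∈ U)
    (y : Γ(⨁ fun _ : Fin 3 => twist 0, U)) (i : Fin 3) :
    compValue (d := fun _ : Fin 3 => (1 : ℕ)) (koszulMap.app U y) x hx i =
      polyAtHom x (MvPolynomial.X (i + 1)) * compValue (d := fun _ => 0) y x hx (i + 2) -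
      polyAtHom x (MvPolynomial.X (i + 2)) * compValue (d := fun _ => 0) y x hx (i + 1) := by
  rw [← koszulMatrix_mulVec]
  exact congrFun (compValue_polyMatrixHom (d := fun _ => 0) _ _ _ _ hx y) i

lemma eulerMap_koszulMap : eulerMap ≫ koszulMap = 0 := by
  refine Scheme.Modules.hom_ext _ _ fun U => ConcreteCategory.hom_ext _ _ fun y => ?_
  refine compValue_ext (d := fun _ : Fin 3 => (1 : ℕ)) fun x hx => funext fun i => ?_
  refine (compValue_koszulMap hx (eulerMap.app U y) i).trans ?_
  rw [compValue_eulerMap, compValue_eulerMap]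
  refine Eq.trans ?_ (congrFun (compValue_zero (d := fun _ : Fin 3 => (1 : ℕ)) hx) i).symm
  rw [Pi.zero_apply]
  ring

/-- If the cross product of `y` with the coordinate vector vanishes, then `X i * y j = X j * y i`.
Where `X k` is invertible, `y` is the coordinate vector times `y k / X k`. -/
lemma locExact_koszulMap : LocExact eulerMap koszulMap := by
  intro U y hy x hx
  obtain ⟨k, hk⟩ := exists_X_notMem x
  have hrel : ∀ i j, polyAtHom x (MvPolynomial.X i) * compValue (d := fun _ => 0) y x hx j =
      polyAtHom x (MvPolynomial.X j) * compValue (d := fun _ => 0) y x hx i := by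
    have h : ∀ i, polyAtHom x (MvPolynomial.X (i + 1)) *
        compValue (d := fun _ => 0) y x hx (i + 2) =
        polyAtHom x (MvPolynomial.X (i + 2)) * compValue (d := fun _ => 0) y x hx (i + 1) := by
      intro i
      rw [← sub_eq_zero, ← compValue_koszulMap hx y i, hy]
      exact congrFun (compValue_zero (d := fun _ : Fin 3 => (1 : ℕ)) hx) i
    have h0 := h 0
    have h1 := h 1
    have h2 := h 2
    intro i j
    fin_cases i <;> fin_cases j <;>
      first | rfl | exact h0 | exact h1 | exact h2 | exact h0.symm | exact h1.symm | exact h2.symm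
  have hg : IsTwist (-1) (frac x 1 _ hk * compValue (d := fun _ => 0) y x hx k) := by
    simpa using (isTwist_inv (MvPolynomial.isHomogeneous_X ℂ k) hk).mul
      (isTwist_compValue (d := fun _ => 0) hx y k)
  obtain ⟨V, hV, hxV, g, hgV⟩ := exists_section hg hx
  refine ⟨V, homOfLE hV, hxV, g, compValue_ext_of_mem (d := fun _ => 0) hxV (funext fun i => ?_)⟩
  refine (compValue_eulerMap hxV g i).trans ?_
  rw [hgV]
  refine Eq.trans ?_ (congrFun (compValue_map (d := fun _ => 0) (homOfLE hV) hxV y) i).symm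
  refine (isUnit_polyAtHom hk).mul_left_cancel ?_
  have h1 := polyAtHom_mul_frac (a := 1) hk
  rw [map_one] at h1
  linear_combination hrel i k + polyAtHom x (MvPolynomial.X i) *
    compValue (d := fun _ => 0) y x hx k * h1

/-- The global sections of the quotient bundle come from `ℂ ^ 3`. -/
lemma exists_lift_globalSection (t : Γ(Q, (⊤ : P2.Opens))) :
    ∃ v : Γ(⨁ fun _ : Fin 3 => twist 0, (⊤ : P2.Opens)), (cokernel.π eulerMap).app ⊤ v = t := by
  -- The cross product with the coordinates factors through `Q`. It turns a global section of `Q`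
  -- into three linear forms.
  let κ : Q ⟶ ⨁ fun _ : Fin 3 => twist (1 : ℕ) := cokernel.desc eulerMap koszulMap eulerMap_koszulMap
  have hκ : cokernel.π eulerMap ≫ κ = koszulMap := cokernel.π_desc _ _ _
  have hsurj : LocSurj (cokernel.π eulerMap) := locSurj_of_epi _
  choose l hl hlt using fun i =>
    exists_polySection_eq ((biproduct.π (fun _ : Fin 3 => twist (1 : ℕ)) i).app ⊤ (κ.app ⊤ t))
  have hvalue : ∀ (x : ProjectiveSpectrum grading) i,
      compValue (d := fun _ : Fin 3 => (1 : ℕ)) (κ.app ⊤ t) x trivial i = polyAtHom x (l i) := by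
    intro x i
    exact (congrArg (fun f => twistValue (U := ⊤) f x trivial) (hlt i)).trans
      (twistValue_polySection (hl i) _ _ _)
  -- The vector `l` is locally a cross product with the coordinate vector, hence orthogonal to it.
  -- The identity of polynomials can be checked at the generic point.
  have hsum : ∑ i, MvPolynomial.X i * l i = 0 := by
    apply polyAtHom_injective genericPoint
    obtain ⟨V, i, hxV, f, hf⟩ := hsurj ⊤ t genericPoint trivial
    have h1 : koszulMap.app V f =
        (⨁ fun _ : Fin 3 => twist (1 : ℕ)).presheaf.map i.op (κ.app ⊤ t) := by
      rw [← hκ, comp_app_apply, hf]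
      exact app_map κ i t
    have h2 : ∀ j, compValue (d := fun _ : Fin 3 => (1 : ℕ)) (koszulMap.app V f) genericPoint hxV j =
        polyAtHom genericPoint (l j) := fun j => by
      rw [h1, ← hvalue]
      exact congrFun (compValue_map (d := fun _ : Fin 3 => (1 : ℕ)) i hxV _) j
    have h3 := fun j => (h2 j).symm.trans (compValue_koszulMap hxV f j)
    rw [map_sum, map_zero, Fin.sum_univ_three]
    rw [map_mul, map_mul, map_mul, h3, h3, h3]
    simp only [Fin.isValue, zero_add, Fin.reduceAdd]
    ring
  obtain ⟨c, hc⟩ := exists_of_sum_X_mul_eq_zero hl hsum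
  obtain ⟨v, hv⟩ := exists_biproduct_section (X := P2) (U := ⊤) (M := fun _ : Fin 3 => twist 0)
    fun i => polySection (d := 0) (MvPolynomial.isHomogeneous_C _ (c i)) ⊤
  have hvv : ∀ x i, compValue (d := fun _ => 0) v x trivial i =
      polyAtHom x (MvPolynomial.C (c i)) := fun x i =>
    (congrArg (fun f => twistValue (U := ⊤) f x trivial) (hv i)).trans
      (twistValue_polySection (d := 0) _ _ _ _)
  have hkv : koszulMap.app ⊤ v = κ.app ⊤ t := by
    refine compValue_ext (d := fun _ : Fin 3 => (1 : ℕ)) fun x hx => funext fun i => ?_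
    rw [hvalue x i]
    refine (compValue_koszulMap hx v i).trans ?_
    rw [hvv, hvv, hc i, map_sub, map_mul, map_mul]
  refine ⟨v, section_ext_of_locally fun x hx => ?_⟩
  obtain ⟨V, i, hxV, f, hf⟩ := hsurj ⊤ t x hx
  -- Locally `t` is the image of some `f`. The difference `v - f` is killed by the Koszul map, so it
  -- comes from the Euler map and vanishes in `Q`.
  have h0 : koszulMap.app V ((⨁ fun _ : Fin 3 => twist 0).presheaf.map i.op v - f) = 0 := by
    rw [map_sub, sub_eq_zero, app_map, hkv, ← hκ, comp_app_apply, hf]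
    exact (app_map κ i t).symm
  obtain ⟨W, i', hxW, g, hg⟩ := locExact_koszulMap V _ h0 x hxV
  have h1 := congrArg ((cokernel.π eulerMap).app W) hg
  rw [← comp_app_apply, cokernel.condition, app_map, map_sub, hf, app_map, map_sub, eq_comm,
    sub_eq_iff_eq_add] at h1
  have hcomp : ∀ z : Γ(Q, (⊤ : P2.Opens)), Q.presheaf.map (i' ≫ i).op z =
      Q.presheaf.map i'.op (Q.presheaf.map i.op z) := fun z => by
    rw [op_comp, Functor.map_comp, ConcreteCategory.comp_apply]
  exact ⟨W, i' ≫ i, hxW, (hcomp _).trans ((h1.trans (zero_add _)).trans (hcomp t).symm)⟩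

end Euler

/-! ### The cover of `F` by a sum of line bundles. -/

section BundlePresentation

/-- The projection onto the quotient bundle. -/
def quotientMap : (⨁ fun _ : Fin 3 => twist 0) ⟶ Q := cokernel.π eulerMap

instance : Epi quotientMap := inferInstanceAs (Epi (cokernel.π eulerMap))

lemma eulerMap_quotientMap : eulerMap ≫ quotientMap = 0 := cokernel.condition eulerMap

lemma locExact_eulerMap_quotientMap : LocExact eulerMap quotientMap :=
  locExact_of_exact _ _ _ (ShortComplex.exact_cokernel eulerMap)

variable {a : ℕ} (b : ℕ) (d : Fin a → ℕ)

/-- The sum of line bundles and copies of `Q`. -/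
abbrev splitBundle : P2.Modules :=
  (⨁ fun j => twist (d j)) ⊞ (⨁ fun _ : Fin b => Q)

/-- The degrees of the sum of line bundles which covers `splitBundle`. -/
def coverDegree : Fin a ⊕ Fin b × Fin 3 → ℕ := Sum.elim d fun _ => 0

/-- The columns of the Euler maps. -/
def eulerColumns (a b : ℕ) : Matrix (Fin a ⊕ Fin b × Fin 3) (Fin b) S :=
  .of fun j m => Sum.elim (fun _ => 0) (fun mk => if mk.1 = m then MvPolynomial.X mk.2 else 0) j

/-- The degrees of the relations: `s` sections and `b` Euler maps. -/
def relationDegree (s b : ℕ) : Fin s ⊕ Fin b → ℕ := Sum.elim (fun _ => 0) fun _ => 1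

lemma eulerColumns_mulVec {A : Type} [CommRing A] (φ : S →+* A) (u : Fin b → A) :
    (eulerColumns a b).map φ *ᵥ u =
      Sum.elim (0 : Fin a → A) fun mk => φ (MvPolynomial.X mk.2) * u mk.1 := by
  ext (j | ⟨m, k⟩)
  · simp [eulerColumns, mulVec, dotProduct]
  · simp [eulerColumns, mulVec, dotProduct, apply_ite φ]

lemma isHomogeneous_eulerColumns (j : Fin a ⊕ Fin b × Fin 3) (m : Fin b) :
    (eulerColumns a b j m).IsHomogeneous (coverDegree b d j + 1) := by
  rcases j with j | ⟨m', k⟩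
  · exact MvPolynomial.isHomogeneous_zero _ _ _
  · rw [eulerColumns, of_apply, Sum.elim_inr]
    split_ifs
    · exact MvPolynomial.isHomogeneous_X _ _
    · exact MvPolynomial.isHomogeneous_zero _ _ _

/-- The part of a section of the cover which is mapped to the `m`-th copy of `Q`. -/
def coverPart (m : Fin b) :
    (⨁ fun j => twist (coverDegree b d j)) ⟶ ⨁ fun _ : Fin 3 => twist 0 :=
  biproduct.lift fun k =>
    (biproduct.π (fun j => twist (coverDegree b d j)) (Sum.inr (m, k)) : _ ⟶ twist 0)

/-- The part of a section of the cover in a line bundle. -/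
def coverFst (j : Fin a) : (⨁ fun j => twist (coverDegree b d j)) ⟶ twist (d j) :=
  biproduct.π (fun j => twist (coverDegree b d j)) (Sum.inl j)

/-- The projection of the cover. -/
def coverMap : (⨁ fun j => twist (coverDegree b d j)) ⟶ splitBundle b d :=
  biprod.lift
    (biproduct.lift fun j => coverFst b d j)
    (biproduct.lift fun m => coverPart b d m ≫ quotientMap)

variable {b d}

lemma compValue_coverPart {U : P2.Opens} {x : ProjectiveSpectrum grading} (hx : x ∈ U)
    (y : Γ(⨁ fun j => twist (coverDegree b d j), U)) (m : Fin b) (k : Fin 3) :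
    compValue (d := fun _ => 0) ((coverPart b d m).app U y) x hx k =
      compValue y x hx (Sum.inr (m, k)) := by
  have h : coverPart b d m ≫ biproduct.π (fun _ : Fin 3 => twist 0) k =
    (biproduct.π (fun j => twist (coverDegree b d j)) (Sum.inr (m, k)) : _ ⟶ twist 0) :=
    biproduct.lift_π _ _
  exact congrArg (fun f : _ ⟶ twist 0 => twistValue (f.app U y) x hx) h

lemma fst_coverMap (j : Fin a) : coverMap b d ≫ biprod.fst ≫ biproduct.π (fun j => twist (d j)) j =
    coverFst b d j := by
  rw [coverMap, biprod.lift_fst_assoc, biproduct.lift_π]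

lemma snd_coverMap (m : Fin b) : coverMap b d ≫ biprod.snd ≫ biproduct.π (fun _ => Q) m =
    coverPart b d m ≫ quotientMap := by
  rw [coverMap, biprod.lift_snd_assoc, biproduct.lift_π (fun m => coverPart b d m ≫ quotientMap)]

lemma biprod_section_ext {X : Scheme.{0}} {M N : X.Modules} {U : X.Opens} {y z : Γ(M ⊞ N, U)}
    (h1 : (biprod.fst : M ⊞ N ⟶ M).app U y = (biprod.fst : M ⊞ N ⟶ M).app U z)
    (h2 : (biprod.snd : M ⊞ N ⟶ N).app U y = (biprod.snd : M ⊞ N ⟶ N).app U z) : y = z := by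
  have key : ∀ y : Γ(M ⊞ N, U), y = (biprod.inl : M ⟶ M ⊞ N).app U ((biprod.fst : M ⊞ N ⟶ M).app U y) +
      (biprod.inr : N ⟶ M ⊞ N).app U ((biprod.snd : M ⊞ N ⟶ N).app U y) := by
    intro y
    have : y = (𝟙 (M ⊞ N) : M ⊞ N ⟶ M ⊞ N).app U y := rfl
    rw [← biprod.total] at this
    exact this
  rw [key y, key z, h1, h2]

lemma splitBundle_section_ext {U : P2.Opens} {y z : Γ(splitBundle b d, U)}
    (h1 : ∀ j, ((biprod.fst : splitBundle b d ⟶ _) ≫ biproduct.π (fun j => twist (d j)) j).app U y =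
      ((biprod.fst : splitBundle b d ⟶ _) ≫ biproduct.π (fun j => twist (d j)) j).app U z)
    (h2 : ∀ m, ((biprod.snd : splitBundle b d ⟶ _) ≫ biproduct.π (fun _ => Q) m).app U y =
      ((biprod.snd : splitBundle b d ⟶ _) ≫ biproduct.π (fun _ => Q) m).app U z) : y = z :=
  biprod_section_ext (biproduct_section_ext h1) (biproduct_section_ext h2)

/-- A section of `splitBundle` lifts to the cover if its parts in the copies of `Q` lift. -/
lemma exists_coverMap_eq {U : P2.Opens} (t : Γ(splitBundle b d, U))
    (v : Fin b → Γ(⨁ fun _ : Fin 3 => twist 0, U))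
    (hv : ∀ m, (quotientMap).app U (v m) =
      ((biprod.snd : splitBundle b d ⟶ _) ≫ biproduct.π (fun _ => Q) m).app U t) :
    ∃ y, (coverMap b d).app U y = t := by
  obtain ⟨y, hy⟩ := exists_biproduct_section (X := P2) (U := U)
    (M := fun j => twist (coverDegree b d j))
    (Sum.rec (fun j => ((biprod.fst : splitBundle b d ⟶ _) ≫
      biproduct.π (fun j => twist (d j)) j).app U t)
      fun mk => (biproduct.π (fun _ : Fin 3 => twist 0) mk.2).app U (v mk.1))
  refine ⟨y, splitBundle_section_ext (fun j => ?_) fun m => ?_⟩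
  · rw [← comp_app_apply, fst_coverMap]
    exact hy (Sum.inl j)
  · rw [← comp_app_apply, snd_coverMap, ← hv, comp_app_apply]
    congr 1
    refine compValue_ext (d := fun _ => 0) fun x hx => funext fun k => ?_
    rw [compValue_coverPart]
    exact congrArg (fun f => twistValue (d := 0) (U := U) f x hx) (hy (Sum.inr (m, k)))

lemma locSurj_coverMap : LocSurj (coverMap b d) := by
  intro U t x hx
  obtain ⟨V, hVU, hxV, hV⟩ := exists_open_forall (X := P2) (x := x) hx
    (fun (m : Fin b) V => ∃ (h : V ≤ U) (v : Γ(⨁ fun _ : Fin 3 => twist 0, V)),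
      (quotientMap).app V v = resSection Q h
        (((biprod.snd : splitBundle b d ⟶ _) ≫ biproduct.π (fun _ => Q) m).app U t))
    (fun m V W hWV h => by
      obtain ⟨hVU, f, hf⟩ := h
      refine ⟨hWV.trans hVU, resSection _ hWV f, ?_⟩
      rw [app_resSection]
      exact (congrArg (resSection Q hWV) hf).trans (resSection_trans _ _ _))
    (fun m => by
      obtain ⟨V, i, hxV, f, hf⟩ := locSurj_of_epi (quotientMap) U
        (((biprod.snd : splitBundle b d ⟶ _) ≫ biproduct.π (fun _ => Q) m).app U t) x hx
      exact ⟨V, leOfHom i, hxV, leOfHom i, f, hf⟩)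
  choose h v hv using hV
  obtain ⟨y, hy⟩ := exists_coverMap_eq (resSection _ hVU t) v fun m => by
    rw [hv, app_resSection]
  exact ⟨V, homOfLE hVU, hxV, y, hy⟩

/-- The kernel of the projection of the cover is given by the Euler maps. -/
lemma exists_euler_of_coverMap_eq_zero {U : P2.Opens}
    (y : Γ(⨁ fun j => twist (coverDegree b d j), U)) (hy : (coverMap b d).app U y = 0)
    (x : ProjectiveSpectrum grading) (hx : x ∈ U) :
    ∃ (V : P2.Opens) (_ : V ≤ U) (hxV : x ∈ V) (g : Fin b → Γ(twist (-1), V)),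
      compValue y x hx = Sum.elim (fun _ => 0) fun mk =>
        polyAtHom x (MvPolynomial.X mk.2) * twistValue (g mk.1) x hxV := by
  have hfst : ∀ j, compValue y x hx (Sum.inl j) = 0 := fun j => by
    have h : (coverMap b d ≫ biprod.fst ≫ biproduct.π (fun j => twist (d j)) j).app U y = 0 := by
      rw [comp_app_apply, hy, map_zero]
    rw [fst_coverMap] at h
    exact congrArg (fun f => twistValue (U := U) (d := d j) f x hx) h
  have hsnd : ∀ m, (quotientMap).app U ((coverPart b d m).app U y) = 0 := fun m => by
    rw [← comp_app_apply, ← snd_coverMap, comp_app_apply, hy]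
    exact map_zero _
  obtain ⟨V, hVU, hxV, hV⟩ := exists_open_forall (X := P2) (x := x) hx
    (fun (m : Fin b) V => ∃ (h : V ≤ U) (g : Γ(twist (-1), V)),
      eulerMap.app V g = resSection _ h ((coverPart b d m).app U y))
    (fun m V W hWV h => by
      obtain ⟨hVU, f, hf⟩ := h
      exact ⟨hWV.trans hVU, resSection _ hWV f, by rw [app_resSection, hf, resSection_trans]⟩)
    (fun m => by
      obtain ⟨V, i, hxV, f, hf⟩ := locExact_eulerMap_quotientMap U _ (hsnd m) x hx
      exact ⟨V, leOfHom i, hxV, leOfHom i, f, hf⟩)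
  choose h g hg using hV
  refine ⟨V, hVU, hxV, g, ?_⟩
  ext (j | ⟨m, k⟩)
  · exact hfst j
  · rw [← compValue_coverPart hx, Sum.elim_inr, ← compValue_eulerMap, hg]
    exact (congrFun (compValue_resSection (d := fun _ => 0) hVU hxV
      ((coverPart b d m).app U y)) k).symm

lemma exists_lift_globalSection_splitBundle (t : Γ(splitBundle b d, (⊤ : P2.Opens))) :
    ∃ y, (coverMap b d).app ⊤ y = t := by
  choose v hv using fun m => exists_lift_globalSection
    (((biprod.snd : splitBundle b d ⟶ _) ≫ biproduct.π (fun _ => Q) m).app ⊤ t)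
  exact exists_coverMap_eq t v hv

variable (b d) in
/-- The columns of polynomials given by sections of the cover. -/
lemma exists_columns {s : ℕ} (y : Fin s → Γ(⨁ fun j => twist (coverDegree b d j), (⊤ : P2.Opens))) :
    ∃ σ : Matrix (Fin a ⊕ Fin b × Fin 3) (Fin s) S,
      (∀ j r, (σ j r).IsHomogeneous (coverDegree b d j)) ∧
      ∀ x j r, compValue (y r) x trivial j = polyAtHom x (σ j r) := by
  choose q hq h using fun j r => exists_polySection_eq
    ((biproduct.π (fun j => twist (coverDegree b d j)) j).app ⊤ (y r))
  refine ⟨.of q, hq, fun x j r => ?_⟩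
  exact (congrArg (fun f => twistValue (U := ⊤) f x trivial) (h j r)).trans
    (twistValue_polySection (hq j r) _ _ _)

end BundlePresentation

/-! ### The presentation of a quotient by trivial sections. -/

section QuotientPresentation

/-- The isomorphism `𝒪(0) ⟶ 𝒪`. -/
def twistZeroToStructure : twist 0 ⟶ structureModule P2 := CategoryTheory.inv structureToTwistZero

lemma structure_twistZero : structureToTwistZero ≫ twistZeroToStructure = 𝟙 _ :=
  IsIso.hom_inv_id _

lemma twistZero_structure : twistZeroToStructure ≫ structureToTwistZero = 𝟙 _ :=
  IsIso.inv_hom_id _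

variable {a b s : ℕ} {d : Fin a → ℕ} {σ : Matrix (Fin a ⊕ Fin b × Fin 3) (Fin s) S}

lemma isHomogeneous_relations (hσ : ∀ j r, (σ j r).IsHomogeneous (coverDegree b d j)) (j r) :
    (fromCols σ (eulerColumns a b) j r).IsHomogeneous (coverDegree b d j + relationDegree s b r) := by
  rcases r with r | m
  · exact hσ j r
  · exact isHomogeneous_eulerColumns b d j m

/-- The components of the relations which come from the trivial sections. -/
def trivialFst (s b : ℕ) (r : Fin s) : (⨁ fun r => twist (-relationDegree s b r : ℤ)) ⟶ twist 0 :=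
  biproduct.π (fun r => twist (-relationDegree s b r : ℤ)) (Sum.inl r)

/-- The inclusion of the relations which come from the trivial sections. -/
def trivialInl (s b : ℕ) (r : Fin s) : twist 0 ⟶ (⨁ fun r => twist (-relationDegree s b r : ℤ)) :=
  biproduct.ι (fun r => twist (-relationDegree s b r : ℤ)) (Sum.inl r)

/-- The inclusion of the relations which come from the Euler maps. -/
def eulerInr (s b : ℕ) (m : Fin b) : twist (-1) ⟶ (⨁ fun r => twist (-relationDegree s b r : ℤ)) :=
  biproduct.ι (fun r => twist (-relationDegree s b r : ℤ)) (Sum.inr m)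

lemma trivialInl_trivialFst (r : Fin s) : trivialInl s b r ≫ trivialFst s b r = 𝟙 _ :=
  biproduct.ι_π_self (fun r => twist (-relationDegree s b r : ℤ)) (Sum.inl r)

lemma trivialInl_trivialFst_ne {r r' : Fin s} (h : r ≠ r') :
    trivialInl s b r ≫ trivialFst s b r' = 0 :=
  biproduct.ι_π_ne (fun r => twist (-relationDegree s b r : ℤ)) (by simpa using h)

lemma eulerInr_trivialFst (m : Fin b) (r : Fin s) :
    eulerInr s b m ≫ trivialFst s b r = 0 :=
  biproduct.ι_π_ne (fun r => twist (-relationDegree s b r : ℤ)) (by simp)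

/-- The trivial part of the relations. -/
def trivialPart (s b : ℕ) :
    (⨁ fun r => twist (-relationDegree s b r : ℤ)) ⟶ ⨁ fun _ : Fin s => structureModule P2 :=
  biproduct.lift fun r => trivialFst s b r ≫ twistZeroToStructure

lemma trivialPart_π (r : Fin s) : trivialPart s b ≫
    biproduct.π (fun _ : Fin s => structureModule P2) r =
      trivialFst s b r ≫ twistZeroToStructure := biproduct.lift_π _ _

lemma mulVec_relations {A : Type} [CommRing A] (φ : S →+* A) (u : Fin s ⊕ Fin b → A) :
    (fromCols σ (eulerColumns a b)).map φ *ᵥ u = σ.map φ *ᵥ (u ∘ Sum.inl) +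
      (eulerColumns a b).map φ *ᵥ (u ∘ Sum.inr) := by
  rw [← fromCols_mulVec]
  congr 1
  ext i (j | j) <;> rfl

lemma compValue_inl_trivialInl {U : P2.Opens} {x : ProjectiveSpectrum grading} (hx : x ∈ U)
    (r : Fin s) (g : Γ(twist 0, U)) :
    compValue ((trivialInl s b r).app U g) x hx = Pi.single (Sum.inl r) (twistValue g x hx) := by
  ext r'
  by_cases h : r' = Sum.inl r
  · subst h
    rw [Pi.single_eq_same]
    exact congrArg (fun f : twist 0 ⟶ twist 0 => twistValue (f.app U g) x hx)
      (trivialInl_trivialFst (b := b) r)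
  · rw [Pi.single_eq_of_ne h]
    exact congrArg (fun f : twist 0 ⟶ _ => twistValue (f.app U g) x hx)
      (biproduct.ι_π_ne (fun r => twist (-relationDegree s b r : ℤ)) (Ne.symm h))

lemma compValue_inr_eulerInr {U : P2.Opens} {x : ProjectiveSpectrum grading} (hx : x ∈ U)
    (m : Fin b) (g : Γ(twist (-1), U)) :
    compValue ((eulerInr s b m).app U g) x hx = Pi.single (Sum.inr m) (twistValue g x hx) := by
  ext r'
  by_cases h : r' = Sum.inr m
  · subst h
    rw [Pi.single_eq_same]
    exact congrArg (fun f : twist (-1) ⟶ twist (-1) => twistValue (f.app U g) x hx)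
      (biproduct.ι_π_self (fun r => twist (-relationDegree s b r : ℤ)) (Sum.inr m))
  · rw [Pi.single_eq_of_ne h]
    exact congrArg (fun f : twist (-1) ⟶ _ => twistValue (f.app U g) x hx)
      (biproduct.ι_π_ne (fun r => twist (-relationDegree s b r : ℤ)) (Ne.symm h))

/-- The equality is checked on each summand of the source. On a copy of `𝒪(0)` it is enough to
compare the images of the section `1`; on a copy of `𝒪(-1)` both sides vanish by the Euler sequence.
-/
lemma relationHom_coverMap (hσ : ∀ j r, (σ j r).IsHomogeneous (coverDegree b d j))
    (i : (⨁ fun _ : Fin s => structureModule P2) ⟶ splitBundle b d)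
    (h : ∀ (r : Fin s) (y : Γ(⨁ fun j => twist (coverDegree b d j), (⊤ : P2.Opens))),
      (∀ x j, compValue y x trivial j = polyAtHom x (σ j r)) →
      (coverMap b d).app ⊤ y = ((twistZeroToStructure ≫
        biproduct.ι (fun _ : Fin s => structureModule P2) r) ≫ i).app ⊤
        (polySection (d := 0) (MvPolynomial.isHomogeneous_one _ _) ⊤)) :
    relationHom (coverDegree b d) (relationDegree s b) (fromCols σ (eulerColumns a b))
      (isHomogeneous_relations hσ) ≫ coverMap b d = trivialPart s b ≫ i := by
  refine biproduct.hom_ext' _ _ fun r => ?_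
  rcases r with r | m
  · have h1 : trivialInl s b r ≫ trivialPart s b =
        twistZeroToStructure ≫ biproduct.ι (fun _ : Fin s => structureModule P2) r := by
      refine biproduct.hom_ext _ _ fun r' => ?_
      rw [Category.assoc, Category.assoc, trivialPart_π, ← Category.assoc]
      by_cases hr : r = r'
      · subst hr
        rw [trivialInl_trivialFst, biproduct.ι_π_self, Category.id_comp, Category.comp_id]
      · rw [trivialInl_trivialFst_ne hr, biproduct.ι_π_ne _ hr, zero_comp, comp_zero]
    refine Eq.trans ?_ ((congrArg (· ≫ i) h1.symm).trans (Category.assoc _ _ _))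
    refine twistZero_hom_ext (h r _ fun x j => ?_)
    refine (congrFun (compValue_relationHom (isHomogeneous_relations hσ) (x := x) (U := ⊤) trivial
      ((trivialInl s b r).app ⊤ (polySection (d := 0)
        (MvPolynomial.isHomogeneous_one _ _) ⊤))) j).trans ?_
    refine (congrFun (congrArg (mulVec _) (compValue_inl_trivialInl (U := ⊤) trivial r _)) j).trans ?_
    rw [mulVec_single]
    have h1 : twistValue (d := 0) (polySection (d := 0) (MvPolynomial.isHomogeneous_one _ _) ⊤) x
      trivial = 1 := Localization.mk_one
    rw [h1]
    simp
  · have h1 : eulerInr s b m ≫ trivialPart s b = 0 := by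
      refine biproduct.hom_ext _ _ fun r' => ?_
      rw [Category.assoc, trivialPart_π, ← Category.assoc, eulerInr_trivialFst, zero_comp, zero_comp]
    refine Eq.trans ?_ (((congrArg (· ≫ i) h1.symm).trans (Category.assoc _ _ _)))
    rw [zero_comp]
    suffices key : ∀ (U : P2.Opens) (g : Γ(twist (-1), U)), (coverMap b d).app U
        ((relationHom (coverDegree b d) (relationDegree s b) (fromCols σ (eulerColumns a b))
          (isHomogeneous_relations hσ)).app U ((eulerInr s b m).app U g)) = 0 from
      Scheme.Modules.hom_ext _ _ fun U => ConcreteCategory.hom_ext _ _ fun g => key U g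
    intro U g
    set y := (relationHom (coverDegree b d) (relationDegree s b) (fromCols σ (eulerColumns a b))
      (isHomogeneous_relations hσ)).app U ((eulerInr s b m).app U g) with hy
    have hyv : ∀ x hx, compValue y x hx = Sum.elim (fun _ => 0) fun mk =>
        if mk.1 = m then polyAtHom x (MvPolynomial.X mk.2) * twistValue g x hx else 0 := by
      intro x hx
      rw [hy, compValue_relationHom, compValue_inr_eulerInr, mulVec_single]
      ext (j | ⟨m', k⟩)
      · simp [eulerColumns]
      · simp [eulerColumns, apply_ite (polyAtHom x)]
    refine splitBundle_section_ext (fun j => ?_) fun m' => ?_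
    · rw [← comp_app_apply, fst_coverMap, map_zero]
      exact twist_ext fun x hx => congrFun (hyv x hx) (Sum.inl j)
    · rw [← comp_app_apply, snd_coverMap, map_zero]
      have h2 : (coverPart b d m').app U y = if m' = m then eulerMap.app U g else 0 := by
        refine compValue_ext (d := fun _ => 0) fun x hx => funext fun k => ?_
        rw [compValue_coverPart, hyv]
        split_ifs with hm
        · simp [hm, compValue_eulerMap]
        · rw [compValue_zero (d := fun _ => 0)]
          simp [hm]
      rw [comp_app_apply, h2]
      split_ifs
      · rw [← comp_app_apply, eulerMap_quotientMap]
        rfl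
      · exact map_zero _

/-- A quotient by trivial sections has a presentation by sums of twisting sheaves. -/
theorem exists_presentation {E : P2.Modules} (hq : IsQuotientBySections (splitBundle b d) E) :
    ∃ (s : ℕ) (σ : Matrix (Fin a ⊕ Fin b × Fin 3) (Fin s) S)
      (hσ : ∀ j r, (σ j r).IsHomogeneous (coverDegree b d j))
      (π : (⨁ fun j => twist (coverDegree b d j)) ⟶ E)
      (w : relationHom (coverDegree b d) (relationDegree s b) (fromCols σ (eulerColumns a b))
        (isHomogeneous_relations hσ) ≫ π = 0),
      (ShortComplex.mk _ π w).Exact ∧ Epi π ∧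
      Mono (relationHom (coverDegree b d) (relationDegree s b) (fromCols σ (eulerColumns a b))
        (isHomogeneous_relations hσ)) := by
  obtain ⟨s, i, p, w, hS⟩ := hq
  have hmono : Mono i := hS.mono_f
  have hepi : Epi p := hS.epi_g
  -- The images in `F` of the standard sections of `𝒪^s` lift to global sections of the cover. Their
  -- components are polynomials, the columns of `σ`.
  choose y hy using fun r => exists_lift_globalSection_splitBundle (((twistZeroToStructure ≫
    biproduct.ι (fun _ : Fin s => structureModule P2) r) ≫ i).app ⊤
      (polySection (d := 0) (MvPolynomial.isHomogeneous_one _ _) ⊤))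
  obtain ⟨σ, hσ, hyσ⟩ := exists_columns b d y
  have hrel := relationHom_coverMap hσ i fun r y' hy' => by
    rw [← hy r]
    congr 1
    exact compValue_ext fun x hx => funext fun j => (hy' x j).trans (hyσ x j r).symm
  set rel := relationHom (coverDegree b d) (relationDegree s b) (fromCols σ (eulerColumns a b))
        (isHomogeneous_relations hσ) with hreldef
  have hrelv : ∀ {U : P2.Opens} {x : ProjectiveSpectrum grading} (hx : x ∈ U) z,
      compValue (rel.app U z) x hx = σ.map (polyAtHom x) *ᵥ (compValue z x hx ∘ Sum.inl) +
      Sum.elim (0 : Fin a → _) fun mk =>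
        polyAtHom x (MvPolynomial.X mk.2) * compValue z x hx (Sum.inr mk.1) := by
    intro U x hx z
    rw [hreldef, compValue_relationHom, mulVec_relations, eulerColumns_mulVec]
    rfl
  have : Epi (coverMap b d) := epi_of_locSurj _ locSurj_coverMap
  have hw : rel ≫ coverMap b d ≫ p = 0 := by
    rw [← Category.assoc, hrel, Category.assoc, w, comp_zero]
  have hinj : Mono rel := by
    refine mono_of_app_injective _ fun U => (injective_iff_map_eq_zero _).2 fun z hz => ?_
    have h1 : i.app U ((trivialPart s b).app U z) = 0 := by
      rw [← comp_app_apply, ← hrel, comp_app_apply, hz, map_zero]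
    have h2 := app_injective_of_mono i U (h1.trans (map_zero _).symm)
    -- Injectivity of `𝒪^s ⟶ F` kills the components in `𝒪(0)`. The components in `𝒪(-1)` vanish
    -- afterwards because some coordinate is a unit at each point.
    have h3 : ∀ x hx, compValue z x hx ∘ Sum.inl = 0 := by
      intro x hx
      ext1 r
      have h4 : (trivialFst s b r ≫ twistZeroToStructure).app U z = 0 := by
        rw [← trivialPart_π, comp_app_apply, h2, map_zero]
      have h5 : (trivialFst s b r ≫ twistZeroToStructure ≫ structureToTwistZero).app U z = 0 := by
        rw [← Category.assoc, comp_app_apply, h4, map_zero]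
      rw [twistZero_structure, Category.comp_id] at h5
      exact congrArg (fun f => twistValue (U := U) (d := 0) f x hx) h5
    refine compValue_ext fun x hx => ?_
    rw [compValue_zero]
    have h4 := hrelv hx z
    rw [h3, mulVec_zero, zero_add, hz, compValue_zero] at h4
    obtain ⟨k, hk⟩ := exists_X_notMem x
    ext (r | m)
    · exact congrFun (h3 x hx) r
    · exact (isUnit_polyAtHom hk).mul_left_cancel
        (((congrFun h4 (Sum.inr (m, k))).symm).trans (mul_zero _).symm)
  refine ⟨s, σ, hσ, coverMap b d ≫ p, hw, exact_of_locExact _ _ _ ?_, epi_comp _ _, hinj⟩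
  intro U y' hy' (x : ProjectiveSpectrum grading) hx
  obtain ⟨V, iV, hxV, t, ht⟩ := locExact_of_exact _ _ _ hS.exact U ((coverMap b d).app U y') hy' x hx
  obtain ⟨z, hz⟩ := exists_biproduct_section (X := P2) (U := V)
    (M := fun r => twist (-relationDegree s b r : ℤ))
    (Sum.rec (fun r => structureToTwistZero.app V
      ((biproduct.π (fun _ : Fin s => structureModule P2) r).app V t)) fun m => 0)
  have hzt : (trivialPart s b).app V z = t := by
    refine biproduct_section_ext fun r => ?_
    rw [← comp_app_apply, trivialPart_π, comp_app_apply]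
    refine (congrArg (twistZeroToStructure.app V) (hz (Sum.inl r))).trans ?_
    exact congrArg (fun f : structureModule P2 ⟶ _ => f.app V _) structure_twistZero
  -- After subtraction of the relations coming from `𝒪^s`, the section lies in the kernel of the
  -- cover map, which is generated by the Euler maps.
  have h0 : (coverMap b d).app V ((⨁ fun j => twist (coverDegree b d j)).presheaf.map iV.op y' -
      rel.app V z) = 0 := by
    rw [map_sub, app_map, ← ht, ← comp_app_apply rel, hrel, comp_app_apply, hzt, sub_self]
  obtain ⟨W, hWV, hxW, g, hg⟩ := exists_euler_of_coverMap_eq_zero _ h0 x hxV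
  obtain ⟨u, hu⟩ := exists_biproduct_section (X := P2) (U := W)
    (M := fun r => twist (-relationDegree s b r : ℤ)) (Sum.rec (fun r => 0) fun m => g m)
  have huv : ∀ r, compValue u x hxW r = Sum.elim (fun _ => 0) (fun m => twistValue (g m) x hxW) r := by
    rintro (r | m)
    · exact congrArg (fun f => twistValue (U := W) (d := 0) f x hxW) (hu (Sum.inl r))
    · exact congrArg (fun f => twistValue (U := W) (d := -1) f x hxW) (hu (Sum.inr m))
  refine ⟨W, homOfLE hWV ≫ iV, hxW, resSection _ hWV z + u, compValue_ext_of_mem hxW ?_⟩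
  rw [compValue_map, map_add, app_resSection, compValue_add, compValue_resSection, hrelv hxW]
  rw [compValue_sub, compValue_map] at hg
  have h1 : compValue u x hxW ∘ Sum.inl = 0 := funext fun r => huv (Sum.inl r)
  have h2 : ∀ m, compValue u x hxW (Sum.inr m) = twistValue (g m) x hxW := fun m => huv (Sum.inr m)
  rw [h1, mulVec_zero, zero_add]
  refine Eq.trans (congrArg _ ?_) (eq_add_of_sub_eq' hg).symm
  simp only [h2]
  rfl

end QuotientPresentation

/-! ### Dimensions of graded pieces, and ideals generated by two linear forms. -/

section HomogeneousPolynomials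

lemma homogeneousPart_natCast_eq (d : ℕ) :
    homogeneousPart d = MvPolynomial.restrictSupport ℂ
      ((Finset.univ.finsuppAntidiag d : Finset (Fin 3 →₀ ℕ)) : Set (Fin 3 →₀ ℕ)) := by
  ext f
  rw [MvPolynomial.mem_restrictSupport_iff]
  have h : ∀ m : Fin 3 →₀ ℕ, m ∈ Finset.univ.finsuppAntidiag d ↔ (m.degree : ℤ) = d := fun m => by
    rw [Finset.mem_finsuppAntidiag, Finsupp.degree_eq_sum]
    simp [-Nat.cast_sum]
  constructor
  · intro hf m hm
    exact (h m).2 (hf m (MvPolynomial.mem_support_iff.1 hm))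
  · intro hf m hm
    exact (h m).1 (hf (MvPolynomial.mem_support_iff.2 hm))

lemma homogeneousPart_of_neg {d : ℤ} (hd : d < 0) : homogeneousPart d = ⊥ :=
  (Submodule.eq_bot_iff _).2 fun _ => eq_zero_of_mem_homogeneousPart hd

instance (d : ℤ) : FiniteDimensional ℂ (homogeneousPart d) := by
  rcases lt_or_ge d 0 with hd | hd
  · rw [homogeneousPart_of_neg hd]
    infer_instance
  · lift d to ℕ using hd
    rw [homogeneousPart_natCast_eq]
    exact Module.Finite.of_basis (MvPolynomial.basisRestrictSupport ℂ _)

lemma finrank_homogeneousPart_natCast (d : ℕ) :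
    Module.finrank ℂ (homogeneousPart d) = (d + 2).choose 2 := by
  rw [homogeneousPart_natCast_eq,
    Module.finrank_eq_card_basis (MvPolynomial.basisRestrictSupport ℂ _)]
  refine (Fintype.card_coe _).trans ?_
  rw [Finset.card_finsuppAntidiag_nat_eq_choose]
  simp only [Finset.card_univ, Fintype.card_fin]
  rw [show 3 + d - 1 = d + 2 by omega, ← Nat.choose_symm_add]

/-- The difference of the binomial coefficients `(d+2 choose 2)` and `(d choose 2)` is `2d + 1`. The
formula persists for `d = 0, 1`, where the part of degree `d - 2` is zero. -/
lemma finrank_homogeneousPart_sub_two (d : ℕ) :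
    Module.finrank ℂ (homogeneousPart d) =
      Module.finrank ℂ (homogeneousPart (d - 2)) + (2 * d + 1) := by
  rw [finrank_homogeneousPart_natCast]
  obtain rfl | rfl | ⟨d, rfl⟩ : d = 0 ∨ d = 1 ∨ ∃ e, d = e + 2 :=
    match d with
    | 0 => .inl rfl
    | 1 => .inr (.inl rfl)
    | e + 2 => .inr (.inr ⟨e, rfl⟩)
  · rw [homogeneousPart_of_neg (by norm_num)]
    simp
  · rw [homogeneousPart_of_neg (by norm_num)]
    simp
  · rw [show ((d + 2 : ℕ) : ℤ) - 2 = d by push_cast; ring, finrank_homogeneousPart_natCast]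
    have h1 : (d + 2 + 2).choose 2 = (d + 2 + 1).choose 1 + (d + 2 + 1).choose 2 :=
      Nat.choose_succ_succ' (d + 2 + 1) 1
    have h2 : (d + 2 + 1).choose 2 = (d + 2).choose 1 + (d + 2).choose 2 :=
      Nat.choose_succ_succ' (d + 2) 1
    rw [Nat.choose_one_right] at h1 h2
    omega

/-- Homogeneous polynomials are combinations of the coordinates. -/
lemma exists_eq_sum_X_mul {d : ℕ} {f : S} (hf : f.IsHomogeneous (d + 1)) :
    ∃ h : Fin 3 → S, (∀ k, (h k).IsHomogeneous d) ∧ f = ∑ k, MvPolynomial.X k * h k := by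
  have h1 : f ∈ Ideal.span (Set.range (MvPolynomial.X : Fin 3 → S)) := by
    rw [← Set.image_univ, MvPolynomial.mem_ideal_span_X_image]
    intro m hm
    have h2 := hf (MvPolynomial.mem_support_iff.1 hm)
    by_contra! h3
    have : m = 0 := Finsupp.ext fun i => h3 i trivial
    rw [this] at h2
    simp at h2
  rw [Ideal.mem_span_range_iff_exists_fun] at h1
  obtain ⟨c, hc⟩ := h1
  refine ⟨fun k => (DirectSum.decompose grading (c k) d : S), fun k =>
    (DirectSum.decompose grading (c k) d).2, ?_⟩
  have h2 : (DirectSum.decompose grading f (d + 1) : S) = f := DirectSum.decompose_of_mem_same _ hf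
  rw [← h2]
  conv_lhs => rw [← hc]
  rw [DirectSum.decompose_sum, DFinsupp.finsetSum_apply, AddSubmonoidClass.coe_finsetSum]
  refine Finset.sum_congr rfl fun k _ => ?_
  rw [mul_comm, add_comm]
  exact DirectSum.coe_decompose_mul_add_of_left_mem grading (MvPolynomial.isHomogeneous_X ℂ k)

/-- The linear form with given coefficients. -/
def linearForm (c : Fin 3 → ℂ) : S := ∑ k, c k • MvPolynomial.X k

lemma linearForm_mem (c : Fin 3 → ℂ) : linearForm c ∈ homogeneousPart 1 :=
  Submodule.sum_mem _ fun k _ => Submodule.smul_mem _ _ (X_mem_homogeneousPart k)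

lemma eval_linearForm (c p : Fin 3 → ℂ) : eval p (linearForm c) = c ⬝ᵥ p := by
  simp [linearForm, dotProduct, MvPolynomial.smul_eval]

lemma coeff_linearForm (c : Fin 3 → ℂ) (k : Fin 3) :
    MvPolynomial.coeff (Finsupp.single k 1) (linearForm c) = c k := by
  simp [linearForm, MvPolynomial.coeff_sum, MvPolynomial.coeff_smul, MvPolynomial.coeff_X, Finsupp.single_left_inj]

lemma linearForm_add (c c' : Fin 3 → ℂ) : linearForm (c + c') = linearForm c + linearForm c' := by
  simp [linearForm, add_smul, Finset.sum_add_distrib]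

lemma linearForm_smul (t : ℂ) (c : Fin 3 → ℂ) : linearForm (t • c) = t • linearForm c := by
  simp [linearForm, Finset.smul_sum, smul_smul]

lemma linearForm_single (k : Fin 3) : linearForm (Pi.single k 1) = MvPolynomial.X k := by
  simp [linearForm, Pi.single_apply]

lemma linearForm_ne_zero {c : Fin 3 → ℂ} (hc : c ≠ 0) : linearForm c ≠ 0 := by
  intro h
  apply hc
  ext k
  rw [← coeff_linearForm c k, h]
  simp

lemma prime_linearForm {c : Fin 3 → ℂ} (hc : c ≠ 0) : Prime (linearForm c) := by
  have h1 : (linearForm c).IsHomogeneous 1 :=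
    mem_homogeneousPart_natCast.1 (linearForm_mem c)
  refine (MvPolynomial.irreducible_of_totalDegree_eq_one
    (h1.totalDegree (linearForm_ne_zero hc)) fun x hx => ?_).prime
  obtain ⟨k, hk⟩ := Function.ne_iff.1 hc
  have h2 := hx (Finsupp.single k 1)
  rw [coeff_linearForm] at h2
  exact (ne_zero_of_dvd_ne_zero hk h2).isUnit

/-- The syzygies of two independent linear forms. -/
lemma exists_of_linearForm_mul_eq {c c' : Fin 3 → ℂ} (h : c ⨯₃ c' ≠ 0) {f g : S}
    (hfg : linearForm c * f = linearForm c' * g) : ∃ t, g = linearForm c * t ∧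
      f = linearForm c' * t := by
  have hc : c ≠ 0 := by
    rintro rfl
    simp at h
  have h1 : ¬ linearForm c ∣ linearForm c' := by
    rintro ⟨t, ht⟩
    have ht0 : t ∈ homogeneousPart (1 - 1) :=
      mem_homogeneousPart_of_mul_mem (linearForm_mem c) (linearForm_ne_zero hc)
        (ht ▸ linearForm_mem c')
    have ht1 : t.IsHomogeneous 0 := by
      rw [← mem_homogeneousPart_natCast]
      simpa using ht0
    have ht2 : t = MvPolynomial.C (MvPolynomial.coeff 0 t) := by
      rw [← MvPolynomial.totalDegree_eq_zero_iff_eq_C]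
      exact (MvPolynomial.totalDegree_zero_iff_isHomogeneous _).2 ht1
    apply h
    have : c' = MvPolynomial.coeff 0 t • c := by
      ext k
      rw [← coeff_linearForm c' k, ht, ht2, mul_comm, MvPolynomial.coeff_C_mul, coeff_linearForm]
      simp
    rw [this]
    simp
  obtain ⟨t, ht⟩ := ((prime_linearForm hc).dvd_or_dvd ⟨f, hfg.symm⟩).resolve_left h1
  refine ⟨t, ht, mul_left_cancel₀ (linearForm_ne_zero hc) ?_⟩
  rw [hfg, ht]
  ring

/-- Every point is the common zero of two independent linear forms, here with the scalar normalized
so that the cross product is `p` itself. -/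
lemma exists_cross_eq {p : Fin 3 → ℂ} (hp : p ≠ 0) : ∃ c c' : Fin 3 → ℂ, c ⨯₃ c' = p := by
  obtain ⟨i, hi⟩ := Function.ne_iff.1 hp
  fin_cases i
  · have h : p 0 ≠ 0 := hi
    refine ⟨![-p 1, p 0, 0], ![-p 2 / p 0, 0, 1], ?_⟩
    ext k
    fin_cases k <;> simp [cross_apply, mul_div_cancel₀, h]
  · have h : p 1 ≠ 0 := hi
    refine ⟨![0, -p 2, p 1], ![1, -p 0 / p 1, 0], ?_⟩
    ext k
    fin_cases k <;> simp [cross_apply, mul_div_cancel₀, h]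
  · have h : p 2 ≠ 0 := hi
    refine ⟨![p 2, 0, -p 0], ![0, 1, -p 1 / p 2], ?_⟩
    ext k
    fin_cases k <;> simp [cross_apply, mul_div_cancel₀, h]

lemma eq_combination_of_triple_eq_one {c c' e : Fin 3 → ℂ} (he : e ⬝ᵥ (c ⨯₃ c') = 1)
    (v : Fin 3 → ℂ) : v = (v ⬝ᵥ (c' ⨯₃ e)) • c + (v ⬝ᵥ (e ⨯₃ c)) • c' + (v ⬝ᵥ (c ⨯₃ c')) • e := by
  simp only [cross_apply, dotProduct, Fin.sum_univ_three, Matrix.cons_val_zero,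
    Matrix.cons_val_one, Matrix.cons_val] at *
  ext k
  fin_cases k
  · simp
    linear_combination -(v 0) * he
  · simp
    linear_combination -(v 1) * he
  · simp
    linear_combination -(v 2) * he

/-- Modulo `linearForm c` and `linearForm c'` only powers of a third form `linearForm e` remain. The
latter has value `1` at `c ⨯₃ c'`, so the coefficient is the value of `f` there. -/
lemma exists_eq_pow_add {c c' e : Fin 3 → ℂ} (he : e ⬝ᵥ (c ⨯₃ c') = 1) (d : ℕ) (f : S)
    (hf : f.IsHomogeneous d) :
    ∃ g ∈ homogeneousPart (d - 1), ∃ h ∈ homogeneousPart (d - 1),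
      f = linearForm c * g + linearForm c' * h + eval (c ⨯₃ c') f • linearForm e ^ d := by
  induction d generalizing f with
  | zero =>
    refine ⟨0, zero_mem _, 0, zero_mem _, ?_⟩
    have h1 : f = MvPolynomial.C (MvPolynomial.coeff 0 f) := by
      rw [← MvPolynomial.totalDegree_eq_zero_iff_eq_C]
      exact (MvPolynomial.totalDegree_zero_iff_isHomogeneous _).2 hf
    rw [h1]
    simp [MvPolynomial.smul_eq_C_mul]
  | succ d ih =>
    obtain ⟨q, hq, rfl⟩ := exists_eq_sum_X_mul hf
    choose g hg h hh hgh using fun k => ih (q k) (hq k)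
    have hX : ∀ k, ∃ s t : ℂ, (MvPolynomial.X k : S) =
        s • linearForm c + t • linearForm c' + (c ⨯₃ c') k • linearForm e := by
      intro k
      have h1 := eq_combination_of_triple_eq_one he (Pi.single k 1)
      rw [single_one_dotProduct k (c ⨯₃ c')] at h1
      refine ⟨Pi.single k 1 ⬝ᵥ (c' ⨯₃ e), Pi.single k 1 ⬝ᵥ (e ⨯₃ c),
        (linearForm_single k).symm.trans ((congrArg linearForm h1).trans ?_)⟩
      rw [linearForm_add, linearForm_add, linearForm_smul, linearForm_smul, linearForm_smul]
    choose s t hst using hX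
    have hd : ((d + 1 : ℕ) : ℤ) - 1 = d := by push_cast; ring
    rw [hd]
    refine ⟨∑ k, (s k • q k + (c ⨯₃ c') k • (linearForm e * g k)), ?_,
      ∑ k, (t k • q k + (c ⨯₃ c') k • (linearForm e * h k)), ?_, ?_⟩
    · exact Submodule.sum_mem _ fun k _ => add_mem
        (Submodule.smul_mem _ _ (mem_homogeneousPart_natCast.2 (hq k)))
        (Submodule.smul_mem _ _ (mul_mem_homogeneousPart (linearForm_mem e) (hg k) (by ring)))
    · exact Submodule.sum_mem _ fun k _ => add_mem
        (Submodule.smul_mem _ _ (mem_homogeneousPart_natCast.2 (hq k)))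
        (Submodule.smul_mem _ _ (mul_mem_homogeneousPart (linearForm_mem e) (hh k) (by ring)))
    · rw [map_sum, Finset.mul_sum, Finset.mul_sum, Finset.sum_smul, ← Finset.sum_add_distrib,
        ← Finset.sum_add_distrib]
      refine Finset.sum_congr rfl fun k _ => ?_
      rw [map_mul, MvPolynomial.eval_X]
      have h1 : (MvPolynomial.X k : S) * q k = (s k • linearForm c + t k • linearForm c') * q k +
          (c ⨯₃ c') k • linearForm e * (linearForm c * g k + linearForm c' * h k +
            eval (c ⨯₃ c') (q k) • linearForm e ^ d) := by
        rw [← hgh k, ← add_mul, ← hst k]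
      rw [h1]
      simp only [MvPolynomial.smul_eq_C_mul, map_mul]
      ring

/-- A homogeneous polynomial which vanishes at a point is a combination of two linear forms. -/
lemma exists_of_eval_eq_zero {c c' : Fin 3 → ℂ} (h0 : c ⨯₃ c' ≠ 0) {d : ℤ} {f : S}
    (hf : f ∈ homogeneousPart d) (hfp : eval (c ⨯₃ c') f = 0) :
    ∃ g ∈ homogeneousPart (d - 1), ∃ h ∈ homogeneousPart (d - 1),
      f = linearForm c * g + linearForm c' * h := by
  rcases mem_homogeneousPart_iff.1 hf with rfl | ⟨k, rfl, hk⟩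
  · exact ⟨0, zero_mem _, 0, zero_mem _, by simp⟩
  · obtain ⟨i, hi⟩ := Function.ne_iff.1 h0
    obtain ⟨g, hg, h, hh, hgh⟩ := exists_eq_pow_add (e := Pi.single i ((c ⨯₃ c') i)⁻¹) (by
      rw [single_dotProduct]
      exact inv_mul_cancel₀ hi) k f hk
    refine ⟨g, hg, h, hh, ?_⟩
    rw [hfp, zero_smul, add_zero] at hgh
    exact hgh

end HomogeneousPolynomials

/-! ### Graded vectors of polynomials and functionals given by values at points. -/

section DegreePart

/-- A vector outside the column space is separated from it by a linear functional, and functionals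
on `m → ℂ` are dot products. -/
lemma exists_mulVec_eq_of_dotProduct {m n : Type} [Fintype m] [Fintype n] (T : Matrix m n ℂ)
    (v : m → ℂ) (h : ∀ y, y ᵥ* T = 0 → y ⬝ᵥ v = 0) : ∃ x, T *ᵥ x = v := by
  classical
  by_contra hv
  obtain ⟨f, hf, hle⟩ := Submodule.exists_le_ker_of_notMem (p := LinearMap.range T.mulVecLin)
    (v := v) (by rintro ⟨x, hx⟩; exact hv ⟨x, hx⟩)
  have hy : ∀ w, f w = (fun i => f (Pi.single i 1)) ⬝ᵥ w := fun w => by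
    conv_lhs => rw [pi_eq_sum_univ' w, map_sum]
    simp only [map_smul, smul_eq_mul, dotProduct, mul_comm]
  apply hf
  rw [hy]
  refine h _ (funext fun j => ?_)
  have := hle (x := T *ᵥ Pi.single j 1) ⟨Pi.single j 1, rfl⟩
  rw [LinearMap.mem_ker, hy, dotProduct_mulVec, dotProduct_single] at this
  simpa using this

lemma map_eval_mulVec {I K : Type} [Fintype K] (M : Matrix I K S) (v : K → S) (p : Fin 3 → ℂ) :
    (fun i => eval p ((M *ᵥ v) i)) = M.map (eval p) *ᵥ fun k => eval p (v k) :=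
  funext fun i => RingHom.map_mulVec (eval p) M v i

lemma mulVec_eq_zero_of_injective {I K : Type} [Fintype K] {τ : Matrix I K S}
    (hinj : ∀ p : Fin 3 → ℂ, p ≠ 0 → Function.Injective (τ.map (eval p)).mulVec) {v : K → S}
    (hv : τ *ᵥ v = 0) : v = 0 := by
  funext r
  refine eq_zero_of_eval_eq_zero fun p hp => ?_
  have h1 := map_eval_mulVec τ v p
  rw [hv] at h1
  have h2 := hinj p hp (a₁ := fun k => eval p (v k)) (a₂ := 0) (by
    rw [← h1, mulVec_zero]
    ext
    simp)
  exact congrFun h2 r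

variable {J : Type} {dd : J → ℕ}

/-- The vectors of homogeneous polynomials whose `j`-th entry has degree `dd j - i`. -/
def degreePart (dd : J → ℕ) (i : ℤ) : Submodule ℂ (J → S) :=
  Submodule.pi Set.univ fun j => homogeneousPart (dd j - i)

lemma mem_degreePart {i : ℤ} {v : J → S} :
    v ∈ degreePart dd i ↔ ∀ j, v j ∈ homogeneousPart (dd j - i) := by
  simp [degreePart]

lemma mem_degreePart_zero {v : J → S} :
    v ∈ degreePart dd 0 ↔ ∀ j, (v j).IsHomogeneous (dd j) := by
  simp [mem_degreePart, mem_homogeneousPart_natCast]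

lemma smul_mem_degreePart {e i k : ℤ} {f : S} (hf : f ∈ homogeneousPart e) {v : J → S}
    (hv : v ∈ degreePart dd i) (h : k + e = i) : f • v ∈ degreePart dd k :=
  mem_degreePart.2 fun j => mul_mem_homogeneousPart hf (mem_degreePart.1 hv j) (by omega)

lemma mem_degreePart_of_smul_mem {e i k : ℤ} {f : S} (hf : f ∈ homogeneousPart e) (hf0 : f ≠ 0)
    {v : J → S} (hv : f • v ∈ degreePart dd k) (h : k + e = i) : v ∈ degreePart dd i :=
  mem_degreePart.2 fun j => by
    have h1 := mem_homogeneousPart_of_mul_mem hf hf0 (mem_degreePart.1 hv j)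
    rwa [show (dd j : ℤ) - i = dd j - k - e by omega]

/-- The pairing of the value of `v` at `p` with `m`. -/
def pointFunctional [Fintype J] (m : J → ℂ) (p : Fin 3 → ℂ) : (J → S) →ₗ[ℂ] ℂ :=
  ∑ j, m j • (MvPolynomial.aeval p).toLinearMap ∘ₗ LinearMap.proj j

variable [Fintype J]

lemma pointFunctional_apply (m : J → ℂ) (p : Fin 3 → ℂ) (v : J → S) :
    pointFunctional m p v = m ⬝ᵥ fun j => eval p (v j) := by
  simp [pointFunctional, dotProduct, LinearMap.sum_apply, MvPolynomial.aeval_eq_eval]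

lemma pointFunctional_smul (m : J → ℂ) (p : Fin 3 → ℂ) (f : S) (v : J → S) :
    pointFunctional m p (f • v) = eval p f * pointFunctional m p v := by
  simp only [pointFunctional_apply, dotProduct, Finset.mul_sum, Pi.smul_apply, smul_eq_mul, map_mul]
  exact Finset.sum_congr rfl fun j _ => by ring

/-- The equivalence of `degreePart` with a product. -/
def degreePartEquiv (dd : J → ℕ) (i : ℤ) :
    degreePart dd i ≃ₗ[ℂ] ∀ j, homogeneousPart (dd j - i) where
  toFun v j := ⟨v.1 j, mem_degreePart.1 v.2 j⟩
  invFun v := ⟨fun j => v j, mem_degreePart.2 fun j => (v j).2⟩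
  map_add' _ _ := rfl
  map_smul' _ _ := rfl
  left_inv _ := rfl
  right_inv _ := rfl

instance (i : ℤ) : FiniteDimensional ℂ (degreePart dd i) :=
  Module.Finite.equiv (degreePartEquiv dd i).symm

lemma finrank_degreePart (i : ℤ) : Module.finrank ℂ (degreePart dd i) =
    ∑ j, Module.finrank ℂ (homogeneousPart (dd j - i)) := by
  rw [(degreePartEquiv dd i).finrank_eq, Module.finrank_pi_fintype]

lemma finrank_degreePart_zero : Module.finrank ℂ (degreePart dd 0) =
    Module.finrank ℂ (degreePart dd 2) + ∑ j, (2 * dd j + 1) := by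
  rw [finrank_degreePart, finrank_degreePart, ← Finset.sum_add_distrib]
  refine Finset.sum_congr rfl fun j _ => ?_
  rw [sub_zero, finrank_homogeneousPart_sub_two]

variable {R : Type} [Fintype R] {τ : Matrix J R S}

/-- A vector of polynomials of too small degrees which lies in the column space of `τ` on every
fibre vanishes. -/
lemma eq_zero_of_pointFunctional_eq_zero {ρ : R → ℕ}
    (hτ : ∀ j r, (τ j r).IsHomogeneous (dd j + ρ r))
    (hinj : ∀ p : Fin 3 → ℂ, p ≠ 0 → Function.Injective (τ.map (eval p)).mulVec) {w : J → S}
    (hw : w ∈ degreePart dd 1)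
    (h : ∀ p : Fin 3 → ℂ, p ≠ 0 → ∀ m, m ᵥ* τ.map (eval p) = 0 → pointFunctional m p w = 0) :
    w = 0 := by
  classical
  have hz : ∀ p : Fin 3 → ℂ, p ≠ 0 → ∃ z, τ.map (eval p) *ᵥ z = fun j => eval p (w j) := fun p hp =>
    exists_mulVec_eq_of_dotProduct _ _ fun m hm => by
      rw [← pointFunctional_apply]
      exact h p hp m hm
  -- The ideal of denominators `D` for which `D w` is a polynomial combination of the columns of
  -- `τ`.
  let I : Ideal S :=
    { carrier := {D | ∃ F, τ *ᵥ F = D • w}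
      zero_mem' := ⟨0, by simp⟩
      add_mem' := fun {a b} ⟨F, hF⟩ ⟨G, hG⟩ => ⟨F + G, by rw [mulVec_add, hF, hG, add_smul]⟩
      smul_mem' := fun c a ⟨F, hF⟩ => ⟨c • F, by rw [mulVec_smul, hF, smul_smul, smul_eq_mul]⟩ }
  have hI : ∀ p : Fin 3 → ℂ, p ≠ 0 → ∃ D ∈ I, eval p D ≠ 0 := by
    intro p hp
    obtain ⟨T, hT⟩ : ∃ T : Matrix R J ℂ, T * τ.map (eval p) = 1 := by
      obtain ⟨g, hg⟩ := LinearMap.exists_leftInverse_of_injective (τ.map (eval p)).mulVecLin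
        (LinearMap.ker_eq_bot.2 (hinj p hp))
      refine ⟨LinearMap.toMatrix' g, ?_⟩
      have h1 := LinearMap.toMatrix'_comp g (τ.map (eval p)).mulVecLin
      rw [hg, LinearMap.toMatrix'_id, ← toLin'_apply', LinearMap.toMatrix'_toLin'] at h1
      exact h1.symm
    obtain ⟨T', hT'⟩ : ∃ T' : Matrix R J S, ∀ q, T'.map (eval q) = T :=
      ⟨T.map MvPolynomial.C, fun q => by
        ext i j
        simp⟩
    let N : Matrix R R S := T' * τ
    have hN : ∀ q, N.map (eval q) = T * τ.map (eval q) := fun q => by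
      rw [Matrix.map_mul, hT']
    -- Cramer's rule: on each fibre `w = τ z`, so `T' w = N z` and `N.adjugate (T' w) = N.det z`.
    -- Since `N(p) = 1`, this denominator has value `1` at `p`.
    refine ⟨N.det, ⟨N.adjugate *ᵥ (T' *ᵥ w), ?_⟩, ?_⟩
    · refine funext fun j => sub_eq_zero.1 (eq_zero_of_eval_eq_zero fun q hq => ?_)
      obtain ⟨z, hz⟩ := hz q hq
      rw [map_sub, sub_eq_zero]
      have h1 := map_eval_mulVec τ (N.adjugate *ᵥ (T' *ᵥ w)) q
      have h3 : N.adjugate.map (eval q) = (N.map (eval q)).adjugate :=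
        RingHom.map_adjugate (eval q) N
      have h4 : eval q N.det = (N.map (eval q)).det := RingHom.map_det (eval q) N
      have h5 := map_eval_mulVec N.adjugate (T' *ᵥ w) q
      have h6 := map_eval_mulVec T' w q
      rw [hT', ← hz, mulVec_mulVec, ← hN] at h6
      rw [h6, h3, mulVec_mulVec z, adjugate_mul, smul_mulVec, one_mulVec] at h5
      rw [h5, mulVec_smul, hz, ← h4] at h1
      simpa using congrFun h1 j
    · have h4 : eval p N.det = (N.map (eval p)).det := RingHom.map_det (eval p) N
      rw [h4, hN, hT, det_one]
      exact one_ne_zero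
  obtain ⟨n, ⟨F, hF⟩, ⟨G, hG⟩⟩ := exists_pow_mem hI
  have h1 : (MvPolynomial.X 1 : S) ^ n • F - (MvPolynomial.X 0 : S) ^ n • G = 0 := by
    apply mulVec_eq_zero_of_injective hinj
    rw [mulVec_sub, mulVec_smul, mulVec_smul, hF, hG, smul_smul, smul_smul, mul_comm, sub_self]
  choose q hq using fun r => exists_eq_pow_mul (n := n) (f := F r) (g := G r)
    (sub_eq_zero.1 (congrFun h1 r)).symm
  have h2 : w = τ *ᵥ q := by
    have h3 : F = (MvPolynomial.X 0 : S) ^ n • q := funext hq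
    rw [h3, mulVec_smul] at hF
    exact (smul_right_injective (J → S) (pow_ne_zero n (MvPolynomial.X_ne_zero 0)) hF).symm
  funext j
  rcases mem_homogeneousPart_iff.1 (mem_degreePart.1 hw j) with h0 | ⟨k, hk, hwk⟩
  · exact h0
  have h3 : (DirectSum.decompose grading (w j) k : S) = w j :=
    DirectSum.decompose_of_mem_same _ hwk
  rw [← h3, h2, mulVec, dotProduct, DirectSum.decompose_sum, DFinsupp.finsetSum_apply,
    AddSubmonoidClass.coe_finsetSum]
  -- The entry `w j` has degree `dd j - 1`, less than the degree `dd j + ρ r` of `τ j r`. Multiples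
  -- of `τ j r` have no component in that degree.
  refine Finset.sum_eq_zero fun r _ => ?_
  exact DirectSum.coe_decompose_mul_of_left_mem_of_not_le grading (hτ j r) (by omega)

end DegreePart

/-! ### The bilinear form and the orthogonal space. -/

section Pairing

variable {J R : Type}

/-- A symmetric bilinear form on vectors of polynomials, for which multiplication by polynomials is
self-adjoint, which vanishes on the columns of `τ` and is perfect on the vectors whose entries have
degrees `dd j - 1`. -/
structure RelationPairing (dd : J → ℕ) (τ : Matrix J R S) where
  /-- The bilinear form. -/
  form : (J → S) →ₗ[ℂ] (J → S) →ₗ[ℂ] ℂ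
  /-- The vector which represents a functional. -/
  rep : ((J → S) →ₗ[ℂ] ℂ) →ₗ[ℂ] J → S
  form_comm : ∀ u v, form u v = form v u
  form_smul_left : ∀ (f : S) u v, form (f • u) v = form u (f • v)
  form_column : ∀ u r, form u (fun j => τ j r) = 0
  rep_mem : ∀ φ, rep φ ∈ degreePart dd 1
  form_rep : ∀ φ, ∀ v ∈ degreePart dd 1, form (rep φ) v = φ v
  eq_zero_of_form : ∀ w ∈ degreePart dd 1, (∀ v ∈ degreePart dd 1, form w v = 0) → w = 0

variable {dd : J → ℕ} {τ : Matrix J R S}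

/-- The form is a sum of squares of functionals `w ↦ m · w(p)` with `m τ(p) = 0`. Evaluation at
points makes multiplication self-adjoint, the choice of `m` kills the columns, and taking the
functionals to be a basis of the dual makes the form perfect. -/
lemma nonempty_relationPairing [Fintype J] [Fintype R] {ρ : R → ℕ} (hτ : ∀ j r, (τ j r).IsHomogeneous (dd j + ρ r))
    (hinj : ∀ p : Fin 3 → ℂ, p ≠ 0 → Function.Injective (τ.map (eval p)).mulVec) :
    Nonempty (RelationPairing dd τ) := by
  classical
  let T : Set (Module.Dual ℂ (degreePart dd 1)) := {φ | ∃ (m : J → ℂ) (p : Fin 3 → ℂ), p ≠ 0 ∧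
    m ᵥ* τ.map (eval p) = 0 ∧ φ = (pointFunctional m p).domRestrict (degreePart dd 1)}
  have hT : Submodule.span ℂ T = ⊤ := by
    -- In finite dimension the functionals span once they have no common zero. A common zero lies in
    -- the image of `τ` on every fibre, so it vanishes.
    have h1 : (Submodule.span ℂ T).dualCoannihilator = ⊥ := by
      refine (Submodule.eq_bot_iff _).2 fun w hw => ?_
      rw [Submodule.mem_dualCoannihilator] at hw
      refine Subtype.ext (eq_zero_of_pointFunctional_eq_zero hτ hinj w.2 fun p hp m hm => ?_)
      exact hw _ (Submodule.subset_span ⟨m, p, hp, hm, rfl⟩)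
    rw [← Subspace.dualCoannihilator_dualAnnihilator_eq (W := Submodule.span ℂ T), h1,
      Submodule.dualAnnihilator_bot]
  let b := Module.Basis.ofSpan hT.ge
  have : Fintype ((linearIndepOn_empty ℂ (id : Module.Dual ℂ (degreePart dd 1) → _)).extend
    (Set.empty_subset T)) := FiniteDimensional.fintypeBasisIndex b
  have hb : ∀ a, b a ∈ T := fun a => Module.Basis.ofSpan_subset hT.ge ⟨a, rfl⟩
  choose m p hp hm hbm using hb
  -- The basis of vectors dual to the chosen functionals; it is orthonormal for the form, which
  -- explains the formula for `rep`.
  let e := b.dualBasis.map (Module.evalEquiv ℂ (degreePart dd 1)).symm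
  have he : ∀ a a', pointFunctional (m a) (p a) (e a').1 = if a = a' then 1 else 0 := by
    intro a a'
    have h1 : b a (e a') = pointFunctional (m a) (p a) (e a').1 := by
      rw [hbm]
      rfl
    rw [← h1, Module.Basis.map_apply, Module.apply_evalEquiv_symm_apply,
      Module.Basis.dualBasis_apply_self]
  have hsum : ∀ w ∈ degreePart dd 1, w = ∑ a, pointFunctional (m a) (p a) w • (e a).1 := by
    intro w hw
    have h1 := congrArg Subtype.val (e.sum_repr ⟨w, hw⟩)
    rw [Submodule.coe_sum] at h1
    simp only [Submodule.coe_smul] at h1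
    have h2 : ∀ a, pointFunctional (m a) (p a) w = e.repr ⟨w, hw⟩ a := fun a => by
      conv_lhs => rw [← h1]
      simp [he]
    simp only [h2]
    exact h1.symm
  refine ⟨{
    form := ∑ a, (pointFunctional (m a) (p a)).smulRight (pointFunctional (m a) (p a))
    rep := ∑ a, (LinearMap.applyₗ (e a).1).smulRight (e a).1
    form_comm := fun u v => ?_
    form_smul_left := fun f u v => ?_
    form_column := fun u r => ?_
    rep_mem := fun φ => ?_
    form_rep := fun φ v hv => ?_
    eq_zero_of_form := fun w hw h => ?_ }⟩
  · simp [LinearMap.sum_apply, mul_comm]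
  · simp only [LinearMap.sum_apply, LinearMap.smulRight_apply, LinearMap.smul_apply,
      pointFunctional_smul, smul_eq_mul]
    exact Finset.sum_congr rfl fun a _ => by ring
  · simp only [LinearMap.sum_apply, LinearMap.smulRight_apply, LinearMap.smul_apply, smul_eq_mul]
    refine Finset.sum_eq_zero fun a _ => ?_
    have h1 : pointFunctional (m a) (p a) (fun j => τ j r) = 0 :=
      (pointFunctional_apply _ _ _).trans (congrFun (hm a) r)
    rw [h1, mul_zero]
  · simp only [LinearMap.sum_apply, LinearMap.smulRight_apply]
    exact Submodule.sum_mem _ fun a _ => Submodule.smul_mem _ _ (e a).2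
  · conv_rhs => rw [hsum v hv]
    simp [LinearMap.sum_apply, he, mul_comm]
  · rw [hsum w hw]
    refine Finset.sum_eq_zero fun a _ => ?_
    have h1 := h _ (e a).2
    simp [LinearMap.sum_apply, he] at h1
    rw [h1, zero_smul]

namespace RelationPairing

variable (B : RelationPairing dd τ)

include B in
-- Moving the linear form to the other side makes `linearForm c • g`, whose degrees are those where
-- the form is perfect, orthogonal to everything there.
lemma eq_zero_of_linearForm {c : Fin 3 → ℂ} (hc : c ≠ 0) {g : J → S} (hg : g ∈ degreePart dd 2)
    (h : ∀ v ∈ degreePart dd 1, B.form g (linearForm c • v) = 0) : g = 0 := by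
  have h1 := B.eq_zero_of_form (linearForm c • g)
    (smul_mem_degreePart (linearForm_mem c) hg (by norm_num)) fun v hv => by
      rw [B.form_smul_left, h v hv]
  exact (smul_eq_zero.1 h1).resolve_left (linearForm_ne_zero hc)

/-- The vectors with entries of degrees `dd j` which are orthogonal to those with entries of degrees
`dd j - 2`. -/
def orthogonal : Submodule ℂ (J → S) :=
  degreePart dd 0 ⊓ ⨅ g ∈ degreePart dd 2, LinearMap.ker (B.form g)

lemma mem_orthogonal {h : J → S} : h ∈ B.orthogonal ↔
    h ∈ degreePart dd 0 ∧ ∀ g ∈ degreePart dd 2, B.form g h = 0 := by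
  simp [orthogonal]

lemma orthogonal_le : B.orthogonal ≤ degreePart dd 0 := inf_le_left

instance [Fintype J] : FiniteDimensional ℂ B.orthogonal :=
  Submodule.finiteDimensional_of_le B.orthogonal_le

/-- The functionals on vectors with entries of degrees `dd j` given by the pairing. -/
def toDual : degreePart dd 2 →ₗ[ℂ] Module.Dual ℂ (degreePart dd 0) :=
  (LinearMap.lcomp ℂ ℂ (degreePart dd 0).subtype) ∘ₗ B.form ∘ₗ (degreePart dd 2).subtype

lemma toDual_injective : Function.Injective B.toDual := by
  rw [injective_iff_map_eq_zero]
  intro g hg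
  refine Subtype.ext (B.eq_zero_of_linearForm (c := Pi.single 0 1) (by simp) g.2 fun v hv => ?_)
  exact LinearMap.congr_fun hg ⟨linearForm (Pi.single 0 1) • v,
    smul_mem_degreePart (linearForm_mem _) hv (by norm_num)⟩

lemma dualCoannihilator_range_toDual :
    (LinearMap.range B.toDual).dualCoannihilator =
      B.orthogonal.comap (degreePart dd 0).subtype := by
  ext h
  rw [Submodule.mem_dualCoannihilator, Submodule.mem_comap, mem_orthogonal]
  constructor
  · intro h1
    exact ⟨h.2, fun g hg => h1 _ ⟨⟨g, hg⟩, rfl⟩⟩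
  · rintro ⟨-, h1⟩ _ ⟨g, rfl⟩
    exact h1 g.1 g.2

/-- The pairing embeds the vectors of degrees `dd j - 2` in the dual of those of degrees `dd j`, so
the dimension is the difference of theirs. It is this count that gives the matrix its size. -/
lemma finrank_orthogonal [Fintype J] : Module.finrank ℂ B.orthogonal = ∑ j, (2 * dd j + 1) := by
  have h1 := Subspace.finrank_add_finrank_dualCoannihilator_eq (LinearMap.range B.toDual)
  rw [LinearMap.finrank_range_of_inj B.toDual_injective, dualCoannihilator_range_toDual,
    finrank_degreePart_zero,
    (Submodule.comapSubtypeEquivOfLe B.orthogonal_le).finrank_eq]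
    at h1
  exact Nat.add_left_cancel h1

/-- Double annihilators in finite dimension: a functional that vanishes on the orthogonal space
comes from the pairing. -/
lemma exists_form_eq [Fintype J] {φ : (J → S) →ₗ[ℂ] ℂ} (hφ : ∀ h ∈ B.orthogonal, φ h = 0) :
    ∃ g ∈ degreePart dd 2, ∀ h ∈ degreePart dd 0, φ h = B.form g h := by
  have h1 : φ.domRestrict (degreePart dd 0) ∈
      (LinearMap.range B.toDual).dualCoannihilator.dualAnnihilator := by
    rw [Submodule.mem_dualAnnihilator]
    intro h hh
    rw [dualCoannihilator_range_toDual] at hh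
    exact hφ _ hh
  rw [Subspace.dualCoannihilator_dualAnnihilator_eq] at h1
  obtain ⟨g, hg⟩ := h1
  exact ⟨g.1, g.2, fun h hh => (LinearMap.congr_fun hg ⟨h, hh⟩).symm⟩

end RelationPairing

end Pairing

/-! ### Koszul arguments with the pairing, and the source of skew-symmetry. -/

section Koszul

variable {J R : Type} {dd : J → ℕ} {τ : Matrix J R S}

/-- The functional `v ↦ φ (f • v)`. -/
def mulFunctional (φ : (J → S) →ₗ[ℂ] ℂ) (f : S) : (J → S) →ₗ[ℂ] ℂ :=
  φ ∘ₗ Algebra.lsmul ℂ ℂ (J → S) f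

lemma mulFunctional_apply (φ : (J → S) →ₗ[ℂ] ℂ) (f : S) (v : J → S) :
    mulFunctional φ f v = φ (f • v) := rfl

lemma mulFunctional_linearForm (φ : (J → S) →ₗ[ℂ] ℂ) (c : Fin 3 → ℂ) :
    mulFunctional φ (linearForm c) = ∑ k, c k • mulFunctional φ (MvPolynomial.X k) := by
  ext v
  simp only [mulFunctional_apply, linearForm, Finset.sum_smul, map_sum, LinearMap.sum_apply,
    LinearMap.smul_apply, smul_assoc, map_smul]

/-- The cross product with the vector of coordinates. -/
def coordCross : (Fin 3 → J → S) →ₗ[ℂ] Fin 3 → J → S where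
  toFun g k := (MvPolynomial.X (k + 1) : S) • g (k + 2) - (MvPolynomial.X (k + 2) : S) • g (k + 1)
  map_add' f g := by
    ext1 k
    simp only [Pi.add_apply, smul_add]
    abel
  map_smul' c f := by
    ext1 k
    simp only [Pi.smul_apply, RingHom.id_apply, smul_sub, smul_comm c]

lemma coordCross_apply (g : Fin 3 → J → S) (k : Fin 3) : coordCross g k =
    (MvPolynomial.X (k + 1) : S) • g (k + 2) - (MvPolynomial.X (k + 2) : S) • g (k + 1) := rfl

lemma exists_of_coordCross_eq_zero {g : Fin 3 → J → S} (hg : coordCross g = 0) :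
    ∃ t : J → S, ∀ k, g k = (MvPolynomial.X k : S) • t := by
  have h2 : ∀ j, (MvPolynomial.X 0 : S) * g 1 j = MvPolynomial.X 1 * g 0 j := fun j =>
    sub_eq_zero.1 (congrFun (congrFun hg 2) j)
  have h1 : ∀ j, (MvPolynomial.X 2 : S) * g 0 j = MvPolynomial.X 0 * g 2 j := fun j =>
    sub_eq_zero.1 (congrFun (congrFun hg 1) j)
  have key : ∀ j, ∃ t, g 0 j = MvPolynomial.X 0 * t ∧ g 1 j = MvPolynomial.X 1 * t := fun j => by
    have h3 := exists_of_linearForm_mul_eq (c := Pi.single 0 1) (c' := Pi.single 1 1)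
      (f := g 1 j) (g := g 0 j) (by
        intro h
        have := congrFun h 2
        simp [cross_apply] at this) (by rw [linearForm_single, linearForm_single, h2])
    simpa only [linearForm_single] using h3
  choose t ht0 ht1 using key
  refine ⟨t, fun k => funext fun j => ?_⟩
  fin_cases k
  · exact ht0 j
  · exact ht1 j
  · refine mul_left_cancel₀ (MvPolynomial.X_ne_zero (0 : Fin 3)) ((h1 j).symm.trans ?_)
    rw [ht0 j]
    simp
    ring

lemma coordCross_single (k : Fin 3) (g : J → S) : coordCross (Pi.single k g) =
    Pi.single (k + 1) ((MvPolynomial.X (k + 2) : S) • g) -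
      Pi.single (k + 2) ((MvPolynomial.X (k + 1) : S) • g) := by
  ext1 l
  rw [coordCross_apply]
  fin_cases k <;> fin_cases l <;> simp

namespace RelationPairing

variable (B : RelationPairing dd τ)

/-- A vector of polynomials of degrees `dd j + 1` in the kernel of the pairing is a combination of
coordinates with orthogonal coefficients. -/
lemma exists_orthogonal_of_form_eq_zero [Fintype J] {ε : J → S}
    (hε : ∀ j, (ε j).IsHomogeneous (dd j + 1)) (hB : ∀ u, B.form u ε = 0) :
    ∃ e : Fin 3 → J → S, (∀ k, e k ∈ B.orthogonal) ∧
      ε = ∑ k, (MvPolynomial.X k : S) • e k := by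
  choose h hh hsum using fun j => exists_eq_sum_X_mul (hε j)
  have hε' : ε = ∑ k, (MvPolynomial.X k : S) • fun j => h j k := by
    ext1 j
    rw [hsum j, Finset.sum_apply]
    rfl
  let G : Submodule ℂ (Fin 3 → J → S) := Submodule.pi Set.univ fun _ => degreePart dd 2
  -- The obstruction to the coefficients `h` being orthogonal. A Koszul correction of `h` leaves `∑
  -- X k • h k` unchanged, so it suffices to write `θ` as a functional of `coordCross g`.
  let θ : (Fin 3 → J → S) →ₗ[ℂ] ℂ :=
    ∑ k, (B.form.flip fun j => h j k) ∘ₗ LinearMap.proj k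
  have hθ : ∀ g, θ g = ∑ k, B.form (g k) fun j => h j k := fun g => by
    simp [θ, LinearMap.sum_apply]
  have h1 : θ.domRestrict G ∈ LinearMap.range (coordCross (J := J) ∘ₗ G.subtype).dualMap := by
    rw [LinearMap.range_dualMap_eq_dualAnnihilator_ker, Submodule.mem_dualAnnihilator]
    intro g hg
    -- On the kernel of the cross product, where `g k = X k • t`, self-adjointness turns `θ g` into
    -- `B.form t ε`, which is zero.
    obtain ⟨t, ht⟩ := exists_of_coordCross_eq_zero (LinearMap.mem_ker.1 hg)
    change θ g.1 = 0
    have ht' : ∀ k, g.1 k = (MvPolynomial.X k : S) • t := ht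
    rw [hθ]
    simp only [ht', B.form_smul_left]
    rw [← map_sum, ← hε', hB]
  obtain ⟨η, hη⟩ := h1
  -- The vectors representing the components of `η`; they are the Koszul correction of `h`.
  let w : Fin 3 → J → S := fun l => B.rep (η ∘ₗ LinearMap.single ℂ (fun _ => J → S) l)
  have hw : ∀ l, w l ∈ degreePart dd 1 := fun l => B.rep_mem _
  have hBw : ∀ l, ∀ g ∈ degreePart dd 2, ∀ k : Fin 3, B.form g ((MvPolynomial.X k : S) • w l) =
      η (Pi.single l ((MvPolynomial.X k : S) • g)) := fun l g hg k => by
    rw [B.form_comm, B.form_smul_left, B.form_rep _ _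
      (smul_mem_degreePart (X_mem_homogeneousPart k) hg (by norm_num))]
    rfl
  have hB2 : ∀ g ∈ degreePart dd 2, ∀ k, B.form g (fun j => h j k) =
      B.form g ((MvPolynomial.X (k + 2) : S) • w (k + 1)) -
        B.form g ((MvPolynomial.X (k + 1) : S) • w (k + 2)) := fun g hg k => by
    have hm : Pi.single k g ∈ G := by
      rw [Submodule.mem_pi]
      intro l _
      rcases eq_or_ne l k with rfl | hl
      · simpa using hg
      · simp [hl]
    have h2 : η (coordCross (Pi.single k g)) = θ (Pi.single k g) :=
      LinearMap.congr_fun hη ⟨Pi.single k g, hm⟩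
    rw [coordCross_single, map_sub, hθ, Finset.sum_eq_single k
      (fun l _ hl => by simp [hl]) (by simp), Pi.single_eq_same] at h2
    rw [hBw _ g hg, hBw _ g hg, h2]
  refine ⟨fun k => (fun j => h j k) - (MvPolynomial.X (k + 2) : S) • w (k + 1) +
    (MvPolynomial.X (k + 1) : S) • w (k + 2), fun k => ?_, ?_⟩
  · rw [mem_orthogonal]
    refine ⟨add_mem (sub_mem (mem_degreePart_zero.2 fun j => hh j k) ?_) ?_, fun g hg => ?_⟩
    · exact smul_mem_degreePart (X_mem_homogeneousPart _) (hw _) (by norm_num)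
    · exact smul_mem_degreePart (X_mem_homogeneousPart _) (hw _) (by norm_num)
    · rw [map_add, map_sub, hB2 g hg]
      ring
  · rw [hε', Fin.sum_univ_three, Fin.sum_univ_three]
    ext1 j
    simp
    ring

/-- The skew-symmetric expression `f • ⟨φ g⟩ - g • ⟨φ f⟩` where `⟨φ f⟩` represents
`v ↦ φ (f • v)`. -/
def cross (φ : (J → S) →ₗ[ℂ] ℂ) (f g : S) : J → S :=
  f • B.rep (mulFunctional φ g) - g • B.rep (mulFunctional φ f)

/-- For `h` of degrees `dd j - 2`, both terms pair with `h` to `φ (f g h)`, so they cancel. -/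
lemma cross_mem_orthogonal (φ : (J → S) →ₗ[ℂ] ℂ) {f g : S} (hf : f ∈ homogeneousPart 1)
    (hg : g ∈ homogeneousPart 1) : B.cross φ f g ∈ B.orthogonal := by
  rw [mem_orthogonal]
  refine ⟨sub_mem (smul_mem_degreePart hf (B.rep_mem _) (by norm_num))
    (smul_mem_degreePart hg (B.rep_mem _) (by norm_num)), fun h hh => ?_⟩
  rw [cross, map_sub, B.form_comm, B.form_comm h, B.form_smul_left, B.form_smul_left,
    B.form_rep _ _ (smul_mem_degreePart hf hh (by norm_num)),
    B.form_rep _ _ (smul_mem_degreePart hg hh (by norm_num)), mulFunctional_apply,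
    mulFunctional_apply, smul_comm, sub_self]

/-- Both `ψ (f ⟨φ g⟩)` and `φ (g ⟨ψ f⟩)` equal the pairing of `⟨ψ f⟩` with `⟨φ g⟩`. Symmetry of the
pairing thus becomes skew-symmetry in `φ` and `ψ`. -/
lemma apply_cross (φ ψ : (J → S) →ₗ[ℂ] ℂ) (f g : S) :
    ψ (B.cross φ f g) = -φ (B.cross ψ f g) := by
  have h : ∀ (φ ψ : (J → S) →ₗ[ℂ] ℂ) (f g : S), ψ (f • B.rep (mulFunctional φ g)) =
      φ (g • B.rep (mulFunctional ψ f)) := fun φ ψ f g => by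
    rw [← mulFunctional_apply ψ, ← mulFunctional_apply φ, ← B.form_rep _ _ (B.rep_mem _),
      B.form_comm, B.form_rep _ _ (B.rep_mem _)]
  rw [cross, cross, map_sub, map_sub, h φ ψ, h φ ψ]
  ring

lemma cross_linearForm (φ : (J → S) →ₗ[ℂ] ℂ) (c c' : Fin 3 → ℂ) :
    B.cross φ (linearForm c) (linearForm c') =
      ∑ l, (c ⨯₃ c') l • B.cross φ (MvPolynomial.X (l + 1)) (MvPolynomial.X (l + 2)) := by
  simp only [cross, mulFunctional_linearForm, map_sum, map_smul]
  ext1 j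
  simp [linearForm, cross_apply, Fin.sum_univ_three, MvPolynomial.smul_eq_C_mul]
  ring

/-- With `w l` representing `v ↦ φ (X l • v)`, the sum is the triple product of the coordinate
vector with itself and `w`. -/
lemma sum_X_smul_cross (φ : (J → S) →ₗ[ℂ] ℂ) :
    ∑ l, (MvPolynomial.X l : S) •
      B.cross φ (MvPolynomial.X (l + 1)) (MvPolynomial.X (l + 2)) = 0 := by
  ext1 j
  simp [cross, Fin.sum_univ_three]
  ring

end RelationPairing

end Koszul

/-! ### The skew-symmetric matrix of linear forms. -/

section Frame

lemma exists_dotProduct_eq {m : Type} [Fintype m] (f : (m → ℂ) →ₗ[ℂ] ℂ) :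
    ∃ y, ∀ w, f w = y ⬝ᵥ w := by
  classical
  refine ⟨fun i => f (Pi.single i 1), fun w => ?_⟩
  conv_lhs => rw [pi_eq_sum_univ' w, map_sum]
  simp only [map_smul, smul_eq_mul, dotProduct, mul_comm]

lemma isHomogeneous_linearForm (c : Fin 3 → ℂ) : (linearForm c).IsHomogeneous 1 :=
  mem_homogeneousPart_natCast.1 (linearForm_mem c)

variable {J κ β : Type} {dd : J → ℕ} {σ : Matrix J κ S} {ε : Matrix J β S}

/-- A basis of the orthogonal vectors modulo the columns of `σ`, with extensions of its
coordinates, and orthogonal coefficients of the columns of `ε`. -/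
structure OrthogonalFrame [Fintype κ] (B : RelationPairing dd (fromCols σ ε)) (ι : Type) [Fintype ι]
    [DecidableEq ι] where
  /-- The basis. -/
  basis : ι → J → S
  /-- The coordinates. -/
  coord : ι → (J → S) →ₗ[ℂ] ℂ
  /-- The coefficients of the columns of `σ`. -/
  colCoord : κ → (J → S) →ₗ[ℂ] ℂ
  /-- The coefficients of the columns of `ε`. -/
  coeff : β → Fin 3 → J → S
  basis_mem : ∀ i, basis i ∈ B.orthogonal
  column_mem : ∀ r, (fun j => σ j r) ∈ B.orthogonal
  coord_basis : ∀ i i', coord i (basis i') = if i = i' then 1 else 0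
  coord_column : ∀ i r, coord i (fun j => σ j r) = 0
  expand : ∀ h ∈ B.orthogonal, h = ∑ i, coord i h • basis i + ∑ r, colCoord r h • fun j => σ j r
  coeff_mem : ∀ m k, coeff m k ∈ B.orthogonal
  sum_coeff : ∀ m, (fun j => ε j m) = ∑ k, (MvPolynomial.X k : S) • coeff m k

namespace OrthogonalFrame

variable [Fintype κ] {B : RelationPairing dd (fromCols σ ε)} {ι : Type} [Fintype ι]
  [DecidableEq ι] (F : OrthogonalFrame B ι)

/-- The block of the skew-symmetric matrix given by the pairing. -/
def pairingBlock : Matrix ι ι S := of fun i i' => linearForm fun l =>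
  F.coord i (B.cross (F.coord i') (MvPolynomial.X (l + 1)) (MvPolynomial.X (l + 2)))

/-- The block of the skew-symmetric matrix given by `ε`. -/
def columnBlock : Matrix ι β S := of fun i m => linearForm fun k => F.coord i (F.coeff m k)

/-- The skew-symmetric matrix. -/
def skewMatrix : Matrix (ι ⊕ β) (ι ⊕ β) S :=
  fromBlocks F.pairingBlock F.columnBlock (-F.columnBlockᵀ) 0

/-- The generators given by the basis. -/
def generators : Matrix J (ι ⊕ β) S := fromCols (of fun j i => F.basis i j) 0

/-- The coefficients of the relations between the generators. -/
def relationCoeffs [DecidableEq β] : Matrix (κ ⊕ β) (ι ⊕ β) S :=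
  fromBlocks
    (of fun r i => -linearForm fun l =>
      F.colCoord r (B.cross (F.coord i) (MvPolynomial.X (l + 1)) (MvPolynomial.X (l + 2))))
    (of fun r m => -linearForm fun k => F.colCoord r (F.coeff m k)) 0 1

lemma linear_skewMatrix (x y : ι ⊕ β) : (F.skewMatrix x y).IsHomogeneous 1 := by
  rw [skewMatrix]
  rcases x with i | m <;> rcases y with i' | m'
  · rw [fromBlocks_apply₁₁, pairingBlock, of_apply]
    exact isHomogeneous_linearForm _
  · rw [fromBlocks_apply₁₂, columnBlock, of_apply]
    exact isHomogeneous_linearForm _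
  · rw [fromBlocks_apply₂₁, neg_apply, transpose_apply, columnBlock, of_apply]
    exact (isHomogeneous_linearForm _).neg
  · rw [fromBlocks_apply₂₂]
    exact MvPolynomial.isHomogeneous_zero _ _ _

lemma transpose_skewMatrix : F.skewMatrixᵀ = -F.skewMatrix := by
  have h : F.pairingBlockᵀ = -F.pairingBlock := by
    ext1 i i'
    have h1 : (fun l => F.coord i'
        (B.cross (F.coord i) (MvPolynomial.X (l + 1)) (MvPolynomial.X (l + 2)))) = (-1 : ℂ) •
          fun l => F.coord i (B.cross (F.coord i') (MvPolynomial.X (l + 1))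
            (MvPolynomial.X (l + 2))) := by
      ext1 l
      rw [B.apply_cross]
      simp
    rw [transpose_apply, neg_apply, pairingBlock, of_apply, of_apply, h1, linearForm_smul, neg_smul,
      one_smul]
  rw [skewMatrix, fromBlocks_transpose, fromBlocks_neg, h]
  simp

lemma transpose_skewMatrix_map (p : Fin 3 → ℂ) :
    (F.skewMatrix.map (eval p))ᵀ = -F.skewMatrix.map (eval p) := by
  ext x y
  have h := congrFun (congrFun F.transpose_skewMatrix x) y
  rw [transpose_apply, Matrix.neg_apply] at h
  rw [transpose_apply, map_apply, h, Matrix.neg_apply, map_apply, map_neg]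

lemma isHomogeneous_generators (j : J) (x : ι ⊕ β) :
    (F.generators j x).IsHomogeneous (dd j) := by
  rcases x with i | m
  · exact mem_degreePart_zero.1 (B.orthogonal_le (F.basis_mem i)) j
  · exact MvPolynomial.isHomogeneous_zero _ _ _

lemma isHomogeneous_relationCoeffs [DecidableEq β] (r : κ ⊕ β) (x : ι ⊕ β) :
    (F.relationCoeffs r x).IsHomogeneous (Sum.elim (fun _ => 1) (fun _ => 0) r : ℕ) := by
  rw [relationCoeffs]
  rcases r with r | m' <;> rcases x with i | m
  · rw [fromBlocks_apply₁₁, of_apply]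
    exact (isHomogeneous_linearForm _).neg
  · rw [fromBlocks_apply₁₂, of_apply]
    exact (isHomogeneous_linearForm _).neg
  · rw [fromBlocks_apply₂₁]
    exact MvPolynomial.isHomogeneous_zero _ _ _
  · simp only [fromBlocks_apply₂₂, one_apply, Sum.elim_inr]
    split_ifs
    · exact MvPolynomial.isHomogeneous_one _ _
    · exact MvPolynomial.isHomogeneous_zero _ _ _

lemma sum_X_smul_eq {v : Fin 3 → J → S} (hv : ∀ l, v l ∈ B.orthogonal) (j : J) :
    ∑ l, MvPolynomial.X l * v l j = ∑ i, F.basis i j * linearForm (fun l => F.coord i (v l)) +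
      ∑ r, σ j r * linearForm (fun l => F.colCoord r (v l)) := by
  have h : ∀ l, v l j = ∑ i, F.coord i (v l) • F.basis i j + ∑ r, F.colCoord r (v l) • σ j r :=
    fun l => by
      conv_lhs => rw [F.expand _ (hv l)]
      simp
  simp only [h, linearForm, Finset.mul_sum, mul_add, Finset.sum_add_distrib]
  rw [Finset.sum_comm, Finset.sum_comm (s := Finset.univ (α := Fin 3)) (t := Finset.univ (α := κ))]
  simp only [mul_smul_comm, mul_comm]

/-- A column is obtained by expanding vectors `v l` of the orthogonal space in the frame and summing
against `X l`. The sum is zero for the cross products and a column of `ε` for its coefficients; the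
coordinates along `σ`, and that column, are moved to the right. -/
lemma generators_mul_skewMatrix [Fintype β] [DecidableEq β] :
    F.generators * F.skewMatrix = fromCols σ ε * F.relationCoeffs := by
  ext1 j x
  rw [mul_apply, mul_apply, Fintype.sum_sum_type, Fintype.sum_sum_type]
  rcases x with i' | m
  · have h := F.sum_X_smul_eq (fun l => B.cross_mem_orthogonal (F.coord i')
      (X_mem_homogeneousPart (l + 1)) (X_mem_homogeneousPart (l + 2))) j
    have h0 := congrFun (B.sum_X_smul_cross (F.coord i')) j
    simp only [Finset.sum_apply, Pi.smul_apply, smul_eq_mul, Pi.zero_apply] at h0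
    rw [h0] at h
    simp only [generators, skewMatrix, relationCoeffs, fromCols_apply_inl, fromCols_apply_inr,
      fromBlocks_apply₁₁, fromBlocks_apply₂₁, of_apply, Matrix.zero_apply, zero_mul, mul_zero, mul_neg,
      Finset.sum_const_zero, add_zero, pairingBlock, Finset.sum_neg_distrib]
    exact eq_neg_of_add_eq_zero_left h.symm
  · have h := F.sum_X_smul_eq (F.coeff_mem m) j
    have h0 := congrFun (F.sum_coeff m) j
    simp only [Finset.sum_apply, Pi.smul_apply, smul_eq_mul] at h0
    rw [← h0] at h
    simp only [generators, skewMatrix, relationCoeffs, fromCols_apply_inl, fromCols_apply_inr,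
      fromBlocks_apply₁₂, fromBlocks_apply₂₂, of_apply, Matrix.zero_apply, mul_zero, mul_neg,
      Finset.sum_const_zero, add_zero, columnBlock, Finset.sum_neg_distrib, one_apply, mul_ite,
      mul_one, Finset.sum_ite_eq', Finset.mem_univ, if_true]
    rw [h]
    ring

end OrthogonalFrame

end Frame

/-! ### Kernel, image and rank of the matrix at a point. -/

section Fibre

variable {J κ β : Type} {dd : J → ℕ}

/-- A functional which vanishes on the multiples of two linear forms is given by a value at their
common zero. -/
lemma exists_dotProduct_eval_eq [Fintype J] {c c' : Fin 3 → ℂ} (h0 : c ⨯₃ c' ≠ 0) {ψ : (J → S) →ₗ[ℂ] ℂ}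
    (h1 : ∀ v ∈ degreePart dd 1, ψ (linearForm c • v) = 0)
    (h2 : ∀ v ∈ degreePart dd 1, ψ (linearForm c' • v) = 0) :
    ∃ y : J → ℂ, ∀ h ∈ degreePart dd 0, ψ h = pointFunctional y (c ⨯₃ c') h := by
  let ev : degreePart dd 0 →ₗ[ℂ] J → ℂ :=
    (MvPolynomial.aeval (c ⨯₃ c')).toLinearMap.compLeft J ∘ₗ (degreePart dd 0).subtype
  have hev : ∀ h j, ev h j = eval (c ⨯₃ c') (h.1 j) := fun h j => by
    simp [ev, MvPolynomial.aeval_eq_eval]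
  -- A vector that vanishes at the point is a combination of the two linear forms, on which `ψ` is
  -- zero. So `ψ` factors through evaluation at the point.
  have key : ψ.domRestrict (degreePart dd 0) ∈ LinearMap.range ev.dualMap := by
    rw [LinearMap.range_dualMap_eq_dualAnnihilator_ker, Submodule.mem_dualAnnihilator]
    intro h hh
    have h3 : ∀ j, eval (c ⨯₃ c') (h.1 j) = 0 := fun j =>
      (hev h j).symm.trans (congrFun (LinearMap.mem_ker.1 hh) j)
    choose f hf g hg hfg using fun j =>
      exists_of_eval_eq_zero h0 (mem_degreePart.1 h.2 j) (h3 j)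
    have h4 : h.1 = linearForm c • f + linearForm c' • g := funext hfg
    rw [LinearMap.domRestrict_apply, h4, map_add,
      h1 f (mem_degreePart.2 fun j => by simpa using hf j),
      h2 g (mem_degreePart.2 fun j => by simpa using hg j), add_zero]
  obtain ⟨f, hf⟩ := key
  obtain ⟨y, hy⟩ := exists_dotProduct_eq f
  refine ⟨y, fun h hh => ?_⟩
  have h3 := LinearMap.congr_fun hf ⟨h, hh⟩
  rw [LinearMap.dualMap_apply, hy] at h3
  rw [pointFunctional_apply]
  refine h3.symm.trans (congrArg (y ⬝ᵥ ·) (funext fun j => hev _ j))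

variable {σ : Matrix J κ S} {ε : Matrix J β S}

lemma RelationPairing.cross_sum_smul {τ : Matrix J κ S} (B : RelationPairing dd τ) {ι : Type}
    [Fintype ι] (ξ : ι → ℂ) (φ : ι → (J → S) →ₗ[ℂ] ℂ) (f g : S) :
    B.cross (∑ i, ξ i • φ i) f g = ∑ i, ξ i • B.cross (φ i) f g := by
  have h : ∀ f, mulFunctional (∑ i, ξ i • φ i) f = ∑ i, ξ i • mulFunctional (φ i) f := fun f => by
    ext v
    simp [mulFunctional_apply, LinearMap.sum_apply]
  simp only [RelationPairing.cross, h, map_sum, map_smul, Finset.smul_sum, smul_sub,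
    Finset.sum_sub_distrib, smul_comm (_ : S) (_ : ℂ)]

/-- A functional whose skew-symmetric expression vanishes differs from one given by the pairing by
the value at a point. -/
lemma RelationPairing.exists_of_cross_eq_zero [Fintype J] {τ : Matrix J κ S} (B : RelationPairing dd τ)
    {c c' : Fin 3 → ℂ} (h0 : c ⨯₃ c' ≠ 0) {φ : (J → S) →ₗ[ℂ] ℂ}
    (h : B.cross φ (linearForm c) (linearForm c') = 0) :
    ∃ y : J → ℂ, ∀ v ∈ B.orthogonal, φ v = pointFunctional y (c ⨯₃ c') v := by
  have hc : c ≠ 0 := by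
    rintro rfl
    simp at h0
  -- Vanishing of the cross expression is a syzygy between two independent linear forms, so both
  -- representing vectors are multiples of one `t`.
  choose t ht1 ht2 using fun j => exists_of_linearForm_mul_eq h0
    (sub_eq_zero.1 (congrFun h j))
  have ht1' : B.rep (mulFunctional φ (linearForm c)) = linearForm c • t := funext ht1
  have ht2' : B.rep (mulFunctional φ (linearForm c')) = linearForm c' • t := funext ht2
  have ht : t ∈ degreePart dd 2 := mem_degreePart_of_smul_mem (linearForm_mem c)
    (linearForm_ne_zero hc) (ht1' ▸ B.rep_mem _) (by norm_num)
  -- After subtraction of `B.form t`, the functional vanishes on the multiples of both linear forms.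
  -- The subtracted term is zero on the orthogonal space.
  obtain ⟨y, hy⟩ := exists_dotProduct_eval_eq (dd := dd) h0 (ψ := φ - B.form t)
    (fun v hv => by
      rw [LinearMap.sub_apply, ← B.form_smul_left, ← ht1', B.form_rep _ _ hv, mulFunctional_apply,
        sub_self])
    (fun v hv => by
      rw [LinearMap.sub_apply, ← B.form_smul_left, ← ht2', B.form_rep _ _ hv, mulFunctional_apply,
        sub_self])
  refine ⟨y, fun v hv => ?_⟩
  rw [← hy v (B.orthogonal_le hv), LinearMap.sub_apply, (B.mem_orthogonal.1 hv).2 t ht, sub_zero]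

namespace OrthogonalFrame

variable [Fintype κ] {B : RelationPairing dd (fromCols σ ε)} {ι : Type} [Fintype ι]
  [DecidableEq ι] (F : OrthogonalFrame B ι)

lemma eval_columnBlock (p : Fin 3 → ℂ) (i : ι) (m : β) :
    eval p (F.columnBlock i m) = F.coord i (∑ k, p k • F.coeff m k) := by
  rw [columnBlock, of_apply, eval_linearForm, map_sum]
  simp only [map_smul, dotProduct, smul_eq_mul, mul_comm]

lemma eval_pairingBlock (c c' : Fin 3 → ℂ) (i i' : ι) : eval (c ⨯₃ c') (F.pairingBlock i i') =
    F.coord i (B.cross (F.coord i') (linearForm c) (linearForm c')) := by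
  rw [pairingBlock, of_apply, eval_linearForm, B.cross_linearForm, map_sum]
  simp only [map_smul, dotProduct, smul_eq_mul, mul_comm]

lemma eval_sum_coeff (p : Fin 3 → ℂ) (m : β) (j : J) :
    eval p ((∑ k, p k • F.coeff m k) j) = eval p (ε j m) := by
  rw [congrFun (F.sum_coeff m) j]
  simp [MvPolynomial.smul_eval]

lemma exists_of_coord_eq_zero {h : J → S} (hh : h ∈ B.orthogonal) (h0 : ∀ i, F.coord i h = 0) :
    ∃ x : κ → ℂ, ∀ j, h j = ∑ r, x r • σ j r := by
  refine ⟨fun r => F.colCoord r h, fun j => ?_⟩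
  conv_lhs => rw [F.expand h hh]
  simp [h0]

variable [Fintype J] [Fintype β]

/-- The kernel of the skew-symmetric matrix at a point. -/
lemma exists_of_skewMatrix_mulVec_eq_zero {p : Fin 3 → ℂ} (hp : p ≠ 0)
    (hinj : Function.Injective ((fromCols σ ε).map (eval p)).mulVec) {x : ι ⊕ β → ℂ}
    (hx : F.skewMatrix.map (eval p) *ᵥ x = 0) :
    ∃ y : J → ℂ, y ᵥ* (fromCols σ ε).map (eval p) = 0 ∧ x = y ᵥ* F.generators.map (eval p) := by
  obtain ⟨c, c', rfl⟩ := exists_cross_eq hp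
  set p := c ⨯₃ c' with hpc
  -- The upper rows of the kernel equation say that the cross expression of `u` plus `∑ x m • q m`
  -- has no coordinates modulo `σ`; the lower rows say that `u` kills each `q m`.
  let u := ∑ i, x (.inl i) • F.coord i
  let q : β → J → S := fun m => ∑ k, p k • F.coeff m k
  have hq : ∀ m, q m ∈ B.orthogonal := fun m =>
    Submodule.sum_mem _ fun k _ => Submodule.smul_mem _ _ (F.coeff_mem m k)
  have hcross := B.cross_sum_smul (fun i => x (.inl i)) F.coord (linearForm c) (linearForm c')
  have h1 : ∀ i, F.coord i (B.cross u (linearForm c) (linearForm c') +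
      ∑ m, x (.inr m) • q m) = 0 := fun i => by
    have h := congrFun hx (.inl i)
    simp only [mulVec, dotProduct, Fintype.sum_sum_type, map_apply, skewMatrix,
      fromBlocks_apply₁₁, fromBlocks_apply₁₂, hpc, eval_columnBlock, eval_pairingBlock] at h
    rw [hcross, map_add, map_sum, map_sum]
    simp only [map_smul, smul_eq_mul, mul_comm (x _)]
    exact h
  have h2 : ∀ m, u (q m) = 0 := fun m => by
    have h := congrFun hx (.inr m)
    simp only [mulVec, dotProduct, Fintype.sum_sum_type, map_apply, skewMatrix,
      fromBlocks_apply₂₁, fromBlocks_apply₂₂, Matrix.neg_apply, transpose_apply, map_neg,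
      eval_columnBlock, Matrix.zero_apply, map_zero, zero_mul, Finset.sum_const_zero,
      add_zero, neg_mul, Finset.sum_neg_distrib] at h
    simp only [u, LinearMap.sum_apply, LinearMap.smul_apply, smul_eq_mul, mul_comm (x _)]
    exact neg_eq_zero.1 h
  have hlin : ∀ d : Fin 3 → ℂ, d ⬝ᵥ p = 0 → eval p (linearForm d) = 0 := fun d hd => by
    rw [eval_linearForm, hd]
  have hc1 := hlin c (dot_self_cross c c')
  have hc2 := hlin c' (dot_cross_self c c')
  obtain ⟨z, hz⟩ := F.exists_of_coord_eq_zero (add_mem (B.cross_mem_orthogonal u (linearForm_mem c)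
    (linearForm_mem c')) (Submodule.sum_mem _ fun m _ => Submodule.smul_mem _ _ (hq m))) h1
  -- At `p` the cross expression vanishes, both linear forms being zero there, and `q m` takes the
  -- value of the column `m` of `ε`. What remains is a relation between the columns of `τ(p)`.
  have h3 : (fromCols σ ε).map (eval p) *ᵥ Sum.elim (-z) (fun m => x (.inr m)) = 0 := by
    ext1 j
    have h := congrArg (eval p) (hz j)
    simp only [RelationPairing.cross, Pi.add_apply, Pi.sub_apply, Pi.smul_apply, smul_eq_mul,
      map_add, map_sub, map_mul, hc1, hc2, zero_mul, sub_zero, zero_add, Finset.sum_apply, map_sum,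
      MvPolynomial.smul_eval] at h
    simp only [mulVec, dotProduct, Fintype.sum_sum_type, map_apply, fromCols_apply_inl,
      fromCols_apply_inr, Sum.elim_inl, Sum.elim_inr, Pi.neg_apply, mul_neg, Pi.zero_apply,
      Finset.sum_neg_distrib]
    rw [neg_add_eq_zero]
    have h4 : ∀ m, eval p (q m j) = eval p (ε j m) := fun m => F.eval_sum_coeff p m j
    simp only [h4, mul_comm (x _), mul_comm (z _)] at h
    exact h.symm
  have h4 := hinj (h3.trans (mulVec_zero _).symm)
  have h5 : ∀ m, x (.inr m) = 0 := fun m => congrFun h4 (.inr m)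
  have h6 : ∀ r, z r = 0 := fun r => neg_eq_zero.1 (congrFun h4 (.inl r))
  have h7 : B.cross u (linearForm c) (linearForm c') = 0 := by
    ext1 j
    have := hz j
    simpa [h5, h6] using this
  obtain ⟨y, hy⟩ := B.exists_of_cross_eq_zero hp h7
  refine ⟨y, funext fun r => ?_, funext fun a => ?_⟩
  · rcases r with r | m
    · have hr := hy _ (F.column_mem r)
      rw [pointFunctional_apply] at hr
      refine hr.symm.trans ?_
      simp [u, LinearMap.sum_apply, F.coord_column]
    · have hm := hy _ (hq m)
      rw [h2, pointFunctional_apply] at hm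
      refine Eq.trans ?_ hm.symm
      exact congrArg (y ⬝ᵥ ·) (funext fun j => (F.eval_sum_coeff p m j).symm)
  · rcases a with i | m
    · have hi := hy _ (F.basis_mem i)
      rw [pointFunctional_apply] at hi
      refine Eq.trans ?_ hi
      simp [u, LinearMap.sum_apply, F.coord_basis]
    · rw [h5]
      refine (Finset.sum_eq_zero fun j _ => ?_).symm
      simp [generators]

/-- Transposing `Φ A = τ Ψ` at `p` and using skew-symmetry gives the inclusion opposite to that of
`exists_of_skewMatrix_mulVec_eq_zero`. -/
lemma skewMatrix_mulVec_vecMul {p : Fin 3 → ℂ} {y : J → ℂ}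
    (hy : y ᵥ* (fromCols σ ε).map (eval p) = 0) :
    F.skewMatrix.map (eval p) *ᵥ (y ᵥ* F.generators.map (eval p)) = 0 := by
  classical
  have h2 := congrArg (fun M : Matrix J (ι ⊕ β) S => M.map (eval p)) F.generators_mul_skewMatrix
  simp only [Matrix.map_mul] at h2
  rw [← neg_eq_zero, ← neg_mulVec, ← F.transpose_skewMatrix_map, mulVec_transpose, vecMul_vecMul, h2, ← vecMul_vecMul, hy,
    zero_vecMul]

/-- If `y` annihilates all these columns, evaluation against `y` at `p` kills the orthogonal space,
so it is the pairing with some `g` of degrees `dd j - 2`. It also kills multiples of a linear form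
through `p`, which forces `g = 0` and then `y = 0`. -/
lemma surjective_mulVec_fromCols_generators {p : Fin 3 → ℂ} (hp : p ≠ 0) :
    Function.Surjective
      (fromCols (F.generators.map (eval p)) ((fromCols σ ε).map (eval p))).mulVec := by
  classical
  intro v
  refine exists_mulVec_eq_of_dotProduct _ _ fun y hy => ?_
  have h1 : ∀ h ∈ B.orthogonal, pointFunctional y p h = 0 := fun h hh => by
    rw [F.expand h hh, map_add, map_sum, map_sum]
    have h2 : ∀ i, pointFunctional y p (F.basis i) = 0 := fun i =>
      (pointFunctional_apply _ _ _).trans (congrFun hy (.inl (.inl i)))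
    have h3 : ∀ r, pointFunctional y p (fun j => σ j r) = 0 := fun r =>
      (pointFunctional_apply _ _ _).trans (congrFun hy (.inr (.inl r)))
    simp [h2, h3]
  obtain ⟨g, hg, hgh⟩ := B.exists_form_eq h1
  obtain ⟨c, c', rfl⟩ := exists_cross_eq hp
  have hc : c ≠ 0 := by
    rintro rfl
    simp at hp
  have hg0 : g = 0 := B.eq_zero_of_linearForm hc hg fun v hv => by
    rw [← hgh _ (smul_mem_degreePart (linearForm_mem c) hv (by norm_num)), pointFunctional_smul,
      eval_linearForm, dot_self_cross, zero_mul]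
  have hy0 : y = 0 := by
    ext1 j
    obtain ⟨k, hk⟩ := Function.ne_iff.1 hp
    have h2 : ((MvPolynomial.X k : S) ^ dd j).IsHomogeneous (dd j) := by
      simpa using (MvPolynomial.isHomogeneous_X ℂ k).pow (dd j)
    have h3 := hgh (Pi.single j ((MvPolynomial.X k : S) ^ dd j)) (mem_degreePart_zero.2 fun j' => by
      rcases eq_or_ne j' j with rfl | hj
      · simpa using h2
      · simpa [hj] using MvPolynomial.isHomogeneous_zero _ _ _)
    rw [hg0, map_zero, LinearMap.zero_apply, pointFunctional_apply, dotProduct,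
      Finset.sum_eq_single j (fun j' _ hj => by simp [hj]) (by simp)] at h3
    rw [Pi.single_eq_same, map_pow, MvPolynomial.eval_X] at h3
    exact (mul_eq_zero.1 h3).resolve_right (pow_ne_zero _ hk)
  rw [hy0, zero_dotProduct]

/-- The image of a skew matrix is the annihilator of its kernel, and the kernel consists of the `y
Φ(p)` with `y τ(p) = 0`; such a vector pairs with `v` to `y τ(p) w = 0`. -/
lemma exists_eq_skewMatrix_mulVec {p : Fin 3 → ℂ} (hp : p ≠ 0)
    (hinj : Function.Injective ((fromCols σ ε).map (eval p)).mulVec) {v : ι ⊕ β → ℂ}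
    {w : κ ⊕ β → ℂ}
    (h : F.generators.map (eval p) *ᵥ v = (fromCols σ ε).map (eval p) *ᵥ w) :
    ∃ u, F.skewMatrix.map (eval p) *ᵥ u = v := by
  refine exists_mulVec_eq_of_dotProduct _ _ fun x hx => ?_
  rw [← mulVec_transpose, F.transpose_skewMatrix_map, neg_mulVec, neg_eq_zero] at hx
  obtain ⟨y, hy, rfl⟩ := F.exists_of_skewMatrix_mulVec_eq_zero hp hinj hx
  rw [← dotProduct_mulVec, h, dotProduct_mulVec, hy, zero_dotProduct]

/-- The map `y ↦ y Φ(p)` identifies the left kernel of `τ(p)` with the kernel of the skew matrix; it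
is injective because the columns of `Φ(p)` and `τ(p)` together span. -/
lemma rank_skewMatrix {p : Fin 3 → ℂ} (hp : p ≠ 0)
    (hinj : Function.Injective ((fromCols σ ε).map (eval p)).mulVec) :
    (F.skewMatrix.map (eval p)).rank + Fintype.card J =
      Fintype.card (ι ⊕ β) + Fintype.card (κ ⊕ β) := by
  classical
  let L := LinearMap.ker ((fromCols σ ε).map (eval p)).vecMulLinear
  let K := LinearMap.ker (F.skewMatrix.map (eval p)).mulVecLin
  let f : L →ₗ[ℂ] K := LinearMap.codRestrict K
    ((F.generators.map (eval p)).vecMulLinear ∘ₗ L.subtype) fun y =>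
      F.skewMatrix_mulVec_vecMul y.2
  have hf : Function.Bijective f := by
    constructor
    · rw [injective_iff_map_eq_zero]
      intro y hy
      refine Subtype.ext (dotProduct_eq_zero _ fun v => ?_)
      obtain ⟨x, rfl⟩ := F.surjective_mulVec_fromCols_generators hp v
      have h1 : y.1 ᵥ* F.generators.map (eval p) = 0 := congrArg Subtype.val hy
      have h2 : y.1 ᵥ* (fromCols σ ε).map (eval p) = 0 := y.2
      rw [dotProduct_mulVec, vecMul_fromCols, h1, h2]
      simp
    · intro x
      obtain ⟨y, hy, hxy⟩ := F.exists_of_skewMatrix_mulVec_eq_zero hp hinj x.2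
      exact ⟨⟨y, hy⟩, Subtype.ext hxy.symm⟩
  have h1 := (LinearEquiv.ofBijective f hf).finrank_eq
  have h2 := (F.skewMatrix.map (eval p)).mulVecLin.finrank_range_add_finrank_ker
  have h3 := ((fromCols σ ε).map (eval p)).vecMulLinear.finrank_range_add_finrank_ker
  have h4 := LinearMap.finrank_range_of_inj (f := ((fromCols σ ε).map (eval p)).mulVecLin) hinj
  have h5 := rank_transpose ((fromCols σ ε).map (eval p))
  rw [rank, rank, mulVecLin_transpose, h4] at h5
  rw [h5] at h3
  simp only [Module.finrank_fintype_fun_eq_card] at h2 h3 h4 h5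
  rw [rank]
  change _ + Module.finrank ℂ L = _ at h3
  change _ + Module.finrank ℂ K = _ at h2
  omega

end OrthogonalFrame

end Fibre

section AdaptedBasis

/-- An independent family in a subspace can be completed to a basis, with coordinates which extend
to the whole space. -/
lemma exists_adapted_basis {V κ ι : Type} [AddCommGroup V] [Module ℂ V] [Fintype κ] [Fintype ι]
    [DecidableEq ι] (U : Submodule ℂ V) [FiniteDimensional ℂ U] {v : κ → V}
    (hv : LinearIndependent ℂ v) (hvU : ∀ r, v r ∈ U)
    (hcard : Module.finrank ℂ U = Fintype.card κ + Fintype.card ι) :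
    ∃ (u : ι → V) (f : ι → V →ₗ[ℂ] ℂ) (g : κ → V →ₗ[ℂ] ℂ), (∀ i, u i ∈ U) ∧
      (∀ i i', f i (u i') = if i = i' then 1 else 0) ∧ (∀ i r, f i (v r) = 0) ∧
      ∀ h ∈ U, h = ∑ i, f i h • u i + ∑ r, g r h • v r := by
  classical
  let v' : κ → U := fun r => ⟨v r, hvU r⟩
  have hv' : LinearIndependent ℂ v' := LinearIndependent.of_comp U.subtype hv
  obtain ⟨b, hb⟩ : ∃ b : Module.Basis (κ ⊕ ι) ℂ U, ∀ r, b (.inl r) = v' r := by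
    obtain ⟨C, hC⟩ := (Submodule.span ℂ (Set.range v')).exists_isCompl
    have h1 := Submodule.finrank_add_eq_of_isCompl hC
    rw [finrank_span_eq_card hv', hcard] at h1
    let bC := Module.finBasisOfFinrankEq ℂ C (Nat.add_left_cancel h1)
    let b := ((Module.Basis.span hv').prod (bC.reindex (Fintype.equivFin ι).symm)).map
      (Submodule.prodEquivOfIsCompl _ _ hC)
    refine ⟨b, fun r => ?_⟩
    simp [b, Module.Basis.prod_apply, Module.Basis.span_apply]
  choose f hf using fun i => LinearMap.exists_extend (b.coord (.inr i))
  choose g hg using fun r => LinearMap.exists_extend (b.coord (.inl r))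
  have hf' : ∀ i (h : U), f i h.1 = b.repr h (.inr i) := fun i h => LinearMap.congr_fun (hf i) h
  have hg' : ∀ r (h : U), g r h.1 = b.repr h (.inl r) := fun r h => LinearMap.congr_fun (hg r) h
  refine ⟨fun i => (b (.inr i)).1, f, g, fun i => (b (.inr i)).2, fun i i' => ?_, fun i r => ?_,
    fun h hh => ?_⟩
  · rw [hf', Module.Basis.repr_self, Finsupp.single_apply]
    simp [eq_comm]
  · have h1 := hf' i (v' r)
    rw [← hb, Module.Basis.repr_self, Finsupp.single_apply, if_neg (by simp), hb] at h1
    exact h1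
  · have h1 := congrArg Subtype.val (b.sum_repr ⟨h, hh⟩)
    rw [Submodule.coe_sum, Fintype.sum_sum_type] at h1
    simp only [Submodule.coe_smul, hb, ← hf', ← hg'] at h1
    rw [add_comm]
    exact h1.symm

end AdaptedBasis

/-! ### Assembly of the matrix and its size. -/

section Resolution

variable {J κ β : Type} [Fintype J] [Fintype κ] [Fintype β] {dd : J → ℕ} {σ : Matrix J κ S}
  {ε : Matrix J β S}

/-- The columns of `σ` are orthogonal and linearly independent over `ℂ`, being independent already
at a single point, so they extend to a basis of the orthogonal space. The size of `ι` is the number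
of missing vectors. -/
lemma exists_orthogonalFrame (hσ : ∀ j r, (σ j r).IsHomogeneous (dd j))
    (hε : ∀ j m, (ε j m).IsHomogeneous (dd j + 1))
    (hinj : ∀ p : Fin 3 → ℂ, p ≠ 0 →
      Function.Injective ((fromCols σ ε).map (eval p)).mulVec)
    {ι : Type} [Fintype ι] [DecidableEq ι]
    (hcard : ∑ j, (2 * dd j + 1) = Fintype.card κ + Fintype.card ι) :
    ∃ B : RelationPairing dd (fromCols σ ε), Nonempty (OrthogonalFrame B ι) := by
  classical
  obtain ⟨B⟩ := nonempty_relationPairing (dd := dd) (τ := fromCols σ ε)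
    (ρ := Sum.elim (fun _ => 0) fun _ => 1) (fun j r => by
      rcases r with r | m
      · exact hσ j r
      · exact hε j m) hinj
  have hmem : ∀ r, (fun j => σ j r) ∈ B.orthogonal := fun r =>
    B.mem_orthogonal.2 ⟨mem_degreePart_zero.2 fun j => hσ j r, fun g _ => B.form_column g (.inl r)⟩
  have hind : LinearIndependent ℂ fun r j => σ j r := by
    rw [Fintype.linearIndependent_iff]
    intro x hx
    have hp : (Pi.single 0 1 : Fin 3 → ℂ) ≠ 0 := by simp
    have h1 : (fromCols σ ε).map (eval (Pi.single 0 1)) *ᵥ Sum.elim x 0 = 0 := by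
      ext1 j
      have h2 := congrArg (eval (Pi.single 0 1)) (congrFun hx j)
      simpa [mulVec, dotProduct, Fintype.sum_sum_type, MvPolynomial.smul_eval, mul_comm] using h2
    exact fun r => congrFun (hinj _ hp (h1.trans (mulVec_zero _).symm)) (.inl r)
  obtain ⟨u, f, g, h1, h2, h3, h4⟩ := exists_adapted_basis (ι := ι) B.orthogonal hind hmem
    (B.finrank_orthogonal.trans hcard)
  choose e he hsum using fun m => B.exists_orthogonal_of_form_eq_zero (ε := fun j => ε j m)
    (fun j => hε j m) fun u => B.form_column u (.inr m)
  exact ⟨B, ⟨⟨u, f, g, e, h1, hmem, h2, h3, h4, he, hsum⟩⟩⟩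

/-- Independent relations are resolved, on every fibre, by a skew-symmetric matrix of linear forms
of constant rank. -/
theorem exists_skewLinearMatrix (hσ : ∀ j r, (σ j r).IsHomogeneous (dd j))
    (hε : ∀ j m, (ε j m).IsHomogeneous (dd j + 1))
    (hinj : ∀ p : Fin 3 → ℂ, p ≠ 0 →
      Function.Injective ((fromCols σ ε).map (eval p)).mulVec)
    (hcard : Fintype.card J = 2 + Fintype.card (κ ⊕ β)) {c : ℕ}
    (hc : c = Fintype.card β + ∑ j, dd j) :
    ∃ (A : SkewLinearMatrix (2 * c + 2)) (Φ : Matrix J (Fin (2 * c + 2)) S)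
      (Ψ : Matrix (κ ⊕ β) (Fin (2 * c + 2)) S), A.HasConstantRank (2 * c) ∧
      (∀ j i, (Φ j i).IsHomogeneous (dd j)) ∧
      (∀ r i, (Ψ r i).IsHomogeneous (Sum.elim (fun _ => 1) (fun _ => 0) r : ℕ)) ∧
      Φ * A.mat = fromCols σ ε * Ψ ∧
      ∀ p : Fin 3 → ℂ, p ≠ 0 →
        (∀ v w, Φ.map (eval p) *ᵥ v = (fromCols σ ε).map (eval p) *ᵥ w →
          ∃ u, v = A.mat.map (eval p) *ᵥ u) ∧
        Function.Surjective (fromCols (Φ.map (eval p)) ((fromCols σ ε).map (eval p))).mulVec := by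
  classical
  rw [Fintype.card_sum] at hcard
  -- The orthogonal space has dimension `2 ∑ dd j + |J|` with `|J| = |κ| + |β| + 2`; removing the
  -- `|κ|` columns of `σ` leaves this number. The border by `β` then gives size `2c + 2`.
  obtain ⟨B, ⟨F⟩⟩ := exists_orthogonalFrame (ι := Fin (2 * ∑ j, dd j + Fintype.card β + 2))
    hσ hε hinj (by
      rw [Finset.sum_add_distrib, ← Finset.mul_sum, Fintype.card_fin]
      simp
      omega)
  have hn : Fintype.card (Fin (2 * ∑ j, dd j + Fintype.card β + 2) ⊕ β) = 2 * c + 2 := by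
    rw [Fintype.card_sum, Fintype.card_fin]
    omega
  let e := (Fintype.equivFinOfCardEq hn).symm
  refine ⟨⟨F.skewMatrix.submatrix e e, fun i j => F.linear_skewMatrix _ _, ?_⟩,
    F.generators.submatrix id e, F.relationCoeffs.submatrix id e, fun p hp => ?_,
    fun j i => F.isHomogeneous_generators _ _, fun r i => F.isHomogeneous_relationCoeffs _ _, ?_,
    fun p hp => ⟨fun v w h => ?_, fun y => ?_⟩⟩
  · rw [transpose_submatrix, F.transpose_skewMatrix]
    rfl
  · change ((F.skewMatrix.map (eval p)).submatrix e e).rank = 2 * c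
    have h1 := F.rank_skewMatrix hp (hinj p hp)
    rw [Fintype.card_sum (α := κ), hn] at h1
    rw [rank_submatrix]
    omega
  · change F.generators.submatrix id e * F.skewMatrix.submatrix e e = _
    rw [submatrix_mul_equiv, F.generators_mul_skewMatrix]
    rfl
  · change (F.generators.map (eval p)).submatrix id e *ᵥ v = _ at h
    rw [submatrix_mulVec_equiv] at h
    obtain ⟨u, hu⟩ := F.exists_eq_skewMatrix_mulVec hp (hinj p hp) h
    refine ⟨u ∘ e, ?_⟩
    change v = (F.skewMatrix.map (eval p)).submatrix e e *ᵥ (u ∘ e)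
    rw [submatrix_mulVec_equiv, Function.comp_assoc, Equiv.self_comp_symm, Function.comp_id, hu,
      Function.comp_assoc, Equiv.symm_comp_self, Function.comp_id]
  · obtain ⟨x, rfl⟩ := F.surjective_mulVec_fromCols_generators hp y
    refine ⟨Sum.elim ((x ∘ .inl) ∘ e) (x ∘ .inr), ?_⟩
    change fromCols ((F.generators.map (eval p)).submatrix id e) _ *ᵥ _ = _
    rw [fromCols_mulVec_sumElim, fromCols_mulVec, submatrix_mulVec_equiv, Function.comp_assoc _ e,
      Equiv.self_comp_symm, Function.comp_id, Function.comp_id]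

end Resolution

end PlaneBundle

end

open PlaneBundle

theorem mainTheorem2 (a b : ℕ) (d : Fin a → ℕ) (hd : ∀ j, 1 ≤ d j) (E : P2.Modules)
    (hE : IsVectorBundle E 2)
    (hq : IsQuotientBySections ((⨁ fun j => twist (d j)) ⊞ (⨁ fun _ : Fin b => Q)) E) :
    IsMEffective E ∧ IsSkewCokernel (b + ∑ j, d j) E := by
  obtain ⟨s, σ, hσ, π, w, hex, hepi, hmono⟩ := exists_presentation hq
  have hbundle := fun (p : Fin 3 → ℂ) (hp : p ≠ 0) =>
    card_eq_and_mulVec_injective hE (isHomogeneous_relations hσ) π w hex hp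
  have hcard := (hbundle (Pi.single 0 1) (by simp)).1
  obtain ⟨A, Φ, Ψ, hA, hΦ, hΨ, hrel, h⟩ := exists_skewLinearMatrix hσ
    (isHomogeneous_eulerColumns b d) (fun p hp => (hbundle p hp).2) hcard
    (c := b + ∑ j, d j) (by simp [coverDegree])
  have hcoker : IsSkewCokernel (b + ∑ j, d j) E := ⟨A, hA,
    nonempty_iso_cokernel (isHomogeneous_relations hσ) π w hex A Φ hΦ Ψ _
      (fun r => by rcases r with r | m <;> rfl) hΨ hrel (fun p hp => (hbundle p hp).2)
      (fun p hp => (h p hp).1) fun p hp => (h p hp).2⟩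
  refine ⟨⟨_, ?_, hcoker⟩, hcoker⟩
  by_contra h0
  -- If `c = 0` there are no summands at all, since every `d j` is at least `1`. The cover is then
  -- zero, contradicting that it has two more summands than the relations.
  obtain ⟨rfl, hsum⟩ : b = 0 ∧ ∑ j, d j = 0 := by omega
  have ha : a = 0 := by
    by_contra ha
    have h1 := Finset.sum_eq_zero_iff.1 hsum ⟨0, Nat.pos_of_ne_zero ha⟩ (Finset.mem_univ _)
    have h2 := hd ⟨0, Nat.pos_of_ne_zero ha⟩
    omega
  subst ha
  simp at hcard
  omega
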